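/- A knot is understood as a class of knot diagrams on the sphere \(S^2\) up to planar isotopy and Reidemeister moves. Let \(K\) be a knot that has a reduced alternating diagram. (A diagram is reduced if no region touches a crossing from two opposite sides; the crossingless diagram of the unknot is allowed.) For a diagram \(D\), colour its regions with two colours so that adjacent regions have different colours. The checkerboard graph \(G=(V,E)\) has the regions of one colour as vertices and one edge for each crossing, joining the two regions of that colour at the crossing; \(G^*=(V^*,E^*)\) is the graph for the other colour. Let \(\tilde G=(V,\tilde E)\) and \(\tilde G^*=(V^*,\tilde E^*)\) be the simple graphs obtained from them by keeping one edge out of each class of parallel edges. Let \(n(2)\) and \(n^*(2)\) be the numbers of edges of \(\tilde G\) and \(\tilde G^*\) that have multiplicity at least \(2\) in \(G\) and \(G^*\), let \(\mathrm{tri}\) and \(\mathrm{tri}^*\) be the numbers of triangles in \(\tilde G\) and \(\tilde G^*\), and put \(T(D)=|\tilde E|+|\tilde E^*|-|E|\) (the twist number of \(D\)). Then \(K\) has a Jones polynomial \(V_K\in\mathbb Z[t,t^{-1}]\), that is, \(V_K(A^{-4})=(-A)^{-3w(D)}\langle D\rangle\) for every diagram \(D\) of \(K\), where \(w\) is the writhe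 and \(\langle\cdot\rangle\) the Kauffman bracket, normalised by \(\langle\bigcirc\rangle=1\). Write \(V_K(t)=a_nt^n+a_{n+1}t^{n+1}+\dots+a_mt^m\) with \(a_n\ne0\ne a_m\), and \(a_k=0\) for \(k<n\) and \(k>m\). Then: 1. \(|a_n|=|a_m|=1\). 2. \(|a_{n+1}|+|a_{m-1}|=T(D)\) for every reduced alternating diagram \(D\) of \(K\). 3. For every reduced alternating diagram \(D\) of \(K\), \[|a_{n+2}|+|a_{m-2}|+|a_{m-1}|\,|a_{n+1}|=\frac{T(D)+T(D)^2}{2}+n(2)+n^*(2)-\mathrm{tri}-\mathrm{tri}^*.\] 4. In particular, \(T(D)\) takes the same value for all reduced alternating diagrams \(D\) of \(K\) (and for all choices of the colouring). -/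

import Mathlib

open LaurentPolynomial

noncomputable section

/-!
Knot diagrams on the sphere `S²` as combinatorial maps.

A crossing `x` has four half-edges ("darts") `(x, 0), (x, 1), (x, 2), (x, 3)`, listed
counterclockwise around `x`.  The darts `(x, 0), (x, 2)` belong to the strand passing under, the
darts `(x, 1), (x, 3)` to the strand passing over.  The edges of the diagram are given by a
fixed-point free involution `glue` on the darts.  With no crossings, the structure stands for a
simple closed curve without crossings.
-/

/-- A 4-valent combinatorial map with over/under information at its vertices. -/
structure CrossingMap where
  /-- the number of crossings -/
  n : ℕ
  /-- the two darts of every edge are exchanged -/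
  glue : Equiv.Perm (Fin n × ZMod 4)
  glue_glue : ∀ d, glue (glue d) = d
  glue_ne : ∀ d, glue d ≠ d

namespace CrossingMap

variable (D : CrossingMap)

/-- Half-edges. -/
abbrev Dart : Type := Fin D.n × ZMod 4

/-- The next dart at the same crossing, counterclockwise. -/
def rot : Equiv.Perm D.Dart := Equiv.prodCongr (Equiv.refl _) (Equiv.addRight 1)

/-- The opposite dart at the same crossing: the other half of the same strand. -/
def opp : Equiv.Perm D.Dart := Equiv.prodCongr (Equiv.refl _) (Equiv.addRight 2)

/-- The dart belongs to the overpassing strand of its crossing. -/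
def IsOver (d : D.Dart) : Prop := d.2 = 1 ∨ d.2 = 3

/-- The components of the underlying immersed curve (for `n ≠ 0`): walk along edges, and straight
ahead at crossings. -/
def Component : Type := Quot fun d e : D.Dart => e = D.glue d ∨ e = D.opp d

/-- The regions (faces) of the diagram.  A dart `d` stands for the corner between `d` and the next
dart `rot d`; keeping the region on one side, one goes from this corner along the edge of `rot d` to
the corner at `glue (rot d)`.  A crossingless circle bounds two regions. -/
def Face : Type := (Quot fun d e : D.Dart => e = D.glue (D.rot d)) ⊕ {_b : Bool // D.n = 0}

/-- The region that contains the corner between `d` and `rot d`. -/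
def face (d : D.Dart) : D.Face := Sum.inl (Quot.mk _ d)

end CrossingMap

/-- A knot diagram on the sphere: one component (all darts lie on one closed curve), and Euler
characteristic two, `n - 2 n + (number of regions) = 2`. -/
structure KnotDiagram extends CrossingMap where
  single : Subsingleton toCrossingMap.Component
  planar : Nat.card toCrossingMap.Face = n + 2

namespace CrossingMap

variable (D : CrossingMap)

/-- The diagram is alternating: along the curve, over- and underpasses alternate, i.e. every edge
joins an overpass to an underpass. -/
def IsAlternating : Prop := ∀ d, D.IsOver (D.glue d) ↔ ¬ D.IsOver d

/-- The diagram is reduced: there is no nugatory crossing, i.e. no region touches a crossing from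
two opposite sides. -/
def IsReduced : Prop := ∀ d, D.face d ≠ D.face (D.opp d)

/-! ### Reidemeister moves -/

/-- `f` carries crossings to crossings, respecting the cyclic order and over/under. -/
def RespectsCrossings {D D' : CrossingMap} (f : D.Dart → D'.Dart) : Prop :=
  (∀ d, f (D.rot d) = D'.rot (f d)) ∧ ∀ d, D'.IsOver (f d) ↔ D.IsOver d

/-- `Through S d e`: leaving the crossing of `d` along the edge of `d`, and going straight ahead at
crossings in `S`, one arrives at the dart `e`. -/
inductive Through (S : Set (Fin D.n)) : D.Dart → D.Dart → Prop
  | edge (d : D.Dart) : Through S d (D.glue d)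
  | step {d e : D.Dart} : Through S d e → e.1 ∈ S → Through S d (D.glue (D.opp e))

/-- `D` is obtained from `D'` by erasing the crossings in `S`, joining the strands
straight through. -/
def Erases (D' : CrossingMap) (S : Set (Fin D'.n)) (D : CrossingMap) : Prop :=
  ∃ f : D.Dart ↪ D'.Dart, RespectsCrossings f ∧ Set.range f = {d | d.1 ∉ S} ∧
    ∀ d, D'.Through S (f d) (f (D.glue d))

/-- Orientation preserving isomorphism of diagrams (isotopy of the sphere). -/
def Iso (D D' : CrossingMap) : Prop :=
  ∃ f : D.Dart ≃ D'.Dart, RespectsCrossings f ∧ ∀ d, D'.glue (f d) = f (D.glue d)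

/-- First Reidemeister move: `D` arises from `D'` by removing a kink, i.e. a crossing with a
one-sided region (at the corner `d`). -/
def R1 (D' D : CrossingMap) : Prop :=
  ∃ d : D'.Dart, D'.glue (D'.rot d) = d ∧ D'.Erases {d.1} D

/-- Second Reidemeister move: `D` arises from `D'` by separating two strands which bound a
two-sided region (with corners `d`, `e` at distinct crossings), one of them passing over the other at
both crossings. -/
def R2 (D' D : CrossingMap) : Prop :=
  ∃ d e : D'.Dart, d.1 ≠ e.1 ∧ D'.glue (D'.rot d) = e ∧ D'.glue (D'.rot e) = d ∧
    (D'.IsOver (D'.rot d) ↔ D'.IsOver e) ∧ D'.Erases {d.1, e.1} D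

/-- Given an edge that joins `rot a` to `b`, on the strand with successive darts
`rot⁻¹ a, rot a, b, opp b`, exchange the roles of the two crossings on that strand. -/
def slide (a b : D.Dart) : Equiv.Perm D.Dart :=
  Equiv.swap (D.rot.symm a) b * Equiv.swap (D.rot a) (D.opp b)

/-- Third Reidemeister move: `D` has a three-sided region with corners `a`, `b`, `c` at distinct
crossings, whose three sides do not all go from over to under (so that one of the three strands is
on top, one in the middle, one at the bottom).  In `D'` a strand is moved across the opposite
crossing: each of the three strands meets the two other ones in the reversed order, all else is
unchanged. -/
def R3 (D D' : CrossingMap) : Prop :=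
  ∃ a b c : D.Dart, a.1 ≠ b.1 ∧ b.1 ≠ c.1 ∧ c.1 ≠ a.1 ∧
    D.glue (D.rot a) = b ∧ D.glue (D.rot b) = c ∧ D.glue (D.rot c) = a ∧
    ¬ ((D.IsOver a ↔ D.IsOver b) ∧ (D.IsOver b ↔ D.IsOver c)) ∧
    ∃ f : D.Dart ≃ D'.Dart, RespectsCrossings f ∧
      ∀ d, D'.glue (f (D.slide a b (D.slide b c (D.slide c a d)))) =
        f (D.slide a b (D.slide b c (D.slide c a (D.glue d))))

end CrossingMap

/-- Two knot diagrams differ by a planar isotopy or by one Reidemeister move. -/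
def ReidemeisterMove (D D' : KnotDiagram) : Prop :=
  D.Iso D'.toCrossingMap ∨ D.R1 D'.toCrossingMap ∨ D.R2 D'.toCrossingMap ∨ D.R3 D'.toCrossingMap

/-- Knots: knot diagrams up to (the equivalence relation generated by) Reidemeister moves. -/
def Knot : Type := Quot ReidemeisterMove

/-- The knot represented by a diagram. -/
def KnotDiagram.knot (D : KnotDiagram) : Knot := Quot.mk _ D

/-! ### The Jones polynomial -/

namespace CrossingMap

variable (D : CrossingMap)

/-- The darts pointing in the same direction along an orientation of a component:
if `d` leaves its crossing, then so does `opp (glue d)`. -/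
def Direction : Type := Quot fun d e : D.Dart => e = D.opp (D.glue d)

open Classical in
/-- The sign of a crossing of a knot diagram: it is positive if (for either orientation of the knot)
the outgoing dart of the understrand follows the outgoing dart of the overstrand
counterclockwise. -/
def sign (x : Fin D.n) : ℤ :=
  if (Quot.mk _ (x, 1) : D.Direction) = Quot.mk _ (x, 2) then 1 else -1

/-- The writhe. -/
def writhe : ℤ := ∑ x, D.sign x

/-- The smoothing of all crossings in a state `s`.  At a crossing with `s x = true`, it joins
the regions swept by the overstrand when turned counterclockwise (`A`-smoothing, connecting the darts
`0, 1` and `2, 3`); otherwise the other two (`B`-smoothing, connecting `1, 2` and `3, 0`). -/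
def smooth (s : Fin D.n → Bool) (d : D.Dart) : D.Dart :=
  (d.1, (if s d.1 then 1 else 3) - d.2)

/-- The number of circles in the state `s`. -/
def circles (s : Fin D.n → Bool) : ℕ :=
  Nat.card (Quot fun d e : D.Dart => e = D.glue d ∨ e = D.smooth s d) + if D.n = 0 then 1 else 0

/-- The Kauffman bracket, a Laurent polynomial in `A = T 1`, with value `1` on the circle. -/
def bracket : ℤ[T;T⁻¹] :=
  ∑ s : Fin D.n → Bool, (∏ x, T (if s x then 1 else -1)) * (- T 2 - T (-2)) ^ (D.circles s - 1)

/-- The writhe-normalised bracket `(-A)^(-3 w) ⟨D⟩`. -/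
def normalizedBracket : ℤ[T;T⁻¹] :=
  (-1) ^ D.writhe.natAbs * T (-3 * D.writhe) * D.bracket

end CrossingMap

/-- `V` is the Jones polynomial of `K`: for each diagram `D` of `K`, substituting `t = A⁻⁴` in `V(t)`
gives `(-A)^(-3 w) ⟨D⟩`. -/
def Knot.IsJonesPolynomial (K : Knot) (V : ℤ[T;T⁻¹]) : Prop :=
  ∀ D : KnotDiagram, D.knot = K →
    LaurentPolynomial.eval₂ (C : ℤ →+* ℤ[T;T⁻¹]) (isUnit_T (-4)).unit V = D.normalizedBracket

/-! ### Multigraphs -/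

namespace Graph

variable {α β : Type*} (G : Graph α β)

/-- The multiplicity of an edge of the underlying simple graph: the number of edges of the
multigraph with these ends. -/
def multiplicity (e : Sym2 G.vertexSet) : ℕ :=
  {x : β | ∃ u v : G.vertexSet, e = s(u, v) ∧ G.IsLink x u v}.ncard

/-- The number `n(j)` of edges of multiplicity at least `j` in the underlying simple graph. -/
def numMultiple (j : ℕ) : ℕ := {e ∈ G.toSimpleGraph.edgeSet | j ≤ G.multiplicity e}.ncard

/-- The number of edges of the underlying simple graph. -/
def numSimpleEdges : ℕ := G.toSimpleGraph.edgeSet.ncard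

/-- The number of triangles in the underlying simple graph. -/
def numTriangles : ℕ := (G.toSimpleGraph.cliqueSet 3).ncard

end Graph

/-! ### Checkerboard graphs and the twist number -/

/-- A checkerboard colouring: adjacent regions have different colours. -/
structure CheckerboardColoring (D : CrossingMap) where
  color : D.Face → Bool
  rot_ne : ∀ d, color (D.face (D.rot d)) ≠ color (D.face d)
  circle_ne : ∀ h : D.n = 0, color (Sum.inr ⟨true, h⟩) ≠ color (Sum.inr ⟨false, h⟩)

namespace CheckerboardColoring

variable {D : CrossingMap} (c : CheckerboardColoring D)

theorem color_add_two (x : Fin D.n) (i : ZMod 4) :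
    c.color (D.face (x, i + 2)) = c.color (D.face (x, i)) := by
  have h1 : c.color (D.face (x, i + 1)) ≠ c.color (D.face (x, i)) := c.rot_ne (x, i)
  have h2 : c.color (D.face (x, i + 1 + 1)) ≠ c.color (D.face (x, i + 1)) := c.rot_ne (x, i + 1)
  have h3 : i + 1 + 1 = i + 2 := by ring
  rw [h3] at h2
  exact (Bool.eq_not_of_ne h2).trans ((Bool.eq_not_of_ne h1.symm).symm)

/-- An alternating diagram has a checkerboard colouring: the region at the corner between `d` and
`rot d` is coloured according to whether `d` is over or under. -/
theorem nonempty_of_isAlternating (h : D.IsAlternating) : Nonempty (CheckerboardColoring D) := by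
  classical
  have hrot : ∀ d : D.Dart, D.IsOver (D.rot d) ↔ ¬ D.IsOver d := by
    rintro ⟨x, i⟩
    change (i + 1 = 1 ∨ i + 1 = 3) ↔ ¬ (i = 1 ∨ i = 3)
    revert i; decide
  refine ⟨⟨Sum.elim (Quot.lift (fun d => decide (D.IsOver d)) ?_) (fun b => b.1), ?_, ?_⟩⟩
  · rintro d e rfl
    simp [h (D.rot d), hrot]
  · intro d
    change decide (D.IsOver (D.rot d)) ≠ decide (D.IsOver d)
    simp [hrot]
  · intro _
    simp

/-- The checkerboard graph of colour `b`: the vertices are the regions of colour `b`; each crossing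
is an edge, which joins the two regions of colour `b` on opposite sides of the crossing. -/
def graph (b : Bool) : Graph D.Face (Fin D.n) where
  vertexSet := {F | c.color F = b}
  edgeSet := Set.univ
  IsLink x F H := ∃ i : ZMod 4, c.color (D.face (x, i)) = b ∧ D.face (x, i) = F ∧
    D.face (x, i + 2) = H
  isLink_symm := by
    rintro x -
    refine ⟨?_⟩
    rintro F H ⟨i, hi, rfl, rfl⟩
    refine ⟨i + 2, by rw [c.color_add_two, hi], rfl, ?_⟩
    rw [show i + 2 + 2 = i by rw [add_assoc, show (2 + 2 : ZMod 4) = 0 from rfl, add_zero]]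
  eq_or_eq_of_isLink_of_isLink := by
    rintro x _ _ _ _ ⟨i, hi, rfl, rfl⟩ ⟨j, hj, rfl, rfl⟩
    have h : j = i ∨ j = i + 1 ∨ j = i + 2 ∨ j = i + 2 + 1 := by
      clear hi hj; revert i j; decide
    have h1 := c.rot_ne (x, i)
    have h3 := c.rot_ne (x, i + 2)
    have h2 := c.color_add_two x i
    rcases h with rfl | rfl | rfl | rfl
    · exact Or.inl rfl
    · exact absurd (hj.trans hi.symm) h1
    · right
      rw [show i + 2 + 2 = i by rw [add_assoc, show (2 + 2 : ZMod 4) = 0 from rfl, add_zero]]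
    · exact absurd (hj.trans (h2.trans hi).symm) h3
  edge_mem_iff_exists_isLink := by
    intro x
    refine ⟨fun _ => ?_, fun _ => Set.mem_univ _⟩
    by_cases h : c.color (D.face (x, 0)) = b
    · exact ⟨_, _, 0, h, rfl, rfl⟩
    · refine ⟨_, _, 1, ?_, rfl, rfl⟩
      have h1 : c.color (D.face (x, 0 + 1)) ≠ c.color (D.face (x, 0)) := c.rot_ne (x, 0)
      rw [zero_add] at h1
      exact (Bool.eq_not_of_ne h1).trans (Bool.eq_not_of_ne (Ne.symm h)).symm
  left_mem_of_isLink := by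
    rintro x F H ⟨i, hi, rfl, -⟩
    exact hi

/-- The twist number `|Ẽ| + |Ẽ*| - |E|` of a diagram, from its two checkerboard graphs. -/
def twistNumber : ℤ :=
  (c.graph true).numSimpleEdges + (c.graph false).numSimpleEdges - (c.graph true).edgeSet.ncard

end CheckerboardColoring

end

/-!
The proof has three independent parts.

*Invariance.* The normalised bracket does not change under isotopies and Reidemeister moves
(`KnotDiagram.normalizedBracket_eq_of_knot_eq`). This is Kauffman's argument. The circles of a state
are the classes of darts under two involutions, the gluing of edges and the smoothing
(`loops`), so that each move reduces to a comparison of such numbers of classes for the states of the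
few crossings involved. A crossing cuts off the corner at a dart `d` or not (`CrossingMap.Caps`),
which makes the three moves independent of which strand is on top. For the first two moves the
smoothed crossings are compared with their removal (`CrossingMap.circles_eq_loops_smoothOff`). For
the third one, the states with no or one corner cut off are compared before and after the move as
local patterns of twelve ends (`loops_eq_of_table`), and the others are reduced to these, as a
circle inside a triangle merges with another one if a smoothing is changed
(`CrossingMap.IsTriangle.loops_eq`).

*The bracket of an alternating diagram.* If the diagram is alternating, then the constant states cut
off all corners of one colour. A set `S` of crossings, that is, of edges of the checkerboard graph
with vertex set `V`, describes the state that differs from such a constant state at `S`. It has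
`|S| + 2 k(S) - |V|` circles, where `k(S)` is the number of components of the graph `(V, S)`
(`KnotDiagram.circles_add_card`): if a further crossing joins two components, then the number of
circles drops by one, and otherwise it rises by at most one; equality holds throughout, since it holds
for the two constant states together by Euler's formula. Hence the bracket is, up to a shift,
`∑_S (-1)^(|S| + |V| + 1) X^r(S) (1 + X)^(|S| + 2 k(S) - |V| - 1)` in `X = A^(-4)`, with
`r(S) = |V| - k(S)` (`statePoly`, `KnotDiagram.bracket_eq`), and likewise with `X = A^4` for the other
colour. That the exponents of the normalised bracket are divisible by four (`KnotDiagram.four_dvd`)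
follows from the parity of the number of Seifert circles: the orientation is a common transversal of
the matchings of the darts given by the edges, the strands and the Seifert state, and the signs of
the three first return maps multiply (`even_loops_add`).

*The coefficients.* Only the sets `S` of rank at most `i` contribute to the `i`-th coefficient of
the state polynomial. Group them by the underlying set `F` of simple edges; the signed number of sets
`S` over a given `F` is `(-1)^|F|` (`sum_neg_one_pow_image_eq`). Rank at most two means at most two
edges, or a triangle. With the cycle rank `r = |Ẽ| - |V| + 1`, the first three coefficients are,
up to a common sign, `1`, `-r` and `r (r + 1) / 2 + n(2) - tri`. The last one is not negative, as a
graph of cycle rank `r` has at most `r (r + 1) / 2` triangles (`two_mul_numTri_le`): insert the edges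
one by one, and note that an edge with `k` common neighbours of its ends closes `k` triangles, where
the cycle rank was at least `k - 1` before. The two cycle ranks `r`, `r*` add up to the twist number
by Euler's formula, and the assertions follow from
`(T + T²) / 2 = r (r + 1) / 2 + r* (r* + 1) / 2 + r r*` for `T = r + r*`.
-/

noncomputable section

/-! ### Counting the classes of a relation -/

theorem Nat.card_quot_congr {X : Type*} {r r' : X → X → Prop}
    (h : ∀ x y, r x y → Quot.mk r' x = Quot.mk r' y)
    (h' : ∀ x y, r' x y → Quot.mk r x = Quot.mk r y) :
    Nat.card (Quot r) = Nat.card (Quot r') :=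
  Nat.card_congr
    { toFun := Quot.lift (Quot.mk r') h
      invFun := Quot.lift (Quot.mk r) h'
      left_inv := by rintro ⟨x⟩; rfl
      right_inv := by rintro ⟨x⟩; rfl }

/-- Identifying two inequivalent points lowers the number of classes by one. -/
theorem Nat.card_quot_merge {X : Type*} [Finite X] {r r' : X → X → Prop} {a b : X}
    (hab : Quot.mk r a ≠ Quot.mk r b)
    (hr : ∀ x y, r x y → Quot.mk r' x = Quot.mk r' y) (hr' : Quot.mk r' a = Quot.mk r' b)
    (h : ∀ x y, r' x y → Quot.mk r x = Quot.mk r y ∨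
      (Quot.mk r x = Quot.mk r a ∧ Quot.mk r y = Quot.mk r b) ∨
      (Quot.mk r x = Quot.mk r b ∧ Quot.mk r y = Quot.mk r a)) :
    Nat.card (Quot r) = Nat.card (Quot r') + 1 := by
  classical
  have e : {q : Quot r // q ≠ Quot.mk r b} ≃ Quot r' :=
    { toFun := fun q => Quot.lift (Quot.mk r') hr q.1
      invFun := Quot.lift
        (fun x => if hx : Quot.mk r x = Quot.mk r b then ⟨Quot.mk r a, hab⟩ else ⟨Quot.mk r x, hx⟩)
        (by
          intro x y hxy
          rcases h x y hxy with h | ⟨h1, h2⟩ | ⟨h1, h2⟩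
          · simp [h]
          · simp [h1, h2, hab]
          · simp [h1, h2, hab])
      left_inv := by
        rintro ⟨⟨x⟩, hx⟩
        exact dif_neg hx
      right_inv := by
        rintro ⟨x⟩
        change Quot.lift (Quot.mk r') hr (Subtype.val (dite _ _ _)) = _
        split_ifs with hx
        · change Quot.mk r' a = _
          rw [hr']
          exact (congrArg (Quot.lift (Quot.mk r') hr) hx).symm
        · rfl }
  have := Fintype.ofFinite (Quot r)
  rw [← Nat.card_congr e, Nat.card_eq_fintype_card, Nat.card_eq_fintype_card,
    Fintype.card_subtype_compl, Fintype.card_subtype_eq]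
  have : 0 < Fintype.card (Quot r) := Fintype.card_pos_iff.2 ⟨Quot.mk r b⟩
  omega

/-- Two relations have equally many classes if each of them admits a retraction, along its own
classes, onto a common set of points, and each retraction turns its own relation into the other. -/
theorem Nat.card_quot_retract {X : Type*} {r₁ r₂ : X → X → Prop} (ρ₁ ρ₂ : X → X)
    (h₁ : ∀ x, Quot.mk r₁ (ρ₁ x) = Quot.mk r₁ x) (h₂ : ∀ x, Quot.mk r₂ (ρ₂ x) = Quot.mk r₂ x)
    (h₁₂ : ∀ x y, r₁ x y → Quot.mk r₂ (ρ₁ x) = Quot.mk r₂ (ρ₁ y))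
    (h₂₁ : ∀ x y, r₂ x y → Quot.mk r₁ (ρ₂ x) = Quot.mk r₁ (ρ₂ y))
    (hρ₁ : ∀ x, ρ₂ (ρ₁ x) = ρ₁ x) (hρ₂ : ∀ x, ρ₁ (ρ₂ x) = ρ₂ x) :
    Nat.card (Quot r₁) = Nat.card (Quot r₂) :=
  Nat.card_congr
    { toFun := Quot.lift (fun x => Quot.mk r₂ (ρ₁ x)) h₁₂
      invFun := Quot.lift (fun x => Quot.mk r₁ (ρ₂ x)) h₂₁
      left_inv := by rintro ⟨x⟩; simp [hρ₁, h₁]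
      right_inv := by rintro ⟨x⟩; simp [hρ₂, h₂] }

/-! ### Closed curves of two matchings -/

/-- `loops g m` is the number of closed curves made up of `g`-arcs and `m`-arcs: a `g`-arc joins `d` to
`g d`, an `m`-arc joins `d` to `m d`. -/
def loops {X : Type*} (g m : X → X) : ℕ := Nat.card (Quot fun d e : X => e = g d ∨ e = m d)

/-- The closed curve through a point. -/
abbrev loopOf {X : Type*} (g m : X → X) (d : X) : Quot fun d e : X => e = g d ∨ e = m d :=
  Quot.mk _ d

@[simp]
theorem loopOf_left {X : Type*} (g m : X → X) (d : X) : loopOf g m (g d) = loopOf g m d := by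
  symm; apply Quot.sound; exact Or.inl rfl

@[simp]
theorem loopOf_right {X : Type*} (g m : X → X) (d : X) : loopOf g m (m d) = loopOf g m d := by
  symm; apply Quot.sound; exact Or.inr rfl

theorem loops_conj {X Y : Type*} (e : X ≃ Y) {g m : X → X} {g' m' : Y → Y}
    (hg : ∀ x, g' (e x) = e (g x)) (hm : ∀ x, m' (e x) = e (m x)) : loops g m = loops g' m' :=
  Nat.card_congr <| Quot.congr e fun x y => by simp [hg, hm]

theorem quot_mk_perm_eq_iff {X : Type*} [Finite X] (σ : Equiv.Perm X) (x y : X) :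
    (Quot.mk (fun x y => y = σ x) x = Quot.mk _ y) ↔ σ.SameCycle x y := by
  constructor
  · intro h
    rw [Quot.eq] at h
    induction h with
    | rel a b h => subst h; exact Equiv.Perm.sameCycle_apply_right.2 (.refl _ _)
    | refl => exact .refl _ _
    | symm _ _ _ h => exact h.symm
    | trans _ _ _ _ _ h1 h2 => exact h1.trans h2
  · intro h
    obtain ⟨k, -, rfl⟩ := h.exists_pow_eq'
    clear h
    induction k with
    | zero => rfl
    | succ k ih => rw [ih, pow_succ', Equiv.Perm.mul_apply]; exact Quot.sound rfl

/-- The orbits of a permutation are its cycles and its fixed points. -/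
theorem card_quot_perm {X : Type*} [Fintype X] [DecidableEq X] (σ : Equiv.Perm X) :
    Nat.card (Quot fun x y => y = σ x) =
      σ.cycleType.card + Fintype.card (Function.fixedPoints σ) := by
  classical
  have e : Quot (fun x y => y = σ x) ≃ (σ.cycleFactorsFinset ⊕ Function.fixedPoints σ) := by
    refine Equiv.ofBijective (Quot.lift (fun x => if h : σ x = x then Sum.inr ⟨x, h⟩ else
      Sum.inl ⟨σ.cycleOf x,
        Equiv.Perm.cycleOf_mem_cycleFactorsFinset_iff.2 (Equiv.Perm.mem_support.2 h)⟩) ?_) ⟨?_, ?_⟩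
    · rintro x _ rfl
      by_cases h : σ x = x
      · simp [h]
      · simp [h]
    · rintro ⟨x⟩ ⟨y⟩ hxy
      change dite _ _ _ = dite _ _ _ at hxy
      by_cases h : σ x = x <;> by_cases h' : σ y = y <;> simp [h, h'] at hxy
      · exact congrArg _ (congrArg Subtype.val hxy)
      · rw [quot_mk_perm_eq_iff]
        by_contra hne
        have : σ.cycleOf x y = σ y := by rw [hxy, Equiv.Perm.cycleOf_apply_self]
        rw [Equiv.Perm.cycleOf_apply_of_not_sameCycle hne] at this
        exact h' this.symm
    · rintro (⟨c, hc⟩ | ⟨x, hx⟩)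
      · obtain ⟨x, hx⟩ := (Equiv.Perm.mem_cycleFactorsFinset_iff.1 hc).1.nonempty_support
        refine ⟨Quot.mk _ x, ?_⟩
        have h := Equiv.Perm.mem_support.1 (Equiv.Perm.mem_cycleFactorsFinset_support_le hc hx)
        have := Equiv.Perm.cycle_is_cycleOf hx hc
        simp [h, this]
      · refine ⟨Quot.mk _ x, ?_⟩
        have hx' : σ x = x := hx
        simp [hx']
  rw [Nat.card_congr e, Nat.card_sum, Nat.card_eq_fintype_card, Nat.card_eq_fintype_card,
    Equiv.Perm.cycleType_def, Multiset.card_map]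
  simp

/-- The sign of a permutation is determined by its number of orbits. -/
theorem sign_eq_neg_one_pow {X : Type*} [Fintype X] [DecidableEq X] (σ : Equiv.Perm X) :
    σ.sign = (-1) ^ (Fintype.card X + Nat.card (Quot fun x y => y = σ x)) := by
  classical
  rw [card_quot_perm, σ.card_fixedPoints, Equiv.Perm.sign_of_cycleType]
  have h : σ.cycleType.sum ≤ Fintype.card X := by
    rw [Equiv.Perm.sum_cycleType]; exact Finset.card_le_univ _
  obtain ⟨k, hk⟩ := Nat.exists_eq_add_of_le h
  rw [hk, show σ.cycleType.sum + k + (σ.cycleType.card + (σ.cycleType.sum + k - σ.cycleType.sum))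
    = (σ.cycleType.sum + σ.cycleType.card) + 2 * k by omega, pow_add _ _ (2 * k)]
  simp

section Transversal

variable {X : Type*} {g m m' : X → X} {Z : X → Prop}

/-- The first return map to a set `Z` that contains exactly one end of every `g`-arc and of every
`m`-arc. -/
def firstReturn (hg : ∀ d, g (g d) = d) (hm : ∀ d, m (m d) = d) (hgZ : ∀ d, Z (g d) ↔ ¬ Z d)
    (hmZ : ∀ d, Z (m d) ↔ ¬ Z d) : Equiv.Perm {d // Z d} where
  toFun d := ⟨m (g d), by rw [hmZ, hgZ]; exact not_not.2 d.2⟩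
  invFun d := ⟨g (m d), by rw [hgZ, hmZ]; exact not_not.2 d.2⟩
  left_inv d := by simp [hg, hm]
  right_inv d := by simp [hg, hm]

/-- Every closed curve meets `Z` in one orbit of the first return map. -/
theorem loops_eq_card_orbits (hg : ∀ d, g (g d) = d) (hm : ∀ d, m (m d) = d)
    (hgZ : ∀ d, Z (g d) ↔ ¬ Z d) (hmZ : ∀ d, Z (m d) ↔ ¬ Z d) :
    loops g m = Nat.card (Quot fun x y => y = firstReturn hg hm hgZ hmZ x) := by
  classical
  refine Nat.card_congr
    { toFun := Quot.lift (fun d => if h : Z d then Quot.mk _ ⟨d, h⟩ else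
        Quot.mk _ ⟨g d, (hgZ d).2 h⟩) ?_
      invFun := Quot.lift (fun d => Quot.mk _ d.1) ?_
      left_inv := ?_
      right_inv := ?_ }
  · rintro d _ (rfl | rfl)
    · by_cases h : Z d
      · simp [h, hgZ, hg]
      · simp [h, hgZ]
    · by_cases h : Z d
      · simp only [h, hmZ, not_true, dite_true, dite_false]
        symm
        apply Quot.sound
        ext; simp [firstReturn, hg, hm]
      · simp only [h, hmZ, not_false_eq_true, dite_true, dite_false]
        apply Quot.sound
        ext; simp [firstReturn, hg]
  · rintro ⟨d, hd⟩ _ rfl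
    exact ((loopOf_right g m (g d)).trans (loopOf_left g m d)).symm
  · rintro ⟨d⟩
    change Quot.lift _ _ (dite _ _ _) = _
    split_ifs with h
    · rfl
    · exact loopOf_left g m d
  · rintro ⟨d, hd⟩
    simp [hd]

theorem loops_self [Finite X] (hm : ∀ d, m (m d) = d) (hmZ : ∀ d, Z (m d) ↔ ¬ Z d) :
    loops m m = Nat.card {d // Z d} := by
  rw [loops_eq_card_orbits hm hm hmZ hmZ]
  symm
  refine Nat.card_congr (Equiv.ofBijective (Quot.mk _) ⟨?_, Quot.mk_surjective⟩)
  intro x y h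
  have := congrArg (Quot.lift id (by rintro x _ rfl; ext; simp [firstReturn, hm])) h
  exact this

/-- The numbers of closed curves obtained from any two of three matchings have a determined sum
modulo two, as long as the matchings have a common transversal: the signs of the three
first return maps multiply. -/
theorem even_loops_add [Finite X] {m m' : X → X} (hg : ∀ d, g (g d) = d) (hm : ∀ d, m (m d) = d)
    (hm' : ∀ d, m' (m' d) = d) (hgZ : ∀ d, Z (g d) ↔ ¬ Z d) (hmZ : ∀ d, Z (m d) ↔ ¬ Z d)
    (hm'Z : ∀ d, Z (m' d) ↔ ¬ Z d) :
    Even (loops g m + loops m m' + loops g m' + Nat.card {d // Z d}) := by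
  classical
  have := Fintype.ofFinite X
  have h : firstReturn hg hm' hgZ hm'Z =
      firstReturn hm hm' hmZ hm'Z * firstReturn hg hm hgZ hmZ := by
    ext d; simp [firstReturn, hm]
  have h2 := congrArg Equiv.Perm.sign h
  rw [map_mul, sign_eq_neg_one_pow, sign_eq_neg_one_pow, sign_eq_neg_one_pow,
    ← loops_eq_card_orbits, ← loops_eq_card_orbits, ← loops_eq_card_orbits, ← pow_add] at h2
  rw [Nat.card_eq_fintype_card]
  generalize Fintype.card {d // Z d} = z at *
  rcases Nat.even_or_odd (z + loops g m') with h3 | h3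
  · rw [h3.neg_one_pow, eq_comm, neg_one_pow_eq_one_iff_even (by decide)] at h2
    revert h2 h3; simp only [Nat.even_iff]; omega
  · rw [h3.neg_one_pow, eq_comm, neg_one_pow_eq_neg_one_iff_odd (by decide)] at h2
    revert h2 h3; simp only [Nat.even_iff, Nat.odd_iff]; omega

end Transversal

namespace CrossingMap

variable {D D' : CrossingMap}

/-! ### Darts and smoothings -/

instance : DecidablePred D.IsOver := fun _ => inferInstanceAs (Decidable (_ ∨ _))

@[simp] theorem rot_fst (d : D.Dart) : (D.rot d).1 = d.1 := rfl
@[simp] theorem opp_fst (d : D.Dart) : (D.opp d).1 = d.1 := rfl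
@[simp] theorem rot_symm_fst (d : D.Dart) : (D.rot.symm d).1 = d.1 := rfl
theorem rot_snd (d : D.Dart) : (D.rot d).2 = d.2 + 1 := rfl
theorem opp_snd (d : D.Dart) : (D.opp d).2 = d.2 + 2 := rfl
theorem rot_symm_eq (d : D.Dart) : D.rot.symm d = (d.1, d.2 - 1) := by
  rw [Equiv.symm_apply_eq]
  exact Prod.ext rfl (by rw [rot_snd, sub_add_cancel])

theorem rot_symm_snd (d : D.Dart) : (D.rot.symm d).2 = d.2 - 1 := by rw [rot_symm_eq]

@[simp]
theorem rot_rot (d : D.Dart) : D.rot (D.rot d) = D.opp d :=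
  Prod.ext rfl (by rw [rot_snd, rot_snd, opp_snd, add_assoc]; rfl)

@[simp]
theorem opp_opp (d : D.Dart) : D.opp (D.opp d) = d :=
  Prod.ext rfl (by rw [opp_snd, opp_snd, add_assoc, show (2 + 2 : ZMod 4) = 0 from rfl, add_zero])

@[simp]
theorem rot_opp (d : D.Dart) : D.rot (D.opp d) = D.rot.symm d :=
  Prod.ext rfl (by rw [rot_snd, opp_snd, rot_symm_snd, add_assoc, sub_eq_add_neg]; rfl)

@[simp]
theorem opp_rot (d : D.Dart) : D.opp (D.rot d) = D.rot.symm d := by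
  rw [← rot_opp, ← rot_rot, ← rot_rot]

@[simp]
theorem opp_rot_symm (d : D.Dart) : D.opp (D.rot.symm d) = D.rot d := by
  rw [← opp_rot, opp_opp]

@[simp]
theorem rot_symm_opp (d : D.Dart) : D.rot.symm (D.opp d) = D.rot d := by
  rw [← rot_opp, opp_opp]

theorem rot_ne (d : D.Dart) : D.rot d ≠ d := fun h => by
  have := congrArg Prod.snd h
  rw [rot_snd] at this
  revert this; generalize d.2 = i; revert i; decide

theorem opp_ne (d : D.Dart) : D.opp d ≠ d := fun h => by
  have := congrArg Prod.snd h
  rw [opp_snd] at this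
  revert this; generalize d.2 = i; revert i; decide

theorem rot_symm_ne (d : D.Dart) : D.rot.symm d ≠ d := fun h =>
  rot_ne d ((Equiv.symm_apply_eq _).1 h).symm

theorem rot_symm_ne_rot (d : D.Dart) : D.rot.symm d ≠ D.rot d := by
  rw [← opp_rot]; exact opp_ne _

theorem rot_ne_opp (d : D.Dart) : D.rot d ≠ D.opp d := by
  rw [← rot_rot]; exact (rot_ne _).symm

theorem eq_of_fst_eq {d e : D.Dart} (h : e.1 = d.1) :
    e = d ∨ e = D.rot d ∨ e = D.opp d ∨ e = D.rot.symm d := by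
  obtain ⟨x, i⟩ := d
  obtain ⟨y, j⟩ := e
  obtain rfl : y = x := h
  have : j = i ∨ j = i + 1 ∨ j = i + 2 ∨ j = i - 1 := by revert i j; decide
  rcases this with rfl | rfl | rfl | rfl
  exacts [Or.inl rfl, Or.inr (Or.inl rfl), Or.inr (Or.inr (Or.inl rfl)),
    Or.inr (Or.inr (Or.inr (rot_symm_eq (D := D) (y, i)).symm))]

@[simp]
theorem isOver_rot (d : D.Dart) : D.IsOver (D.rot d) ↔ ¬ D.IsOver d := by
  obtain ⟨x, i⟩ := d
  change (i + 1 = 1 ∨ i + 1 = 3) ↔ ¬ (i = 1 ∨ i = 3)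
  revert i; decide

@[simp]
theorem isOver_opp (d : D.Dart) : D.IsOver (D.opp d) ↔ D.IsOver d := by
  rw [← rot_rot, isOver_rot, isOver_rot, not_not]

@[simp]
theorem isOver_rot_symm (d : D.Dart) : D.IsOver (D.rot.symm d) ↔ ¬ D.IsOver d := by
  rw [← rot_opp, isOver_rot, isOver_opp]

/-- In the state `s`, the crossing is smoothed so that an arc cuts off the corner between `d` and
`rot d`. Whether this is the `A`-smoothing depends on whether `d` is over or under. -/
def Caps (s : Fin D.n → Bool) (d : D.Dart) : Prop := s d.1 = true ↔ ¬ D.IsOver d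

instance (s : Fin D.n → Bool) : DecidablePred (Caps s) := fun _ =>
  inferInstanceAs (Decidable (_ ↔ _))

@[simp]
theorem caps_rot (s : Fin D.n → Bool) (d : D.Dart) : Caps s (D.rot d) ↔ ¬ Caps s d := by
  simp only [Caps, isOver_rot, rot_fst]; tauto

@[simp]
theorem caps_opp (s : Fin D.n → Bool) (d : D.Dart) : Caps s (D.opp d) ↔ Caps s d := by
  simp only [Caps, isOver_opp, opp_fst]

theorem smooth_eq (s : Fin D.n → Bool) (d : D.Dart) :
    D.smooth s d = if Caps s d then D.rot d else D.rot.symm d := by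
  obtain ⟨x, i⟩ := d
  have h : ∀ (b : Bool) (i : ZMod 4), (if b then 1 else 3) - i =
      if (b = true ↔ ¬ (i = 1 ∨ i = 3)) then i + 1 else i - 1 := by decide
  have h2 := h (s x) i
  unfold Caps smooth IsOver
  rw [rot_symm_eq]
  change (x, _) = ite (s x = true ↔ ¬ (i = 1 ∨ i = 3)) (x, i + 1) (x, i - 1)
  rw [h2]
  split_ifs <;> rfl

theorem smooth_of_caps {s : Fin D.n → Bool} {d : D.Dart} (h : Caps s d) :
    D.smooth s d = D.rot d := by rw [smooth_eq, if_pos h]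

theorem smooth_of_not_caps {s : Fin D.n → Bool} {d : D.Dart} (h : ¬ Caps s d) :
    D.smooth s d = D.rot.symm d := by rw [smooth_eq, if_neg h]

@[simp]
theorem smooth_fst (s : Fin D.n → Bool) (d : D.Dart) : (D.smooth s d).1 = d.1 := rfl

@[simp]
theorem smooth_smooth (s : Fin D.n → Bool) (d : D.Dart) : D.smooth s (D.smooth s d) = d :=
  Prod.ext rfl (sub_sub_cancel _ _)

theorem smooth_congr {s s' : Fin D.n → Bool} {d : D.Dart} (h : s d.1 = s' d.1) :
    D.smooth s d = D.smooth s' d := by simp [smooth, h]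

theorem circles_eq_loops (s : Fin D.n → Bool) :
    D.circles s = loops D.glue (D.smooth s) + if D.n = 0 then 1 else 0 := rfl

/-! ### Orientations -/

/-- The direction in which a dart leaves its crossing. -/
def dir (d : D.Dart) : D.Direction := Quot.mk _ d

@[simp]
theorem dir_opp_glue (d : D.Dart) : dir (D.opp (D.glue d)) = dir d := by
  symm; apply Quot.sound; rfl

theorem dir_glue (d : D.Dart) : dir (D.glue d) = dir (D.opp d) := by
  rw [← dir_opp_glue (D.glue d), D.glue_glue]

theorem dir_opp_eq {d e : D.Dart} (h : dir d = dir e) : dir (D.opp d) = dir (D.opp e) := by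
  refine congrArg (Quot.lift (fun d => dir (D.opp d)) ?_) h
  rintro d _ rfl
  rw [opp_opp, dir_glue]

/-- A strand is not traversed in both directions along an orientation: `opp` inverts the permutation
`φ = opp ∘ glue`, so that if `opp d = φ ^ k d`, then halfway between the two a fixed point of `opp` or
of `glue` would occur. -/
theorem dir_opp_ne (d : D.Dart) : dir (D.opp d) ≠ dir d := by
  intro h
  set φ : Equiv.Perm D.Dart := D.glue.trans D.opp with hφ
  have hc : φ.SameCycle d (D.opp d) := (quot_mk_perm_eq_iff φ _ _).1 h.symm
  have hinv : ∀ d, D.opp (φ d) = φ⁻¹ (D.opp d) := by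
    intro d
    rw [Equiv.Perm.eq_inv_iff_eq]
    simp [hφ, D.glue_glue]
  have hinv' : ∀ (k : ℤ) d, D.opp ((φ ^ k) d) = (φ ^ (-k)) (D.opp d) := by
    have h1 : D.opp * φ = φ⁻¹ * D.opp := by ext1 d; exact hinv d
    have h2 : ∀ k : ℤ, D.opp * φ ^ k = (φ⁻¹) ^ k * D.opp := fun k =>
      (show SemiconjBy D.opp φ φ⁻¹ from h1).zpow_right k
    intro k d
    have := congrArg (fun σ : Equiv.Perm D.Dart => σ d) (h2 k)
    simpa using this
  obtain ⟨k, hk⟩ := hc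
  rcases Int.even_or_odd' k with ⟨j, rfl | rfl⟩
  · apply opp_ne ((φ ^ j) d)
    rw [hinv', ← hk, ← Equiv.Perm.mul_apply, ← zpow_add]
    congr 2; ring
  · apply D.glue_ne ((φ ^ j) d)
    apply D.opp.injective
    change φ ((φ ^ j) d) = _
    rw [hinv', ← hk, ← Equiv.Perm.mul_apply, ← Equiv.Perm.mul_apply, ← zpow_add, ← zpow_one_add]
    congr 2; ring

/-- Any two darts of a knot diagram are connected along the curve. -/
theorem component_induction (hD : Subsingleton D.Component) {P : D.Dart → Prop} (d : D.Dart)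
    (hd : P d) (hg : ∀ d, P (D.glue d) ↔ P d) (ho : ∀ d, P (D.opp d) ↔ P d) (e : D.Dart) : P e := by
  have h : (Quot.mk _ d : D.Component) = Quot.mk _ e := hD.elim _ _
  have := congrArg (Quot.lift P (by
    rintro d _ (rfl | rfl)
    · exact propext (hg d).symm
    · exact propext (ho d).symm)) h
  exact this.mp hd

/-- A knot has two directions. -/
theorem dir_eq_or (hD : Subsingleton D.Component) (d e : D.Dart) :
    dir e = dir d ∨ dir e = dir (D.opp d) := by
  have ho : ∀ e, dir e = dir d ∨ dir e = dir (D.opp d) →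
      dir (D.opp e) = dir d ∨ dir (D.opp e) = dir (D.opp d) := by
    rintro e (h | h)
    · exact Or.inr (dir_opp_eq h)
    · exact Or.inl ((dir_opp_eq h).trans (by rw [opp_opp]))
  have ho' : ∀ e, (dir (D.opp e) = dir d ∨ dir (D.opp e) = dir (D.opp d)) ↔
      (dir e = dir d ∨ dir e = dir (D.opp d)) := fun e =>
    ⟨fun h => by have := ho _ h; rwa [opp_opp] at this, ho e⟩
  exact component_induction hD (P := fun e => dir e = dir d ∨ dir e = dir (D.opp d)) d (Or.inl rfl)
    (fun e => by rw [dir_glue]; exact ho' e) ho' e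

theorem dir_opp_eq_iff (hD : Subsingleton D.Component) (d e : D.Dart) :
    dir (D.opp d) = dir e ↔ dir d ≠ dir e := by
  constructor
  · intro h h'
    exact dir_opp_ne d (h.trans h'.symm)
  · intro h
    rcases dir_eq_or hD d e with h1 | h1
    · exact absurd h1.symm h
    · exact h1.symm

/-- The sign of a crossing, read off at any of its corners. -/
theorem sign_eq_one_iff (hD : Subsingleton D.Component) (d : D.Dart) :
    D.sign d.1 = 1 ↔ (dir d = dir (D.rot d) ↔ D.IsOver d) := by
  have key : ∀ d : D.Dart, (dir (D.rot d) = dir (D.rot (D.rot d)) ↔ D.IsOver (D.rot d)) ↔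
      (dir d = dir (D.rot d) ↔ D.IsOver d) := by
    intro d
    rw [isOver_rot, rot_rot, eq_comm, dir_opp_eq_iff hD, ne_eq, not_iff_not]
  have h0 : D.sign d.1 = 1 ↔ (dir ((d.1, 1) : D.Dart) = dir (D.rot (d.1, 1)) ↔
      D.IsOver (d.1, 1)) := by
    have : D.IsOver (d.1, 1) := Or.inl rfl
    rw [iff_true_right this]
    unfold sign
    constructor
    · intro h
      by_contra hne
      exact absurd ((if_neg hne).symm.trans h) (by decide)
    · intro h
      exact if_pos h
  rw [h0]
  rcases eq_of_fst_eq (d := d) (e := (d.1, 1)) rfl with h | h | h | h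
  · rw [h]
  · rw [h, key]
  · rw [h, ← rot_rot, key, key]
  · rw [h, ← key, Equiv.apply_symm_apply]

open Classical in
theorem sign_eq (hD : Subsingleton D.Component) (d : D.Dart) :
    D.sign d.1 = if (dir d = dir (D.rot d) ↔ D.IsOver d) then 1 else -1 := by
  split_ifs with h
  · exact (sign_eq_one_iff hD d).2 h
  · have h1 : D.sign d.1 ≠ 1 := fun h' => h ((sign_eq_one_iff hD d).1 h')
    unfold sign at h1 ⊢
    split_ifs at h1 ⊢
    · exact absurd rfl h1
    · rfl

end CrossingMap

namespace CrossingMap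

variable {D D' : CrossingMap}

/-! ### Maps of diagrams -/

section Respects

variable {f : D.Dart → D'.Dart}

theorem RespectsCrossings.map_opp (hf : RespectsCrossings f) (d : D.Dart) :
    f (D.opp d) = D'.opp (f d) := by
  rw [← rot_rot, hf.1, hf.1, rot_rot]

theorem RespectsCrossings.map_rot_symm (hf : RespectsCrossings f) (d : D.Dart) :
    f (D.rot.symm d) = D'.rot.symm (f d) := by
  rw [← rot_opp, hf.1, hf.map_opp, rot_opp]

/-- The map on crossings induced by a map on darts. -/
def crossing (f : D.Dart → D'.Dart) (x : Fin D.n) : Fin D'.n := (f (x, 0)).1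

theorem RespectsCrossings.map_fst (hf : RespectsCrossings f) (d : D.Dart) :
    (f d).1 = crossing f d.1 := by
  unfold crossing
  rcases eq_of_fst_eq (d := d) (e := (d.1, 0)) rfl with h | h | h | h <;> rw [h]
  · rw [hf.1]; rfl
  · rw [hf.map_opp]; rfl
  · rw [hf.map_rot_symm]; rfl

theorem RespectsCrossings.caps_iff (hf : RespectsCrossings f) (s : Fin D'.n → Bool) (d : D.Dart) :
    Caps s (f d) ↔ Caps (s ∘ crossing f) d := by
  unfold Caps
  rw [hf.map_fst, hf.2]; rfl

theorem RespectsCrossings.map_smooth (hf : RespectsCrossings f) (s : Fin D'.n → Bool)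
    (d : D.Dart) : f (D.smooth (s ∘ crossing f) d) = D'.smooth s (f d) := by
  rw [smooth_eq, smooth_eq]
  simp only [hf.caps_iff]
  split_ifs
  · exact hf.1 d
  · exact hf.map_rot_symm d

theorem RespectsCrossings.crossing_injective (hf : RespectsCrossings f)
    (hinj : Function.Injective f) : Function.Injective (crossing f) := by
  intro x y h
  rcases eq_of_fst_eq (d := f (x, 0)) (e := f (y, 0)) h.symm with h | h | h | h
  · exact (congrArg Prod.fst (hinj h)).symm
  · rw [← hf.1] at h; exact (congrArg Prod.fst (hinj h)).symm
  · rw [← hf.map_opp] at h; exact (congrArg Prod.fst (hinj h)).symm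
  · rw [← hf.map_rot_symm] at h; exact (congrArg Prod.fst (hinj h)).symm

theorem RespectsCrossings.range_crossing (hf : RespectsCrossings f) {S : Set (Fin D'.n)}
    (hr : Set.range f = {d | d.1 ∉ S}) : Set.range (crossing f) = Sᶜ := by
  ext x
  constructor
  · rintro ⟨y, rfl⟩
    have : f (y, 0) ∈ Set.range f := ⟨_, rfl⟩
    rw [hr] at this
    exact this
  · intro hx
    have : ((x, 0) : D'.Dart) ∈ Set.range f := by rw [hr]; exact hx
    obtain ⟨d, hd⟩ := this
    exact ⟨d.1, by rw [← hf.map_fst, hd]⟩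

end Respects

theorem circles_pos (s : Fin D.n → Bool) : 0 < D.circles s := by
  rw [circles_eq_loops]
  split_ifs with h
  · omega
  · have : Nonempty D.Dart := ⟨(⟨0, Nat.pos_of_ne_zero h⟩, 0)⟩
    have : 0 < loops D.glue (D.smooth s) := Nat.card_pos_iff.2
      ⟨⟨Quot.mk _ this.some⟩, inferInstance⟩
    omega

/-! ### Erasing crossings -/

section Erase

variable {S : Set (Fin D'.n)}

/-- The strand that leaves a crossing is traced by iterating a partial map. -/
theorem through_iff (u v : D'.Dart) : D'.Through S u v ↔
    Relation.ReflTransGen (fun e e' : D'.Dart => e.1 ∈ S ∧ e' = D'.glue (D'.opp e))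
      (D'.glue u) v := by
  constructor
  · intro h
    induction h with
    | edge => exact .refl
    | step _ he ih => exact ih.tail ⟨he, rfl⟩
  · intro h
    induction h with
    | refl => exact .edge u
    | tail _ h ih =>
      obtain ⟨he, rfl⟩ := h
      exact .step ih he

/-- A strand has at most one end outside `S`. -/
theorem Through.unique {u v w : D'.Dart} (hv : D'.Through S u v) (hw : D'.Through S u w)
    (hvS : v.1 ∉ S) (hwS : w.1 ∉ S) : v = w := by
  rw [through_iff] at hv hw
  have hU : Relator.RightUnique
      (fun e e' : D'.Dart => e.1 ∈ S ∧ e' = D'.glue (D'.opp e)) := by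
    rintro a b c ⟨-, rfl⟩ ⟨-, rfl⟩; rfl
  rcases hv.total_of_right_unique hU hw with h | h
  · rcases h.cases_head with h | ⟨c, ⟨hc, -⟩, -⟩
    · exact h
    · exact absurd hc hvS
  · rcases h.cases_head with h | ⟨c, ⟨hc, -⟩, -⟩
    · exact h.symm
    · exact absurd hc hwS

/-- The dart `v` lies on the strand that starts at `u` and passes straight through the crossings
in `S`. -/
def OnStrand (S : Set (Fin D'.n)) (u v : D'.Dart) : Prop :=
  v = u ∨ D'.Through S u v ∨ (v.1 ∈ S ∧ D'.Through S u (D'.opp v))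

theorem OnStrand.glue {u v : D'.Dart} (hu : u.1 ∉ S) (h : OnStrand S u v) :
    OnStrand S u (D'.glue v) := by
  rcases h with rfl | h | ⟨hv, h⟩
  · exact Or.inr (Or.inl (.edge _))
  · cases h with
    | edge => exact Or.inl (D'.glue_glue _)
    | step h he =>
      rw [D'.glue_glue]
      exact Or.inr (Or.inr ⟨he, by rwa [opp_opp]⟩)
  · have := h.step hv
    rw [opp_opp] at this
    exact Or.inr (Or.inl this)

theorem OnStrand.opp {u v : D'.Dart} (hu : u.1 ∉ S) (hv : v.1 ∈ S) (h : OnStrand S u v) :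
    OnStrand S u (D'.opp v) := by
  rcases h with rfl | h | ⟨-, h⟩
  · exact absurd hv hu
  · exact Or.inr (Or.inr ⟨hv, by rwa [opp_opp]⟩)
  · exact Or.inr (Or.inl h)

theorem OnStrand.trans_symm {u u' v : D'.Dart} (hu : u.1 ∉ S) (h : OnStrand S u v)
    (h' : OnStrand S u' v) : OnStrand S u u' := by
  have key : ∀ w, D'.Through S u' w → OnStrand S u w → OnStrand S u u' := by
    intro w hw
    induction hw with
    | edge => intro h; have := h.glue hu; rwa [D'.glue_glue] at this
    | step _ he ih =>
      intro h
      have := h.glue hu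
      rw [D'.glue_glue] at this
      have := OnStrand.opp (v := D'.opp _) hu he this
      rw [opp_opp] at this
      exact ih this
  rcases h' with rfl | h' | ⟨hv, h'⟩
  · exact h
  · exact key _ h' h
  · exact key _ h' (h.opp hu hv)

open Classical in
/-- The smoothing `s` at the crossings outside `S`; the strands pass straight through the crossings
in `S`. -/
def smoothOff (S : Set (Fin D'.n)) (s : Fin D'.n → Bool) (d : D'.Dart) : D'.Dart :=
  if d.1 ∈ S then D'.opp d else D'.smooth s d

theorem smoothOff_of_mem {s : Fin D'.n → Bool} {d : D'.Dart} (h : d.1 ∈ S) :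
    smoothOff S s d = D'.opp d := if_pos h

theorem smoothOff_of_notMem {s : Fin D'.n → Bool} {d : D'.Dart} (h : d.1 ∉ S) :
    smoothOff S s d = D'.smooth s d := if_neg h

/-- The circles of a diagram with some crossings erased, computed in the original diagram. The
crossing `x` excludes the circle without crossings. -/
theorem circles_eq_loops_smoothOff (hD' : Subsingleton D'.Component) (x : Fin D'.n)
    {f : D.Dart → D'.Dart} (hinj : Function.Injective f) (hf : RespectsCrossings f)
    (hr : Set.range f = {d | d.1 ∉ S}) (ht : ∀ d, D'.Through S (f d) (f (D.glue d)))
    (s : Fin D'.n → Bool) :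
    D.circles (s ∘ crossing f) = loops D'.glue (smoothOff S s) := by
  have hfS : ∀ d, (f d).1 ∉ S := fun d => by
    have : f d ∈ Set.range f := ⟨d, rfl⟩
    rwa [hr] at this
  by_cases hn : D.n = 0
    -- If no crossing is left, then the strands form the whole curve, a single component.
  · have : IsEmpty D.Dart := by
      rw [Dart, hn]; infer_instance
    have hS : ∀ d : D'.Dart, d.1 ∈ S := by
      intro d
      by_contra h
      have : d ∈ Set.range f := by rw [hr]; exact h
      obtain ⟨e, -⟩ := this
      exact this.elim e
    have h1 : loops D'.glue (smoothOff S s) = Nat.card D'.Component :=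
      congrArg (fun m => loops D'.glue m) (funext fun d => smoothOff_of_mem (s := s) (hS d))
    have h2 : Nonempty D'.Component := ⟨Quot.mk _ (x, 0)⟩
    rw [h1, Nat.card_of_subsingleton h2.some, circles_eq_loops, if_pos hn]
    have : IsEmpty (Quot fun d e : D.Dart => e = D.glue d ∨ e = D.smooth (s ∘ crossing f) d) :=
      ⟨fun q => by obtain ⟨d, -⟩ := Quot.exists_rep q; exact this.elim d⟩
    rw [loops, Nat.card_of_isEmpty]
  · rw [circles_eq_loops, if_neg hn, add_zero]
    -- Every dart lies on a strand starting outside `S`, and the circle of the start is determined.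
    have hex : ∀ v, ∃ y, OnStrand S (f y) v := by
      let y : D.Dart := (⟨0, Nat.pos_of_ne_zero hn⟩, 0)
      have step : ∀ v w : D'.Dart, (w = D'.glue v ∨ w = D'.opp v) →
          (∃ y, OnStrand S (f y) v) → ∃ y, OnStrand S (f y) w := by
        rintro v w (rfl | rfl) ⟨y, hy⟩
        · exact ⟨y, hy.glue (hfS y)⟩
        · by_cases hv : v.1 ∈ S
          · exact ⟨y, hy.opp (hfS y) hv⟩
          · have : D'.opp v ∈ Set.range f := by rw [hr]; exact hv
            obtain ⟨z, hz⟩ := this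
            exact ⟨z, Or.inl hz.symm⟩
      refine component_induction hD' (f y) ⟨y, Or.inl rfl⟩ (fun v => ⟨fun h => ?_, fun h => ?_⟩)
        (fun v => ⟨fun h => ?_, fun h => ?_⟩)
      · exact step _ _ (Or.inl (D'.glue_glue v).symm) h
      · exact step _ _ (Or.inl rfl) h
      · exact step _ _ (Or.inr (opp_opp v).symm) h
      · exact step _ _ (Or.inr rfl) h
    have hsame : ∀ y y' v, OnStrand S (f y) v → OnStrand S (f y') v →
        loopOf D.glue (D.smooth (s ∘ crossing f)) y' =
          loopOf D.glue (D.smooth (s ∘ crossing f)) y := by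
      intro y y' v h h'
      rcases h.trans_symm (hfS y) h' with h | h | ⟨h, -⟩
      · rw [hinj h]
      · rw [hinj ((h.unique (ht y)) (hfS _) (hfS _)), loopOf_left]
      · exact absurd h (hfS _)
    choose y hy using hex
    have hout : ∀ v : D'.Dart, v.1 ∉ S → ∃ d, f d = v := by
      intro v hv
      have : v ∈ Set.range f := by rw [hr]; exact hv
      exact this
    refine Nat.card_congr
      { toFun := Quot.lift (fun d => loopOf D'.glue (smoothOff S s) (f d)) ?_
        invFun := Quot.lift (fun v => loopOf D.glue (D.smooth (s ∘ crossing f)) (y v)) ?_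
        left_inv := ?_
        right_inv := ?_ }
    · rintro d _ (rfl | rfl)
      · have key : ∀ v, D'.Through S (f d) v →
            loopOf D'.glue (smoothOff S s) (f d) = loopOf D'.glue (smoothOff S s) v := by
          intro v hv
          induction hv with
          | edge => rw [loopOf_left]
          | step _ he ih =>
            rw [ih, loopOf_left, ← smoothOff_of_mem (s := s) he, loopOf_right]
        exact key _ (ht d)
      · rw [hf.map_smooth, ← smoothOff_of_notMem (s := s) (hfS d), loopOf_right]
    · rintro v _ (rfl | rfl)
      · exact hsame _ _ _ (hy _) ((hy v).glue (hfS _))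
      · by_cases hv : v.1 ∈ S
        · rw [smoothOff_of_mem hv]
          exact hsame _ _ _ (hy _) ((hy v).opp (hfS _) hv)
        · rw [smoothOff_of_notMem hv]
          obtain ⟨d, rfl⟩ := hout v hv
          rw [← hf.map_smooth]
          rw [hsame _ _ _ (Or.inl rfl) (hy (f d)), hsame _ _ _ (Or.inl rfl) (hy (f (D.smooth _ d))),
            loopOf_right]
    · rintro ⟨d⟩
      exact hsame _ _ _ (Or.inl rfl) (hy (f d))
    · rintro ⟨v⟩
      change loopOf D'.glue (smoothOff S s) (f (y v)) = loopOf D'.glue (smoothOff S s) v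
      have key : ∀ u w, D'.Through S u w →
            loopOf D'.glue (smoothOff S s) u = loopOf D'.glue (smoothOff S s) w := by
        intro u w hv
        induction hv with
        | edge => rw [loopOf_left]
        | step _ he ih =>
          rw [ih, loopOf_left, ← smoothOff_of_mem (s := s) he, loopOf_right]
      rcases hy v with h | h | ⟨h1, h⟩
      · rw [← h]
      · exact key _ _ h
      · rw [key _ _ h, ← smoothOff_of_mem (s := s) h1, loopOf_right]

theorem dir_map_eq_iff (hD : Subsingleton D.Component) (hD' : Subsingleton D'.Component)
    {f : D.Dart → D'.Dart} (hf : RespectsCrossings f)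
    (ht : ∀ d, D'.Through S (f d) (f (D.glue d))) (d e : D.Dart) :
    dir (f d) = dir (f e) ↔ dir d = dir e := by
  have h1 : ∀ d e, dir d = dir e → dir (f d) = dir (f e) := by
    intro d e h
    refine congrArg (Quot.lift (fun d => dir (f d)) ?_) h
    rintro d _ rfl
    have key : ∀ v, D'.Through S (f d) v → dir (f d) = dir (D'.opp v) := by
      intro v hv
      induction hv with
      | edge => rw [dir_opp_glue]
      | step _ he ih => rw [ih, dir_opp_glue]
    rw [hf.map_opp]
    exact key _ (ht d)
  refine ⟨fun h => ?_, h1 d e⟩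
  by_contra hne
  have := h1 _ _ ((dir_opp_eq_iff hD d e).2 hne)
  rw [hf.map_opp, dir_opp_eq_iff hD'] at this
  exact this h

theorem sign_crossing (hD : Subsingleton D.Component) (hD' : Subsingleton D'.Component)
    {f : D.Dart → D'.Dart} (hf : RespectsCrossings f)
    (hdir : ∀ d e, dir (f d) = dir (f e) ↔ dir d = dir e) (x : Fin D.n) :
    D'.sign (crossing f x) = D.sign x := by
  have h1 := sign_eq hD (x, 0)
  have h2 := sign_eq hD' (f (x, 0))
  have h3 : (dir (f (x, 0)) = dir (D'.rot (f (x, 0))) ↔ D'.IsOver (f (x, 0))) ↔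
      (dir ((x, 0) : D.Dart) = dir (D.rot (x, 0)) ↔ D.IsOver (x, 0)) := by
    rw [← hf.1, hf.2, hdir]
  refine h2.trans (Eq.trans ?_ h1.symm)
  by_cases h : dir ((x, 0) : D.Dart) = dir (D.rot (x, 0)) ↔ D.IsOver (x, 0)
  · rw [if_pos h, if_pos (h3.2 h)]
  · rw [if_neg h, if_neg (mt h3.1 h)]

end Erase

end CrossingMap

/-! ### Replacing a local pattern of arcs -/

section Table

variable {ι : Type*}

/-- One step along a local pattern of arcs. The set `ι` consists of the ends of the pattern, `W` marks
the inner ones; the map `γ` joins the inner ends among themselves, and `μ` joins all ends. -/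
def tableStep (W : ι → Bool) (γ μ : ι → ι) (j : ι) : ι :=
  if W (μ j) then γ (μ j) else μ j

/-- The point reached from an inner end by following the pattern until it is left; an outer end stays
in place. The number of iterations is sufficient for patterns with six inner ends. -/
def tableExit (W : ι → Bool) (γ μ : ι → ι) : ι → ι :=
  (fun j => if W j then tableStep W γ μ j else j)^[6]

/-- Two ends are joined by a piece of the pattern, of bounded length in order to be decidable. -/
def TableLinked (W : ι → Bool) (γ μ : ι → ι) (j j' : ι) : Prop :=
  ∃ k : Fin 9, (tableStep W γ μ)^[k] j = j' ∨ μ ((tableStep W γ μ)^[k] j) = j'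

instance [DecidableEq ι] (W : ι → Bool) (γ μ : ι → ι) (j j' : ι) :
    Decidable (TableLinked W γ μ j j') := by unfold TableLinked; infer_instance

/-- The pattern `μ₁` connects the outer ends as the pattern `μ₂` does, and every
inner end is connected to an outer end. -/
def TableLE (W : ι → Bool) (γ μ₁ μ₂ : ι → ι) : Prop :=
  (∀ j, W (tableExit W γ μ₁ j) = false) ∧
  (∀ j, TableLinked W γ μ₁ j (tableExit W γ μ₁ j)) ∧
  (∀ j, W j = true → TableLinked W γ μ₂ (tableExit W γ μ₁ j) (tableExit W γ μ₁ (γ j))) ∧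
  (∀ j, TableLinked W γ μ₂ (tableExit W γ μ₁ j) (tableExit W γ μ₁ (μ₁ j)))

instance [DecidableEq ι] [Fintype ι] (W : ι → Bool) (γ μ₁ μ₂ : ι → ι) :
    Decidable (TableLE W γ μ₁ μ₂) := by unfold TableLE; infer_instance

variable {X : Type*} {g m m₁ m₂ : X → X} {p : ι → X} {W : ι → Bool} {γ μ μ₁ μ₂ : ι → ι}

theorem TableLinked.loopOf_eq (hγ : ∀ j, W j = true → g (p j) = p (γ j))
    (hμ : ∀ j, m (p j) = p (μ j)) {j j' : ι} (h : TableLinked W γ μ j j') :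
    loopOf g m (p j) = loopOf g m (p j') := by
  have hstep : ∀ j, loopOf g m (p (tableStep W γ μ j)) = loopOf g m (p j) := by
    intro j
    unfold tableStep
    split_ifs with hW
    · rw [← hγ _ hW, loopOf_left, ← hμ, loopOf_right]
    · rw [← hμ, loopOf_right]
  have hit : ∀ (k : ℕ) j, loopOf g m (p ((tableStep W γ μ)^[k] j)) = loopOf g m (p j) := by
    intro k
    induction k with
    | zero => intro j; rfl
    | succ k ih => intro j; rw [Function.iterate_succ_apply, ih, hstep]
  obtain ⟨k, rfl | rfl⟩ := h
  · exact (hit _ _).symm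
  · rw [← hμ, loopOf_right, hit]

theorem tableExit_of_outer {j : ι} (h : W j = false) : tableExit W γ μ j = j := by
  unfold tableExit
  exact Function.iterate_fixed (by simp [h]) 6

/-- A pattern may be replaced by another one which connects the outer ends in the same way, provided
that neither of them contains a closed curve. -/
theorem loops_eq_of_table [DecidableEq ι] (hp : Function.Injective p) (hg : ∀ x, g (g x) = x)
    (hγ : ∀ j, W j = true → g (p j) = p (γ j)) (hγW : ∀ j, W j = true → W (γ j) = true)
    (hμ₁ : ∀ j, m₁ (p j) = p (μ₁ j)) (hμ₂ : ∀ j, m₂ (p j) = p (μ₂ j))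
    (hm₁ : ∀ x, m₁ (m₁ x) = x)
    (hm : ∀ x, x ∉ Set.range p → m₁ x = m₂ x)
    (h₁₂ : TableLE W γ μ₁ μ₂) (h₂₁ : TableLE W γ μ₂ μ₁) : loops g m₁ = loops g m₂ := by
  classical
  have hmr : ∀ x, x ∉ Set.range p → m₁ x ∉ Set.range p := by
    rintro x hx ⟨j, hj⟩
    exact hx ⟨μ₁ j, by rw [← hμ₁, hj, hm₁]⟩
  -- The retraction `ρ` moves each inner end to an outer end on the same closed curve.
  have key : ∀ {m m' : X → X} {μ μ' : ι → ι}, (∀ j, m (p j) = p (μ j)) →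
      (∀ j, m' (p j) = p (μ' j)) → (∀ x, x ∉ Set.range p → m x = m' x) →
      (∀ x, x ∉ Set.range p → m x ∉ Set.range p) → TableLE W γ μ μ' →
      let ρ := Function.extend p (p ∘ tableExit W γ μ) id
      (∀ x, loopOf g m (ρ x) = loopOf g m x) ∧
      (∀ x y, (y = g x ∨ y = m x) → loopOf g m' (ρ x) = loopOf g m' (ρ y)) := by
    intro m m' μ μ' hμ hμ' hmm hmr ht ρ
    have hρ : ∀ j, ρ (p j) = p (tableExit W γ μ j) := fun j => hp.extend_apply _ _ _
    have hρ' : ∀ x, x ∉ Set.range p → ρ x = x := fun x hx => Function.extend_apply' _ _ _ hx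
    have hρo : ∀ x, (∀ j, W j = true → x ≠ p j) → ρ x = x := by
      intro x hx
      by_cases h : x ∈ Set.range p
      · obtain ⟨j, rfl⟩ := h
        have : W j = false := by
          by_contra hW
          exact hx j (by simpa using hW) rfl
        rw [hρ, tableExit_of_outer this]
      · exact hρ' x h
    obtain ⟨-, h2, h3, h4⟩ := ht
    refine ⟨fun x => ?_, ?_⟩
    · by_cases h : x ∈ Set.range p
      · obtain ⟨j, rfl⟩ := h
        rw [hρ, ← (h2 j).loopOf_eq hγ hμ]
      · rw [hρ' x h]
    · rintro x _ (rfl | rfl)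
      · by_cases h : ∃ j, W j = true ∧ x = p j
        · obtain ⟨j, hj, rfl⟩ := h
          rw [hγ j hj, hρ, hρ, (h3 j hj).loopOf_eq hγ hμ']
        · push Not at h
          rw [hρo x h, hρo (g x), loopOf_left]
          intro j hj hx
          exact h (γ j) (hγW j hj) (by rw [← hγ j hj, ← hx, hg])
      · by_cases h : x ∈ Set.range p
        · obtain ⟨j, rfl⟩ := h
          rw [hμ, hρ, hρ, (h4 j).loopOf_eq hγ hμ']
        · rw [hρ' x h, hρ' _ (hmr x h), hmm x h, loopOf_right]
  have hmr₂ : ∀ x, x ∉ Set.range p → m₂ x ∉ Set.range p := fun x hx => by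
    rw [← hm x hx]; exact hmr x hx
  obtain ⟨h1, h2⟩ := key hμ₁ hμ₂ hm hmr h₁₂
  obtain ⟨h3, h4⟩ := key hμ₂ hμ₁ (fun x hx => (hm x hx).symm) hmr₂ h₂₁
  have hfix : ∀ {μ μ' : ι → ι}, (∀ j, W (tableExit W γ μ j) = false) → ∀ x,
      Function.extend p (p ∘ tableExit W γ μ') id (Function.extend p (p ∘ tableExit W γ μ) id x) =
        Function.extend p (p ∘ tableExit W γ μ) id x := by
    intro μ μ' h x
    by_cases hx : x ∈ Set.range p
    · obtain ⟨j, rfl⟩ := hx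
      rw [hp.extend_apply, Function.comp_apply, hp.extend_apply, Function.comp_apply,
        tableExit_of_outer (h j)]
    · rw [Function.extend_apply' _ _ _ hx, id, Function.extend_apply' _ _ _ hx, id]
  exact Nat.card_quot_retract _ _ h1 h3 h2 h4 (hfix h₁₂.1) (hfix h₂₁.1)

end Table

/-! ### The pattern of the third Reidemeister move -/

section TriangleTable

/-- The exchange of the two crossings, the corners `k` and `l`, on a side of a triangle. The ends
`(k, 0), (k, 1), (k, 2), (k, 3)` stand for the darts `d, rot d, opp d, rot⁻¹ d`, where `d` is the
`k`-th corner. -/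
def triangleSlide (k l : Fin 3) : Equiv.Perm (Fin 3 × ZMod 4) :=
  Equiv.swap (k, 3) (l, 0) * Equiv.swap (k, 1) (l, 2)

/-- The exchange of the two crossings on all sides of a triangle. -/
def triangleFlip : Equiv.Perm (Fin 3 × ZMod 4) :=
  triangleSlide 0 1 * triangleSlide 1 2 * triangleSlide 2 0

/-- The inner ends at a triangle. -/
def triangleInner (j : Fin 3 × ZMod 4) : Bool := j.2 = 0 || j.2 = 1

/-- The sides of a triangle. -/
def triangleGlue (j : Fin 3 × ZMod 4) : Fin 3 × ZMod 4 :=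
  if j.2 = 1 then (j.1 + 1, 0) else (j.1 + 2, 1)

/-- The smoothing that cuts off the corners marked by `t`. -/
def triangleSmooth (t : Fin 3 → Bool) (j : Fin 3 × ZMod 4) : Fin 3 × ZMod 4 :=
  (j.1, if t j.1 then 1 - j.2 else 3 - j.2)

/-- The smoothing after the third Reidemeister move, carried back to the ends before the move. -/
def triangleSmooth' (t : Fin 3 → Bool) (j : Fin 3 × ZMod 4) : Fin 3 × ZMod 4 :=
  triangleFlip (triangleSmooth t (triangleFlip j))

/-- Two patterns at a triangle connect the outer ends in the same way. -/
def TriangleEquiv (μ₁ μ₂ : Fin 3 × ZMod 4 → Fin 3 × ZMod 4) : Prop :=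
  TableLE triangleInner triangleGlue μ₁ μ₂ ∧ TableLE triangleInner triangleGlue μ₂ μ₁

instance (μ₁ μ₂ : Fin 3 × ZMod 4 → Fin 3 × ZMod 4) : Decidable (TriangleEquiv μ₁ μ₂) := by
  unfold TriangleEquiv; infer_instance

set_option maxRecDepth 100000 in
/-- Two corners cut off after the move amount to none before the move. -/
theorem triangleEquiv_none :
    TriangleEquiv (triangleSmooth ![false, false, false])
      (triangleSmooth' ![true, true, false]) := by decide

set_option maxRecDepth 100000 in
/-- Two corners cut off before the move amount to none after the move. -/
theorem triangleEquiv_two :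
    TriangleEquiv (triangleSmooth ![true, true, false])
      (triangleSmooth' ![false, false, false]) := by decide

set_option maxRecDepth 100000 in
theorem triangleEquiv_one_fst :
    TriangleEquiv (triangleSmooth ![true, false, false])
      (triangleSmooth' ![true, false, false]) := by decide

set_option maxRecDepth 100000 in
theorem triangleEquiv_one_snd :
    TriangleEquiv (triangleSmooth ![false, true, false])
      (triangleSmooth' ![false, true, false]) := by decide

set_option maxRecDepth 100000 in
theorem triangleEquiv_one_thd :
    TriangleEquiv (triangleSmooth ![false, false, true])
      (triangleSmooth' ![false, false, true]) := by decide

end TriangleTable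

/-! ### Separating closed curves -/

theorem loopOf_ne_of_invariant {X : Type*} {g m : X → X} {a b : X} (P : X → Prop)
    (hg : ∀ v, P v → P (g v)) (hgg : ∀ v, g (g v) = v) (hm : ∀ v, P v → P (m v))
    (hmm : ∀ v, m (m v) = v) (ha : P a) (hb : ¬ P b) : loopOf g m a ≠ loopOf g m b := by
  intro h
  have := congrArg (Quot.lift P (by
    rintro v _ (rfl | rfl)
    · exact propext ⟨hg v, fun h => by have := hg _ h; rwa [hgg] at this⟩
    · exact propext ⟨hm v, fun h => by have := hm _ h; rwa [hmm] at this⟩)) h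
  exact hb (this.mp ha)

set_option maxRecDepth 100000 in
theorem triangleFlip_triangleFlip (j : Fin 3 × ZMod 4) : triangleFlip (triangleFlip j) = j := by
  revert j; decide

namespace CrossingMap

variable {D D' : CrossingMap}

/-! ### Changing the smoothing of one crossing -/

section Flip

variable {g : D.Dart → D.Dart} {s s' : Fin D.n → Bool} {d : D.Dart}

/-- If the two arcs at a crossing belong to different circles, then changing the smoothing joins
these circles, provided that the arcs of the new smoothing belong to one circle. The new pattern
`m'` at the crossing need not be a smoothing. -/
theorem loops_eq_add_one_of_ne {m' : D.Dart → D.Dart} (hs : Caps s d)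
    (hm' : ∀ e : D.Dart, e.1 ≠ d.1 → m' e = D.smooth s e)
    (hm'' : ∀ e : D.Dart, e.1 = d.1 → (m' e).1 = d.1)
    (h' : ∀ e : D.Dart, e.1 = d.1 → loopOf g m' e = loopOf g m' d)
    (hne : loopOf g (D.smooth s) d ≠ loopOf g (D.smooth s) (D.opp d)) :
    loops g (D.smooth s) = loops g m' + 1 := by
  have hd : loopOf g (D.smooth s) (D.rot d) = loopOf g (D.smooth s) d := by
    rw [← smooth_of_caps hs, loopOf_right]
  have ho : loopOf g (D.smooth s) (D.rot.symm d) = loopOf g (D.smooth s) (D.opp d) := by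
    rw [← rot_opp, ← smooth_of_caps ((caps_opp s d).2 hs), loopOf_right]
  have hcases : ∀ e : D.Dart, e.1 = d.1 → loopOf g (D.smooth s) e = loopOf g (D.smooth s) d ∨
      loopOf g (D.smooth s) e = loopOf g (D.smooth s) (D.opp d) := by
    intro e he
    rcases eq_of_fst_eq he with rfl | rfl | rfl | rfl
    exacts [Or.inl rfl, Or.inl hd, Or.inr rfl, Or.inr ho]
  refine Nat.card_quot_merge (a := d) (b := D.opp d) hne ?_ ?_ ?_
  · rintro x _ (rfl | rfl)
    · exact (loopOf_left g m' x).symm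
    · by_cases hx : x.1 = d.1
      · exact (h' x hx).trans (h' (D.smooth s x) hx).symm
      · rw [← hm' x hx]; exact (loopOf_right g m' x).symm
  · exact (h' (D.opp d) rfl).symm
  · rintro x _ (rfl | rfl)
    · exact Or.inl (loopOf_left g _ x).symm
    · by_cases hx : x.1 = d.1
      · rcases hcases x hx with h1 | h1 <;> rcases hcases _ (hm'' x hx) with h2 | h2
        · exact Or.inl (h1.trans h2.symm)
        · exact Or.inr (Or.inl ⟨h1, h2⟩)
        · exact Or.inr (Or.inr ⟨h1, h2⟩)
        · exact Or.inl (h1.trans h2.symm)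
      · rw [hm' x hx]; exact Or.inl (loopOf_right g _ x).symm

/-- All four darts of a crossing belong to one circle if both arcs of its smoothing do. -/
theorem loopOf_eq_of_not_caps (hs : ¬ Caps s d)
    (h : loopOf g (D.smooth s) d = loopOf g (D.smooth s) (D.opp d)) (e : D.Dart) (he : e.1 = d.1) :
    loopOf g (D.smooth s) e = loopOf g (D.smooth s) d := by
  have h1 : loopOf g (D.smooth s) (D.rot.symm d) = loopOf g (D.smooth s) d := by
    rw [← smooth_of_not_caps hs, loopOf_right]
  have h2 : loopOf g (D.smooth s) (D.rot d) = loopOf g (D.smooth s) (D.opp d) := by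
    rw [← rot_symm_opp, ← smooth_of_not_caps (mt (caps_opp s d).1 hs), loopOf_right]
  rcases eq_of_fst_eq he with rfl | rfl | rfl | rfl
  exacts [rfl, h2.trans h.symm, h.symm, h1]

theorem smooth_eq_of_ne (hs : ∀ y, y ≠ d.1 → s y = s' y) (e : D.Dart) (he : e.1 ≠ d.1) :
    D.smooth s e = D.smooth s' e := smooth_congr (hs _ he)

end Flip

/-! ### Triangles -/

section Triangle

/-- The darts `a, b, c` at three crossings are the corners of a three-sided region, if edges
are given by `g`. -/
structure IsTriangle (g : D.Dart → D.Dart) (a b c : D.Dart) : Prop where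
  gg : ∀ v, g (g v) = v
  hab : a.1 ≠ b.1
  hbc : b.1 ≠ c.1
  hca : c.1 ≠ a.1
  ga : g (D.rot a) = b
  gb : g (D.rot b) = c
  gc : g (D.rot c) = a

variable {g : D.Dart → D.Dart} {a b c : D.Dart} {s s' : Fin D.n → Bool}

theorem IsTriangle.rotate (h : IsTriangle g a b c) : IsTriangle g b c a :=
  ⟨h.gg, h.hbc, h.hca, h.hab, h.gb, h.gc, h.ga⟩

/-- If all corners of a triangle are cut off, the inner circle is joined to another one by changing
one of the smoothings. -/
theorem IsTriangle.loops_eq (h : IsTriangle g a b c) (ha : Caps s a) (hb : Caps s b)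
    (hc : Caps s c) (hc' : ¬ Caps s' c) (hs : ∀ y, y ≠ c.1 → s y = s' y) :
    loops g (D.smooth s) = loops g (D.smooth s') + 1 := by
  have ga' : g b = D.rot a := by rw [← h.ga, h.gg]
  have gb' : g c = D.rot b := by rw [← h.gb, h.gg]
  have gc' : g a = D.rot c := by rw [← h.gc, h.gg]
  have hm : ∀ {d}, Caps s d → D.smooth s (D.rot d) = d := fun {d} hd => by
    rw [← smooth_of_caps hd, smooth_smooth]
  have ha' : Caps s' a := by unfold Caps at ha ⊢; rwa [← hs _ h.hca.symm]
  have hb' : Caps s' b := by unfold Caps at hb ⊢; rwa [← hs _ h.hbc]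
  refine loops_eq_add_one_of_ne hc (fun e he => (smooth_eq_of_ne hs e he).symm)
    (fun e he => he) (loopOf_eq_of_not_caps hc' ?_) ?_
  · have hm' : ∀ {d}, Caps s' d → loopOf g (D.smooth s') (D.rot d) = loopOf g (D.smooth s') d :=
      fun {d} hd => by rw [← smooth_of_caps hd, loopOf_right]
    rw [← loopOf_left, gb', hm' hb', ← loopOf_left, ga', hm' ha', ← loopOf_left, gc',
      ← loopOf_right, smooth_of_caps ((caps_rot s' c).2 hc'), rot_rot]
  · refine loopOf_ne_of_invariant
      (fun v => v = a ∨ v = D.rot a ∨ v = b ∨ v = D.rot b ∨ v = c ∨ v = D.rot c)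
      ?_ h.gg ?_ (smooth_smooth s) (by simp) ?_
    · rintro v (rfl | rfl | rfl | rfl | rfl | rfl) <;> simp [h.ga, h.gb, h.gc, ga', gb', gc']
    · rintro v (rfl | rfl | rfl | rfl | rfl | rfl) <;>
        simp [hm, smooth_of_caps, ha, hb, hc]
    · rintro (e | e | e | e | e | e)
      · exact h.hca (by simpa using congrArg Prod.fst e)
      · exact h.hca (by simpa using congrArg Prod.fst e)
      · exact h.hbc.symm (by simpa using congrArg Prod.fst e)
      · exact h.hbc.symm (by simpa using congrArg Prod.fst e)
      · exact opp_ne c e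
      · exact (rot_ne_opp c) e.symm

/-- The map that exchanges the crossings on each side of a triangle. -/
def flip (D : CrossingMap) (a b c : D.Dart) : Equiv.Perm D.Dart :=
  D.slide a b * D.slide b c * D.slide c a

/-- The darts at the corners of a triangle. -/
def triangleDart (a b c : D.Dart) (j : Fin 3 × ZMod 4) : D.Dart :=
  ((![a, b, c] j.1).1, (![a, b, c] j.1).2 + j.2)

theorem IsTriangle.triangleDart_injective (h : IsTriangle g a b c) :
    Function.Injective (triangleDart a b c) := by
  rintro ⟨k, i⟩ ⟨l, j⟩ hkl
  have h1 := congrArg Prod.fst hkl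
  have h2 := congrArg Prod.snd hkl
  have hk : k = l := by
    have := h.hab; have := h.hbc; have := h.hca
    fin_cases k <;> fin_cases l <;> simp_all [triangleDart]
  subst hk
  simpa [triangleDart] using h2

theorem triangleDart_eq (a b c : D.Dart) (k : Fin 3) :
    triangleDart a b c (k, 0) = ![a, b, c] k ∧ triangleDart a b c (k, 1) = D.rot (![a, b, c] k) ∧
    triangleDart a b c (k, 2) = D.opp (![a, b, c] k) ∧
    triangleDart a b c (k, 3) = D.rot.symm (![a, b, c] k) := by
  refine ⟨Prod.ext rfl (add_zero _), rfl, rfl, ?_⟩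
  rw [rot_symm_eq, sub_eq_add_neg]; rfl

theorem IsTriangle.slide_triangleDart (h : IsTriangle g a b c) (k l : Fin 3) (j : Fin 3 × ZMod 4) :
    D.slide (![a, b, c] k) (![a, b, c] l) (triangleDart a b c j) =
      triangleDart a b c (triangleSlide k l j) := by
  obtain ⟨-, k1, -, k3⟩ := triangleDart_eq a b c k
  obtain ⟨l0, -, l2, -⟩ := triangleDart_eq a b c l
  unfold slide triangleSlide
  rw [Equiv.Perm.mul_apply, Equiv.Perm.mul_apply, ← k3, ← l2, ← k1, ← l0,
    h.triangleDart_injective.swap_apply, h.triangleDart_injective.swap_apply]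

theorem IsTriangle.flip_triangleDart (h : IsTriangle g a b c) (j : Fin 3 × ZMod 4) :
    D.flip a b c (triangleDart a b c j) = triangleDart a b c (triangleFlip j) := by
  have h1 := h.slide_triangleDart 2 0
  have h2 := h.slide_triangleDart 1 2
  have h3 := h.slide_triangleDart 0 1
  change ∀ j, D.slide c a _ = _ at h1
  change ∀ j, D.slide b c _ = _ at h2
  change ∀ j, D.slide a b _ = _ at h3
  unfold flip triangleFlip
  simp only [Equiv.Perm.mul_apply, h1, h2, h3]

theorem flip_of_notMem {x : D.Dart} (hx : x ∉ Set.range (triangleDart a b c)) :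
    D.flip a b c x = x := by
  have key : ∀ k l : Fin 3, D.slide (![a, b, c] k) (![a, b, c] l) x = x := by
    intro k l
    obtain ⟨-, k1, -, k3⟩ := triangleDart_eq a b c k
    obtain ⟨l0, -, l2, -⟩ := triangleDart_eq a b c l
    have : ∀ j, x ≠ triangleDart a b c j := fun j hj => hx ⟨j, hj.symm⟩
    unfold slide
    rw [Equiv.Perm.mul_apply, ← k3, ← l2, ← k1, ← l0, Equiv.swap_apply_of_ne_of_ne (this _) (this _),
      Equiv.swap_apply_of_ne_of_ne (this _) (this _)]
  have h1 := key 2 0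
  have h2 := key 1 2
  have h3 := key 0 1
  change D.slide c a x = x at h1
  change D.slide b c x = x at h2
  change D.slide a b x = x at h3
  unfold flip
  rw [Equiv.Perm.mul_apply, Equiv.Perm.mul_apply, h1, h2, h3]

theorem IsTriangle.flip_flip (h : IsTriangle g a b c) (x : D.Dart) :
    D.flip a b c (D.flip a b c x) = x := by
  by_cases hx : x ∈ Set.range (triangleDart a b c)
  · obtain ⟨j, rfl⟩ := hx
    rw [h.flip_triangleDart, h.flip_triangleDart]
    rw [triangleFlip_triangleFlip]
  · rw [flip_of_notMem hx, flip_of_notMem hx]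

/-- In the state `s`, the corners of the triangle that are cut off are given by `t`. -/
def CapsAt (s : Fin D.n → Bool) (a b c : D.Dart) (t : Fin 3 → Bool) : Prop :=
  ∀ k, Caps s (![a, b, c] k) ↔ t k = true

theorem CapsAt.smooth_triangleDart {t : Fin 3 → Bool} (ht : CapsAt s a b c t)
    (j : Fin 3 × ZMod 4) :
    D.smooth s (triangleDart a b c j) = triangleDart a b c (triangleSmooth t j) := by
  obtain ⟨k, i⟩ := j
  refine Prod.ext rfl ?_
  have h := ht k
  unfold Caps IsOver at h
  change (if s (![a, b, c] k).1 then 1 else 3) - ((![a, b, c] k).2 + i) =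
    (![a, b, c] k).2 + if t k then 1 - i else 3 - i
  generalize (![a, b, c] k) = d at *
  generalize t k = t at *
  obtain ⟨x, l⟩ := d
  dsimp only at h ⊢
  generalize s x = s at *
  revert l s t i; decide

/-- The number of circles of a state after the third Reidemeister move, which carries the
smoothings along the map `flip`. -/
def flipLoops (g : D.Dart → D.Dart) (a b c : D.Dart) (s : Fin D.n → Bool) : ℕ :=
  loops g (fun v => D.flip a b c (D.smooth s (D.flip a b c v)))

theorem IsTriangle.loops_eq_flipLoops (h : IsTriangle g a b c) {t t' : Fin 3 → Bool}
    (ht : CapsAt s a b c t) (ht' : CapsAt s' a b c t')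
    (hs : ∀ y, y ≠ a.1 → y ≠ b.1 → y ≠ c.1 → s y = s' y)
    (htt : TriangleEquiv (triangleSmooth t) (triangleSmooth' t')) :
    loops g (D.smooth s) = flipLoops g a b c s' := by
  have hr : ∀ x : D.Dart, x ∈ Set.range (triangleDart a b c) ↔
      (x.1 = a.1 ∨ x.1 = b.1 ∨ x.1 = c.1) := by
    intro x
    constructor
    · rintro ⟨⟨k, i⟩, rfl⟩
      fin_cases k <;> simp [triangleDart]
    · rintro (hx | hx | hx)
      · exact ⟨(0, x.2 - a.2), Prod.ext hx.symm (add_sub_cancel _ _)⟩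
      · exact ⟨(1, x.2 - b.2), Prod.ext hx.symm (add_sub_cancel _ _)⟩
      · exact ⟨(2, x.2 - c.2), Prod.ext hx.symm (add_sub_cancel _ _)⟩
  have hg : ∀ k : Fin 3, g (D.rot (![a, b, c] k)) = ![a, b, c] (k + 1) := by
    intro k
    fin_cases k
    exacts [h.ga, h.gb, h.gc]
  refine loops_eq_of_table h.triangleDart_injective h.gg (W := triangleInner) (γ := triangleGlue)
    ?_ (by decide) ht.smooth_triangleDart (fun j => ?_) (smooth_smooth s) (fun x hx => ?_)
    htt.1 htt.2
  · rintro ⟨k, i⟩ hi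
    have hi' : ∀ (k : Fin 3) (i : ZMod 4), triangleInner (k, i) = true → i = 1 ∨ i = 0 := by decide
    rcases hi' k i hi with rfl | rfl
    · rw [(triangleDart_eq a b c k).2.1, hg]
      exact (triangleDart_eq a b c _).1.symm
    · rw [(triangleDart_eq a b c k).1]
      have h1 := hg (k + 2)
      rw [show k + 2 + 1 = k from
        (by decide : ∀ k : Fin 3, k + 2 + 1 = k) k] at h1
      rw [← h1, h.gg]
      exact (triangleDart_eq a b c (k + 2)).2.1.symm
  · rw [h.flip_triangleDart, ht'.smooth_triangleDart, h.flip_triangleDart]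
    rfl
  · rw [flip_of_notMem hx, flip_of_notMem]
    · rw [hr] at hx
      push Not at hx
      exact smooth_congr (hs _ hx.1 hx.2.1 hx.2.2)
    · rw [hr] at hx ⊢
      exact hx

end Triangle

end CrossingMap

namespace CrossingMap

variable {D D' : CrossingMap}

/-! ### Splitting the state sum -/

/-- The contribution of a crossing to the weight of a state. -/
def wt (b : Bool) : ℤ[T;T⁻¹] := T (if b then 1 else -1)

/-- The exponent of `A` contributed by the smoothing that cuts off the corner between `d` and
`rot d`. -/
def capExp (d : D.Dart) : ℤ := if D.IsOver d then -1 else 1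

/-- The factor `-A² - A⁻²` of the bracket for each further circle. -/
abbrev delta : ℤ[T;T⁻¹] := - T 2 - T (-2)

/-- The state sum, split into the states of the crossings `ι x` and the states of the
crossings of the darts `j k`; the latter are described by the corners which are cut off. -/
theorem bracket_eq_sum {β κ : Type*} [Fintype β] [Fintype κ] [DecidableEq β] [DecidableEq κ]
    (ι : β → Fin D.n) (j : κ → D.Dart)
    (h : Function.Bijective (Sum.elim ι fun k => (j k).1)) :
    ∃ u : (β → Bool) → (κ → Bool) → Fin D.n → Bool,
      (∀ s t, u s t ∘ ι = s) ∧ (∀ s t k, Caps (u s t) (j k) ↔ t k = true) ∧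
      D.bracket = ∑ s : β → Bool, (∏ x, wt (s x)) * ∑ t : κ → Bool,
        (∏ k, T (if t k then capExp (j k) else - capExp (j k))) *
          delta ^ (D.circles (u s t) - 1) := by
  set e := Equiv.ofBijective _ h with he
  let q : κ → Bool := fun k => decide (D.IsOver (j k))
  let u : (β → Bool) → (κ → Bool) → Fin D.n → Bool := fun s t x =>
    Sum.elim s (fun k => xor (t k) (q k)) (e.symm x)
  have hι : ∀ x, e.symm (ι x) = Sum.inl x := fun x => by
    rw [Equiv.symm_apply_eq]; rfl
  have hj : ∀ k, e.symm (j k).1 = Sum.inr k := fun k => by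
    rw [Equiv.symm_apply_eq]; rfl
  have huι : ∀ s t x, u s t (ι x) = s x := fun s t x => by simp only [u, hι, Sum.elim_inl]
  have huj : ∀ s t k, u s t (j k).1 = xor (t k) (q k) := fun s t k => by
    simp only [u, hj, Sum.elim_inr]
  let E : (β → Bool) × (κ → Bool) ≃ (Fin D.n → Bool) :=
    { toFun := fun p => u p.1 p.2
      invFun := fun s => (s ∘ ι, fun k => xor (s (j k).1) (q k))
      left_inv := by
        rintro ⟨s, t⟩
        refine Prod.ext (funext fun x => huι s t x) (funext fun k => ?_)
        simp only [huj, Bool.xor_assoc, Bool.xor_self, Bool.xor_false]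
      right_inv := by
        intro s
        funext x
        obtain ⟨x | k, rfl⟩ := h.2 x
        · exact huι _ _ x
        · simp only [Sum.elim_inr, huj, Bool.xor_assoc, Bool.xor_self, Bool.xor_false] }
  refine ⟨u, fun s t => funext fun x => huι s t x, fun s t k => ?_, ?_⟩
  · unfold Caps
    rw [huj]
    by_cases h : D.IsOver (j k) <;> cases ht : t k <;> simp [q, h]
  · simp only [Finset.mul_sum, ← mul_assoc]
    rw [← Fintype.sum_prod_type' (f := fun s t => ((∏ x, wt (s x)) *
      ∏ k, T (if t k then capExp (j k) else - capExp (j k))) * delta ^ (D.circles (u s t) - 1))]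
    symm
    refine Fintype.sum_equiv E _ _ ?_
    rintro ⟨s, t⟩
    change _ = (∏ x, T (if u s t x then 1 else -1)) * delta ^ (D.circles (u s t) - 1)
    rw [← Fintype.prod_equiv e (fun x => T (if u s t (e x) then 1 else -1))
      (fun x => T (if u s t x then 1 else -1)) (fun _ => rfl), Fintype.prod_sum_type]
    congr 2
    · refine Finset.prod_congr rfl fun x _ => ?_
      change wt (s x) = T (if u s t (ι x) then 1 else -1)
      rw [huι]; rfl
    · refine Finset.prod_congr rfl fun k _ => ?_
      change _ = T (if u s t (j k).1 then 1 else -1)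
      rw [huj]
      unfold capExp
      by_cases h : D.IsOver (j k) <;> cases ht : t k <;> simp [q, h, ht]

theorem writhe_eq_sum {β κ : Type*} [Fintype β] [Fintype κ]
    (ι : β → Fin D.n) (j : κ → Fin D.n) (h : Function.Bijective (Sum.elim ι j)) :
    D.writhe = (∑ x, D.sign (ι x)) + ∑ k, D.sign (j k) := by
  unfold writhe
  rw [← Fintype.sum_equiv (Equiv.ofBijective _ h) (fun x => D.sign (Sum.elim ι j x)) _
    (fun _ => rfl), Fintype.sum_sum_type]
  rfl

/-! ### Isotopies -/

theorem crossing_bijective (f : D.Dart ≃ D'.Dart) (hf : RespectsCrossings f) :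
    Function.Bijective (crossing f) := by
  refine ⟨hf.crossing_injective f.injective, fun y => ⟨(f.symm (y, 0)).1, ?_⟩⟩
  rw [← hf.map_fst]; simp

theorem n_eq (f : D.Dart ≃ D'.Dart) (hf : RespectsCrossings f) : D.n = D'.n := by
  simpa using Fintype.card_of_bijective (crossing_bijective f hf)

theorem normalizedBracket_eq_of_iso (hD : Subsingleton D.Component)
    (hD' : Subsingleton D'.Component) (h : D.Iso D') :
    D.normalizedBracket = D'.normalizedBracket := by
  obtain ⟨f, hf, hg⟩ := h
  have hb := crossing_bijective f hf
  have hbr : D.bracket = D'.bracket := by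
    symm
    refine Fintype.sum_equiv (Equiv.arrowCongr (Equiv.ofBijective _ hb).symm (Equiv.refl _)) _ _ ?_
    intro s
    have h1 : Equiv.arrowCongr (Equiv.ofBijective _ hb).symm (Equiv.refl _) s = s ∘ crossing f :=
      rfl
    have h2 : D.circles (s ∘ crossing f) = D'.circles s := by
      rw [circles_eq_loops, circles_eq_loops, if_congr (by rw [n_eq f hf]) rfl rfl,
        loops_conj f hg (fun x => (hf.map_smooth s x).symm)]
    rw [h1, h2, ← Fintype.prod_equiv (Equiv.ofBijective _ hb)
      (fun x => T (if s (crossing f x) then 1 else -1)) _ (fun _ => rfl)]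
    rfl
  have hdir : ∀ d e, dir d = dir e → dir (f d) = dir (f e) := by
    intro d e h
    refine congrArg (Quot.lift (fun d => dir (f d)) ?_) h
    rintro d _ rfl
    rw [hf.map_opp, ← hg, dir_opp_glue]
  have hw : D.writhe = D'.writhe := by
    unfold writhe
    refine Fintype.sum_equiv (Equiv.ofBijective _ hb) _ _ fun x => ?_
    refine (sign_crossing hD hD' hf (fun d e => ⟨fun h => ?_, hdir d e⟩) x).symm
    by_contra hne
    have := hdir _ _ ((dir_opp_eq_iff hD d e).2 hne)
    rw [hf.map_opp, dir_opp_eq_iff hD'] at this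
    exact this h
  unfold normalizedBracket
  rw [hbr, hw]

/-! ### The first Reidemeister move -/

theorem neg_one_pow_natAbs_add (a b : ℤ) :
    (-1 : ℤ[T;T⁻¹]) ^ (a + b).natAbs = (-1) ^ a.natAbs * (-1) ^ b.natAbs := by
  rw [← pow_add]
  rcases Nat.even_or_odd (a + b).natAbs with h | h
  · rw [h.neg_one_pow, Even.neg_one_pow]
    rw [Int.natAbs_even, Int.even_add] at h
    rw [Nat.even_add, Int.natAbs_even, Int.natAbs_even, h]
  · rw [h.neg_one_pow, Odd.neg_one_pow]
    rw [Int.natAbs_odd, Int.odd_add] at h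
    rw [Nat.odd_add, Int.natAbs_odd, Int.natAbs_even, h]

theorem normalizedBracket_eq_of_R1 (hD : Subsingleton D.Component)
    (hD' : Subsingleton D'.Component) (h : D'.R1 D) :
    D'.normalizedBracket = D.normalizedBracket := by
  obtain ⟨d, hd, f, hf, hr, ht⟩ := h
  have hd' : D'.glue d = D'.rot d := by conv_lhs => rw [← hd, D'.glue_glue]
  have hrange := hf.range_crossing hr
  have hinj := hf.crossing_injective f.injective
  have hb : Function.Bijective (Sum.elim (crossing f) fun _ : Unit => d.1) := by
    constructor
    · rintro (x | x) (y | y) h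
      · exact congrArg _ (hinj h)
      · have : crossing f x ∈ Set.range (crossing f) := ⟨x, rfl⟩
        rw [hrange] at this
        exact absurd h this
      · have : crossing f y ∈ Set.range (crossing f) := ⟨y, rfl⟩
        rw [hrange] at this
        exact absurd h.symm this
      · rfl
    · intro y
      by_cases h : y = d.1
      · exact ⟨Sum.inr (), h.symm⟩
      · have : y ∈ Set.range (crossing f) := by rw [hrange]; exact h
        obtain ⟨x, rfl⟩ := this
        exact ⟨Sum.inl x, rfl⟩
  have hn : D'.n ≠ 0 := by have := d.1.pos; omega
  -- One smoothing of the kink splits off a circle, the other one amounts to its removal.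
  have hcount : ∀ u : Fin D'.n → Bool, D'.circles u =
      D.circles (u ∘ crossing f) + if Caps u d then 1 else 0 := by
    intro u
    rw [circles_eq_loops, if_neg hn, add_zero,
      circles_eq_loops_smoothOff hD' d.1 f.injective hf hr ht]
    have hm0 : ∀ e : D'.Dart, e.1 ≠ d.1 → smoothOff {d.1} u e = D'.smooth u e := fun e he =>
      smoothOff_of_notMem he
    have hm1 : ∀ e : D'.Dart, e.1 = d.1 → smoothOff {d.1} u e = D'.opp e := fun e he =>
      smoothOff_of_mem he
    have hall : ∀ e : D'.Dart, e.1 = d.1 → loopOf D'.glue (smoothOff {d.1} u) e =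
        loopOf D'.glue (smoothOff {d.1} u) d := by
      intro e he
      have h1 : loopOf D'.glue (smoothOff {d.1} u) (D'.opp d) =
          loopOf D'.glue (smoothOff {d.1} u) d := by rw [← hm1 d rfl, loopOf_right]
      have h2 : loopOf D'.glue (smoothOff {d.1} u) (D'.rot d) =
          loopOf D'.glue (smoothOff {d.1} u) d := by rw [← hd', loopOf_left]
      have h3 : loopOf D'.glue (smoothOff {d.1} u) (D'.rot.symm d) =
          loopOf D'.glue (smoothOff {d.1} u) (D'.rot d) := by
        rw [← opp_rot, ← hm1 (D'.rot d) rfl, loopOf_right]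
      rcases eq_of_fst_eq he with rfl | rfl | rfl | rfl
      exacts [rfl, h2, h1, h3.trans h2]
    split_ifs with hc
    · refine loops_eq_add_one_of_ne hc hm0 (fun e he => by rw [hm1 e he]; exact he) hall ?_
      refine loopOf_ne_of_invariant (fun v => v = d ∨ v = D'.rot d) ?_ D'.glue_glue ?_
        (smooth_smooth u) (Or.inl rfl) ?_
      · rintro v (rfl | rfl)
        · exact Or.inr hd'
        · exact Or.inl hd
      · rintro v (rfl | rfl)
        · exact Or.inr (smooth_of_caps hc)
        · rw [← smooth_of_caps hc, smooth_smooth]; exact Or.inl rfl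
      · rintro (e | e)
        · exact opp_ne d e
        · exact rot_ne_opp d e.symm
    · have hall' := loopOf_eq_of_not_caps (g := D'.glue) hc (by
        have h1 : loopOf D'.glue (D'.smooth u) (D'.rot d) = loopOf D'.glue (D'.smooth u) d := by
          rw [← hd', loopOf_left]
        rw [← h1, ← loopOf_right, smooth_of_caps ((caps_rot u d).2 hc), rot_rot])
      refine Nat.card_quot_congr ?_ ?_
      · rintro x _ (rfl | rfl)
        · exact (loopOf_left D'.glue _ x).symm
        · by_cases hx : x.1 = d.1
          · exact (hall x hx).trans (hall (D'.smooth u x) hx).symm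
          · rw [← hm0 x hx]; exact (loopOf_right D'.glue _ x).symm
      · rintro x _ (rfl | rfl)
        · exact (loopOf_left D'.glue _ x).symm
        · by_cases hx : x.1 = d.1
          · rw [hm1 x hx]; exact (hall' x hx).trans (hall' (D'.opp x) hx).symm
          · rw [hm0 x hx]; exact (loopOf_right D'.glue _ x).symm
  have hbr : D'.bracket = - T (3 * capExp d) * D.bracket := by
    obtain ⟨u, hu1, hu2, hu3⟩ := bracket_eq_sum (crossing f) (fun _ : Unit => d) hb
    rw [hu3, bracket, Finset.mul_sum]
    refine Finset.sum_congr rfl fun s _ => ?_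
    rw [mul_left_comm]
    congr 1
    rw [← Fintype.sum_equiv (Equiv.funUnique Unit Bool).symm
      (fun b => T (if b then capExp d else - capExp d) * delta ^ (D'.circles (u s fun _ => b) - 1))
      _ (fun b => by simp only [Finset.univ_unique, Finset.prod_singleton]; rfl), Fintype.sum_bool]
    have h1 : D'.circles (u s fun _ => true) = D.circles s + 1 := by
      rw [hcount, hu1, if_pos ((hu2 _ _ ()).2 rfl)]
    have h2 : D'.circles (u s fun _ => false) = D.circles s := by
      rw [hcount, hu1, if_neg (fun h => Bool.false_ne_true ((hu2 _ _ ()).1 h)), add_zero]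
    rw [h1, h2]
    obtain ⟨k, hk⟩ := Nat.exists_eq_add_of_lt (circles_pos s)
    rw [hk, show 0 + k + 1 + 1 - 1 = k + 1 by omega, show 0 + k + 1 - 1 = k by omega, pow_succ]
    have h3 : T (capExp d) * delta + T (- capExp d) = - T (3 * capExp d) := by
      unfold delta capExp
      split_ifs <;> simp only [mul_sub, mul_neg, ← T_add] <;> norm_num
      all_goals ring
    simp only [if_true, Bool.false_eq_true, if_false]
    rw [← h3]; ring
  have hw : D'.writhe = D.writhe + capExp d := by
    rw [writhe_eq_sum _ _ hb]
    have h1 : ∀ x, D'.sign (crossing f x) = D.sign x :=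
      sign_crossing hD hD' hf (dir_map_eq_iff hD hD' hf ht)
    simp only [h1, Finset.univ_unique, Finset.sum_const, Finset.card_singleton, one_smul]
    congr 1
    rw [sign_eq hD' d]
    have h2 : dir d ≠ dir (D'.rot d) := by
      rw [← hd', dir_glue]; exact (dir_opp_ne d).symm
    unfold capExp
    by_cases h : D'.IsOver d <;> simp [h, h2]
  unfold normalizedBracket
  rw [hbr, hw, neg_one_pow_natAbs_add]
  have h1 : (-1 : ℤ[T;T⁻¹]) ^ (capExp d).natAbs = -1 := by
    unfold capExp; split_ifs <;> simp
  have h2 : (T (-3 * (D.writhe + capExp d)) : ℤ[T;T⁻¹]) * T (3 * capExp d) = T (-3 * D.writhe) := by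
    rw [← T_add]; congr 1; ring
  rw [h1, ← h2]; ring

end CrossingMap

namespace CrossingMap

variable {D D' : CrossingMap}

/-! ### The second Reidemeister move -/

section Bigon

variable {d e : D.Dart} {u u' : Fin D.n → Bool}

/-- If both corners of a bigon are cut off, its inner circle is joined to another one by changing
one of the smoothings. -/
theorem loops_bigon_caps (hde : d.1 ≠ e.1) (hd : D.glue (D.rot d) = e) (he : D.glue (D.rot e) = d)
    (hud : Caps u d) (hue : Caps u e) (hue' : ¬ Caps u' e) (hu : ∀ y, y ≠ e.1 → u y = u' y) :
    loops D.glue (D.smooth u) = loops D.glue (D.smooth u') + 1 := by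
  have hd' : D.glue e = D.rot d := by rw [← hd, D.glue_glue]
  have he' : D.glue d = D.rot e := by rw [← he, D.glue_glue]
  have hud' : Caps u' d := by unfold Caps at hud ⊢; rwa [← hu _ hde]
  have hm : ∀ {d}, Caps u d → D.smooth u (D.rot d) = d := fun {d} hd => by
    rw [← smooth_of_caps hd, smooth_smooth]
  refine loops_eq_add_one_of_ne hue (fun v hv => (smooth_eq_of_ne hu v hv).symm)
    (fun v hv => hv) (loopOf_eq_of_not_caps hue' ?_) ?_
  · have hm' : ∀ {d}, Caps u' d → loopOf D.glue (D.smooth u') (D.rot d) =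
        loopOf D.glue (D.smooth u') d := fun {d} hd => by rw [← smooth_of_caps hd, loopOf_right]
    rw [← loopOf_left, hd', hm' hud', ← loopOf_left, he', ← loopOf_right,
      smooth_of_caps ((caps_rot u' e).2 hue'), rot_rot]
  · refine loopOf_ne_of_invariant (fun v => v = d ∨ v = D.rot d ∨ v = e ∨ v = D.rot e)
      ?_ D.glue_glue ?_ (smooth_smooth u) (by simp) ?_
    · rintro v (rfl | rfl | rfl | rfl) <;> simp [hd, he, hd', he']
    · rintro v (rfl | rfl | rfl | rfl) <;> simp [hm, smooth_of_caps, hud, hue]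
    · rintro (h | h | h | h)
      · exact hde.symm (by simpa using congrArg Prod.fst h)
      · exact hde.symm (by simpa using congrArg Prod.fst h)
      · exact opp_ne e h
      · exact (rot_ne_opp e) h.symm

/-- If no corner of a bigon is cut off, then its outer ends are joined as if the strands passed
straight through: exchanging the inner ends at both crossings turns one pattern into the other. -/
theorem loops_bigon_not_caps (hde : d.1 ≠ e.1) (hd : D.glue (D.rot d) = e)
    (he : D.glue (D.rot e) = d) (hud : ¬ Caps u d) (hue : ¬ Caps u e) :
    loops D.glue (smoothOff {d.1, e.1} u) = loops D.glue (D.smooth u) := by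
  have hd' : D.glue e = D.rot d := by rw [← hd, D.glue_glue]
  have he' : D.glue d = D.rot e := by rw [← he, D.glue_glue]
  have h1 : d ≠ e := fun h => hde (congrArg Prod.fst h)
  have h2 : d ≠ D.rot e := fun h => hde (by simpa using congrArg Prod.fst h)
  have h3 : D.rot d ≠ e := fun h => hde (by simpa using congrArg Prod.fst h)
  have h4 : D.rot d ≠ D.rot e := fun h => hde (by simpa using congrArg Prod.fst h)
  set τ : Equiv.Perm D.Dart := Equiv.swap d (D.rot d) * Equiv.swap e (D.rot e) with hτ
  have t1 : τ d = D.rot d := by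
    rw [hτ, Equiv.Perm.mul_apply, Equiv.swap_apply_of_ne_of_ne h1 h2, Equiv.swap_apply_left]
  have t2 : τ (D.rot d) = d := by
    rw [hτ, Equiv.Perm.mul_apply, Equiv.swap_apply_of_ne_of_ne h3 h4, Equiv.swap_apply_right]
  have t3 : τ e = D.rot e := by
    rw [hτ, Equiv.Perm.mul_apply, Equiv.swap_apply_left,
      Equiv.swap_apply_of_ne_of_ne h2.symm h4.symm]
  have t4 : τ (D.rot e) = e := by
    rw [hτ, Equiv.Perm.mul_apply, Equiv.swap_apply_right,
      Equiv.swap_apply_of_ne_of_ne h1.symm h3.symm]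
  have t0 : ∀ v, v ≠ d → v ≠ D.rot d → v ≠ e → v ≠ D.rot e → τ v = v := by
    intro v h1 h2 h3 h4
    rw [hτ, Equiv.Perm.mul_apply, Equiv.swap_apply_of_ne_of_ne h3 h4,
      Equiv.swap_apply_of_ne_of_ne h1 h2]
  have t5 : ∀ v : D.Dart, v.1 ≠ d.1 → v.1 ≠ e.1 → τ v = v := fun v h1 h2 =>
    t0 v (fun h => h1 (by rw [h])) (fun h => h1 (by rw [h, rot_fst]))
      (fun h => h2 (by rw [h])) (fun h => h2 (by rw [h, rot_fst]))
  have t6 : τ (D.opp d) = D.opp d ∧ τ (D.rot.symm d) = D.rot.symm d := by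
    refine ⟨t0 _ (opp_ne d) (rot_ne_opp d).symm ?_ ?_,
      t0 _ (rot_symm_ne d) (rot_symm_ne_rot d) ?_ ?_⟩ <;>
    exact fun h => hde (by simpa using congrArg Prod.fst h)
  have t7 : τ (D.opp e) = D.opp e ∧ τ (D.rot.symm e) = D.rot.symm e := by
    refine ⟨t0 _ ?_ ?_ (opp_ne e) (rot_ne_opp e).symm,
      t0 _ ?_ ?_ (rot_symm_ne e) (rot_symm_ne_rot e)⟩ <;>
    exact fun h => hde.symm (by simpa using congrArg Prod.fst h)
  refine loops_conj τ (fun v => ?_) (fun v => ?_)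
  · by_cases v1 : v = d
    · rw [v1, t1, hd, he', t4]
    by_cases v2 : v = D.rot d
    · rw [v2, t2, hd, he', t3]
    by_cases v3 : v = e
    · rw [v3, t3, hd', he, t2]
    by_cases v4 : v = D.rot e
    · rw [v4, t4, hd', he, t1]
    rw [t0 v v1 v2 v3 v4, t0]
    · exact fun h => v4 (by rw [← he', ← h, D.glue_glue])
    · exact fun h => v3 (by rw [← hd, ← h, D.glue_glue])
    · exact fun h => v2 (by rw [← hd', ← h, D.glue_glue])
    · exact fun h => v1 (by rw [← he, ← h, D.glue_glue])
  · have key : ∀ {d : D.Dart}, ¬ Caps u d → D.smooth u (D.rot d) = D.opp d ∧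
        D.smooth u (D.opp d) = D.rot d ∧ D.smooth u (D.rot.symm d) = d := by
      intro d hd
      refine ⟨?_, ?_, ?_⟩
      · rw [smooth_of_caps ((caps_rot u d).2 hd), rot_rot]
      · rw [smooth_of_not_caps (mt (caps_opp u d).1 hd), rot_symm_opp]
      · rw [← smooth_of_not_caps hd, smooth_smooth]
    obtain ⟨d1, d2, d3⟩ := key hud
    obtain ⟨e1, e2, e3⟩ := key hue
    by_cases v1 : v.1 = d.1
    · rw [smoothOff_of_mem (by simp [v1])]
      rcases eq_of_fst_eq v1 with rfl | rfl | rfl | rfl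
      · rw [t1, t6.1, d1]
      · rw [t2, opp_rot, t6.2, smooth_of_not_caps hud]
      · rw [t6.1, opp_opp, t1, d2]
      · rw [t6.2, opp_rot_symm, t2, d3]
    by_cases v2 : v.1 = e.1
    · rw [smoothOff_of_mem (by simp [v2])]
      rcases eq_of_fst_eq v2 with rfl | rfl | rfl | rfl
      · rw [t3, t7.1, e1]
      · rw [t4, opp_rot, t7.2, smooth_of_not_caps hue]
      · rw [t7.1, opp_opp, t3, e2]
      · rw [t7.2, opp_rot_symm, t4, e3]
    · rw [smoothOff_of_notMem (by simp [v1, v2]), t5 v v1 v2, t5 (D.smooth u v) v1 v2]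

end Bigon

/-- A state is determined by its values at some crossings and the corners cut off at the others. -/
theorem eq_of_capped {D : CrossingMap} {β κ : Type*} {ι : β → Fin D.n} {j : κ → D.Dart}
    (hb : Function.Bijective (Sum.elim ι fun k => (j k).1)) {u u' : Fin D.n → Bool} {y : Fin D.n}
    (hι : u ∘ ι = u' ∘ ι) (hj : ∀ k, (j k).1 = y → (Caps u (j k) ↔ Caps u' (j k))) : u y = u' y := by
  obtain ⟨x | k, rfl⟩ := hb.2 y
  · exact congrFun hι x
  · have := hj k rfl
    unfold Caps at this
    change u (j k).1 = u' (j k).1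
    rw [Bool.eq_iff_iff]
    tauto

theorem normalizedBracket_eq_of_R2 (hD : Subsingleton D.Component)
    (hD' : Subsingleton D'.Component) (h : D'.R2 D) :
    D'.normalizedBracket = D.normalizedBracket := by
  obtain ⟨d, e, hde, hd, he, hover, f, hf, hr, ht⟩ := h
  have hd' : D'.glue e = D'.rot d := by rw [← hd, D'.glue_glue]
  have he' : D'.glue d = D'.rot e := by rw [← he, D'.glue_glue]
  have hrange := hf.range_crossing hr
  have hinj := hf.crossing_injective f.injective
  have hnot : ∀ x, crossing f x ≠ d.1 ∧ crossing f x ≠ e.1 := by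
    intro x
    have : crossing f x ∈ Set.range (crossing f) := ⟨x, rfl⟩
    rw [hrange] at this
    simpa using this
  have hb : Function.Bijective (Sum.elim (crossing f) fun k : Fin 2 => (![d, e] k).1) := by
    constructor
    · rintro (x | x) (y | y) h
      · exact congrArg _ (hinj h)
      · fin_cases y
        · exact absurd h (hnot x).1
        · exact absurd h (hnot x).2
      · fin_cases x
        · exact absurd h.symm (hnot y).1
        · exact absurd h.symm (hnot y).2
      · fin_cases x <;> fin_cases y <;> first | rfl | exact absurd h hde | exact absurd h.symm hde
    · intro y
      by_cases h : y = d.1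
      · exact ⟨Sum.inr 0, h.symm⟩
      by_cases h' : y = e.1
      · exact ⟨Sum.inr 1, h'.symm⟩
      · have : y ∈ Set.range (crossing f) := by rw [hrange]; simp [h, h']
        obtain ⟨x, rfl⟩ := this
        exact ⟨Sum.inl x, rfl⟩
  have hn : D'.n ≠ 0 := by have := d.1.pos; omega
  -- One strand is on top at both crossings, so the weights of the two corners are inverse.
  have hexp : capExp e = - capExp d := by
    unfold capExp
    rw [isOver_rot] at hover
    by_cases h : D'.IsOver d
    · rw [if_pos h, if_neg (fun h' => hover.2 h' h), neg_neg]
    · rw [if_neg h, if_pos (hover.1 h)]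
  have hbr : D'.bracket = D.bracket := by
    obtain ⟨u, hu1, hu2, hu3⟩ := bracket_eq_sum (crossing f) ![d, e] hb
    rw [hu3, bracket]
    refine Finset.sum_congr rfl fun s _ => ?_
    rw [← Fintype.sum_equiv (finTwoArrowEquiv Bool).symm
      (fun p => T (if p.1 then capExp d else - capExp d) *
        T (if p.2 then capExp e else - capExp e) * delta ^ (D'.circles (u s ![p.1, p.2]) - 1))
      _ (fun p => by rw [Fin.prod_univ_two]; rfl), Fintype.sum_prod_type]
    simp only [Fintype.sum_bool]
    have hc : ∀ a b, (Caps (u s ![a, b]) d ↔ a = true) ∧ (Caps (u s ![a, b]) e ↔ b = true) :=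
      fun a b => ⟨hu2 s ![a, b] 0, hu2 s ![a, b] 1⟩
    have hcirc : ∀ v : Fin D'.n → Bool, D'.circles v = loops D'.glue (D'.smooth v) := fun v => by
      rw [circles_eq_loops, if_neg hn, add_zero]
    have h00 : D'.circles (u s ![false, false]) = D.circles s := by
      have := circles_eq_loops_smoothOff hD' d.1 f.injective hf hr ht (u s ![false, false])
      rw [hu1] at this
      rw [this, hcirc, loops_bigon_not_caps hde hd he]
      · rw [(hc _ _).1]; decide
      · rw [(hc _ _).2]; decide
    have h10 : D'.circles (u s ![true, true]) = D'.circles (u s ![true, false]) + 1 := by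
      rw [hcirc, hcirc]
      refine loops_bigon_caps hde hd he ((hc _ _).1.2 rfl) ((hc _ _).2.2 rfl)
        (mt (hc _ _).2.1 (by decide)) (fun y hy => eq_of_capped hb ((hu1 _ _).trans (hu1 _ _).symm)
        fun k hk => ?_)
      rw [hu2, hu2]
      fin_cases k
      · rfl
      · exact absurd hk.symm hy
    have h01 : D'.circles (u s ![true, true]) = D'.circles (u s ![false, true]) + 1 := by
      rw [hcirc, hcirc]
      refine loops_bigon_caps hde.symm he hd ((hc _ _).2.2 rfl) ((hc _ _).1.2 rfl)
        (mt (hc _ _).1.1 (by decide)) (fun y hy => eq_of_capped hb ((hu1 _ _).trans (hu1 _ _).symm)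
        fun k hk => ?_)
      rw [hu2, hu2]
      fin_cases k
      · exact absurd hk.symm hy
      · rfl
    -- The three states other than the one without corners cut off cancel: `δ + A² + A⁻² = 0`.
    obtain ⟨k, hk⟩ := Nat.exists_eq_add_of_lt (circles_pos (u s ![true, false]))
    rw [show D'.circles (u s ![false, true]) = D'.circles (u s ![true, false]) by omega, h10, h00,
      hk, show 0 + k + 1 + 1 - 1 = k + 1 by omega, show 0 + k + 1 - 1 = k by omega, pow_succ, hexp]
    simp only [if_true, Bool.false_eq_true, if_false, neg_neg, ← T_add, add_neg_cancel,
      neg_add_cancel, T_zero, one_mul]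
    have h3 : delta + T (capExp d + capExp d) + T (- capExp d + - capExp d) = 0 := by
      unfold delta capExp
      split_ifs
      · norm_num
      · norm_num
        ring
    have h4 : delta ^ k * delta + T (capExp d + capExp d) * delta ^ k +
        (T (- capExp d + - capExp d) * delta ^ k + delta ^ (D.circles s - 1)) =
        delta ^ k * (delta + T (capExp d + capExp d) + T (- capExp d + - capExp d)) +
          delta ^ (D.circles s - 1) := by ring
    rw [h4, h3, mul_zero, zero_add]
    rfl
  -- The two crossings have opposite signs.
  have hw : D'.writhe = D.writhe := by
    rw [writhe_eq_sum _ _ hb]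
    have h1 : ∀ x, D'.sign (crossing f x) = D.sign x :=
      sign_crossing hD hD' hf (dir_map_eq_iff hD hD' hf ht)
    simp only [h1, Fin.sum_univ_two]
    change (∑ x, D.sign x) + (D'.sign d.1 + D'.sign e.1) = ∑ x, D.sign x
    rw [sign_eq hD' d, sign_eq hD' e]
    have h2 : dir e = dir (D'.rot e) ↔ dir d = dir (D'.rot d) := by
      have h3 : dir (D'.opp e) = dir (D'.rot d) := by rw [← dir_glue, hd']
      have h4 : dir (D'.opp d) = dir (D'.rot e) := by rw [← dir_glue, he']
      rw [← h4, ← h3, eq_comm (a := dir e), dir_opp_eq_iff hD', eq_comm (a := dir d)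
        (b := dir (D'.opp e)), dir_opp_eq_iff hD', ne_comm]
    have h5 : D'.IsOver e ↔ ¬ D'.IsOver d := by rw [← hover, isOver_rot]
    by_cases h6 : dir d = dir (D'.rot d) <;> by_cases h7 : D'.IsOver d <;> simp [h2, h5, h6, h7]
  unfold normalizedBracket
  rw [hbr, hw]

end CrossingMap

namespace CrossingMap

variable {D D' : CrossingMap}

/-! ### The third Reidemeister move -/

section TriangleMove

variable {g : D.Dart → D.Dart} {a b c : D.Dart} {s s' : Fin D.n → Bool}

set_option maxRecDepth 100000 in
theorem triangleFlip_apply (k : Fin 3) :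
    triangleFlip (k, 0) = (k + 2, 3) ∧ triangleFlip (k, 1) = (k + 1, 2) ∧
      triangleFlip (k, 2) = (k + 2, 1) ∧ triangleFlip (k, 3) = (k + 1, 0) := by
  revert k; decide

set_option maxRecDepth 100000 in
theorem triangleFlip_add_fst (k : Fin 3) (i : ZMod 4) :
    triangleFlip (k + 2, i) = ((triangleFlip (k, i)).1 + 2, (triangleFlip (k, i)).2) := by
  revert k i; decide

set_option maxRecDepth 100000 in
theorem triangleFlip_add_snd (k : Fin 3) (i : ZMod 4) :
    triangleFlip (k, i + 2) = ((triangleFlip (k, i)).1, (triangleFlip (k, i)).2 + 2) := by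
  revert k i; decide

theorem triangleDart_glue (h : IsTriangle g a b c) (k : Fin 3) :
    g (triangleDart a b c (k, 1)) = triangleDart a b c (k + 1, 0) := by
  rw [(triangleDart_eq a b c k).2.1, (triangleDart_eq a b c (k + 1)).1]
  fin_cases k
  exacts [h.ga, h.gb, h.gc]

theorem triangleDart_glue' (h : IsTriangle g a b c) (k : Fin 3) :
    g (triangleDart a b c (k + 1, 0)) = triangleDart a b c (k, 1) := by
  rw [← triangleDart_glue h, h.gg]

/-- After the move, the opposite corners form a triangle. -/
theorem IsTriangle.flip (h : IsTriangle g a b c) :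
    IsTriangle (fun v => D.flip a b c (g (D.flip a b c v))) (D.opp a) (D.opp b) (D.opp c) := by
  have key : ∀ k : Fin 3, D.flip a b c (g (D.flip a b c (D.rot (D.opp (![a, b, c] k))))) =
      D.opp (![a, b, c] (k + 1)) := by
    intro k
    rw [rot_opp, ← (triangleDart_eq a b c k).2.2.2, h.flip_triangleDart,
      (triangleFlip_apply k).2.2.2, triangleDart_glue' h, h.flip_triangleDart,
      (triangleFlip_apply k).2.1, (triangleDart_eq a b c (k + 1)).2.2.1]
  exact ⟨fun v => by simp only [h.flip_flip, h.gg], h.hab, h.hbc, h.hca, key 0, key 1, key 2⟩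

theorem IsTriangle.flipLoops_eq (h : IsTriangle g a b c) (ha : Caps s a) (hb : Caps s b)
    (hc : Caps s c) (hc' : ¬ Caps s' c) (hs : ∀ y, y ≠ c.1 → s y = s' y) :
    flipLoops g a b c s = flipLoops g a b c s' + 1 := by
  have key : ∀ s : Fin D.n → Bool, flipLoops g a b c s =
      loops (fun v => D.flip a b c (g (D.flip a b c v))) (D.smooth s) := fun s =>
    loops_conj (D.flip a b c) (fun x => by rw [h.flip_flip]) (fun x => by rw [h.flip_flip])
  rw [key, key]
  exact h.flip.loops_eq ((caps_opp s a).2 ha) ((caps_opp s b).2 hb) ((caps_opp s c).2 hc)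
    (mt (caps_opp s' c).1 hc') hs

/-- The three corners of the triangle play the same role in the move. -/
theorem flipLoops_rotate (h : IsTriangle g a b c) (s : Fin D.n → Bool) :
    flipLoops g a b c s = flipLoops g b c a s := by
  have hr : Set.range (triangleDart a b c) = Set.range (triangleDart b c a) := by
    have key : ∀ j : Fin 3 × ZMod 4, triangleDart b c a j = triangleDart a b c (j.1 + 1, j.2) := by
      rintro ⟨k, i⟩
      fin_cases k <;> rfl
    apply Set.Subset.antisymm
    · rintro _ ⟨⟨k, i⟩, rfl⟩
      refine ⟨(k + 2, i), ?_⟩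
      rw [key]
      exact congrArg (fun l => triangleDart a b c (l, i))
        ((by decide : ∀ k : Fin 3, k + 2 + 1 = k) k)
    · rintro _ ⟨j, rfl⟩
      exact ⟨_, (key j).symm⟩
  have h1 : D.flip a b c = D.flip b c a := by
    ext1 x
    by_cases hx : x ∈ Set.range (triangleDart a b c)
    · obtain ⟨⟨k, i⟩, rfl⟩ := hx
      have key : ∀ k i, triangleDart a b c (k, i) = triangleDart b c a (k + 2, i) := by
        intro k i
        fin_cases k <;> rfl
      have h2 : D.flip b c a (triangleDart a b c (k, i)) =
          triangleDart b c a (triangleFlip (k + 2, i)) := by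
        rw [key, h.rotate.flip_triangleDart]
      rw [h.flip_triangleDart, h2, triangleFlip_add_fst]
      generalize triangleFlip (k, i) = j
      exact key j.1 j.2
    · rw [flip_of_notMem hx, flip_of_notMem (by rwa [← hr])]
  unfold flipLoops
  rw [h1]

theorem IsTriangle.flip_opp (h : IsTriangle g a b c) (x : D.Dart) :
    D.flip a b c (D.opp x) = D.opp (D.flip a b c x) := by
  have key : ∀ j, D.opp (triangleDart a b c j) = triangleDart a b c (j.1, j.2 + 2) := fun j =>
    Prod.ext rfl (add_assoc _ _ _)
  by_cases hx : x ∈ Set.range (triangleDart a b c)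
  · obtain ⟨⟨k, i⟩, rfl⟩ := hx
    rw [key, h.flip_triangleDart, h.flip_triangleDart, key, triangleFlip_add_snd]
  · rw [flip_of_notMem hx, flip_of_notMem]
    rintro ⟨j, hj⟩
    exact hx ⟨_, by rw [← key, hj, opp_opp]⟩

/-- The move exchanges darts which follow each other on a strand. -/
theorem IsTriangle.dir_flip (h : IsTriangle D.glue a b c) (x : D.Dart) :
    dir (D.flip a b c x) = dir x := by
  have h1 : ∀ k, dir (triangleDart a b c (k + 1, 2)) = dir (triangleDart a b c (k, 1)) := by
    intro k
    rw [← dir_opp_glue (triangleDart a b c (k, 1)), triangleDart_glue h,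
      (triangleDart_eq a b c (k + 1)).1, (triangleDart_eq a b c (k + 1)).2.2.1]
  have h2 : ∀ k, dir (triangleDart a b c (k + 1, 0)) = dir (triangleDart a b c (k, 3)) := by
    intro k
    have := dir_opp_eq (h1 k)
    rwa [(triangleDart_eq a b c (k + 1)).2.2.1, (triangleDart_eq a b c k).2.1, opp_opp, opp_rot,
      ← (triangleDart_eq a b c (k + 1)).1, ← (triangleDart_eq a b c k).2.2.2] at this
  by_cases hx : x ∈ Set.range (triangleDart a b c)
  · obtain ⟨⟨k, i⟩, rfl⟩ := hx
    rw [h.flip_triangleDart]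
    obtain ⟨f0, f1, f2, f3⟩ := triangleFlip_apply k
    have hk : k + 2 + 1 = k := (by decide : ∀ k : Fin 3, k + 2 + 1 = k) k
    have hi : i = 0 ∨ i = 1 ∨ i = 2 ∨ i = 3 := by revert i; decide
    rcases hi with rfl | rfl | rfl | rfl
    · rw [f0, ← h2, hk]
    · rw [f1, h1]
    · rw [f2, ← h1, hk]
    · rw [f3, h2]
  · rw [flip_of_notMem hx]

end TriangleMove

theorem dir_map_iff (hD : Subsingleton D.Component) (hD' : Subsingleton D'.Component)
    {F : D.Dart → D'.Dart} (ho : ∀ x, F (D.opp x) = D'.opp (F x))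
    (hg : ∀ x, F (D.glue x) = D'.glue (F x)) (d e : D.Dart) :
    dir (F d) = dir (F e) ↔ dir d = dir e := by
  have hdir : ∀ d e, dir d = dir e → dir (F d) = dir (F e) := by
    intro d e h
    refine congrArg (Quot.lift (fun d => dir (F d)) ?_) h
    rintro d _ rfl
    rw [ho, hg, dir_opp_glue]
  refine ⟨fun h => ?_, hdir d e⟩
  by_contra hne
  have := hdir _ _ ((dir_opp_eq_iff hD d e).2 hne)
  rw [ho, dir_opp_eq_iff hD'] at this
  exact this h

theorem sum_fin_three_bool {M : Type*} [AddCommMonoid M] (F : (Fin 3 → Bool) → M) :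
    ∑ t, F t = ∑ x, ∑ y, ∑ z, F ![x, y, z] := by
  have e : ∑ t, F t = ∑ p : Bool × Bool × Bool, F ![p.1, p.2.1, p.2.2] :=
    (Fintype.sum_bijective (fun p : Bool × Bool × Bool => (![p.1, p.2.1, p.2.2] : Fin 3 → Bool))
      (by decide) _ _ fun _ => rfl).symm
  rw [e, Fintype.sum_prod_type]
  exact Finset.sum_congr rfl fun x _ => Fintype.sum_prod_type _

/-- If the three sides of a triangle do not all go from over to under, then the total weight of the
states with at least two corners cut off, taking the inner circle into account, equals the weight
of the state with no corner cut off. -/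
theorem capExp_triangle {a b c : D.Dart}
    (hover : ¬ ((D.IsOver a ↔ D.IsOver b) ∧ (D.IsOver b ↔ D.IsOver c))) :
    T (capExp a) * T (capExp b) * T (capExp c) * delta +
      T (capExp a) * T (capExp b) * T (- capExp c) + T (capExp a) * T (- capExp b) * T (capExp c) +
      T (- capExp a) * T (capExp b) * T (capExp c) =
    T (- capExp a) * T (- capExp b) * T (- capExp c) := by
  unfold capExp delta
  by_cases ha : D.IsOver a <;> by_cases hb : D.IsOver b <;> by_cases hc : D.IsOver c <;>
    simp only [ha, hb, hc, not_true, not_false_eq_true, and_self, iff_true, iff_false, iff_self] at hover <;>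
    simp only [ha, hb, hc, if_true, if_false, ← T_add, mul_sub, mul_neg] <;> norm_num
  all_goals try ring

/-- The local state sums before and after the third Reidemeister move agree if the circles of their
states are related as below. -/
theorem triangle_sum_eq {a b c : D.Dart}
    (hover : ¬ ((D.IsOver a ↔ D.IsOver b) ∧ (D.IsOver b ↔ D.IsOver c)))
    {F F' : (Fin 3 → Bool) → ℕ} (p : 0 < F ![true, true, false]) (p' : 0 < F' ![true, true, false])
    (e1 : F ![true, true, true] = F ![true, true, false] + 1)
    (e2 : F ![true, true, true] = F ![false, true, true] + 1)
    (e3 : F ![true, true, true] = F ![true, false, true] + 1)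
    (e1' : F' ![true, true, true] = F' ![true, true, false] + 1)
    (e2' : F' ![true, true, true] = F' ![false, true, true] + 1)
    (e3' : F' ![true, true, true] = F' ![true, false, true] + 1)
    (e4 : F ![false, false, false] = F' ![true, true, false])
    (e5 : F ![true, true, false] = F' ![false, false, false])
    (e6 : F ![true, false, false] = F' ![true, false, false])
    (e7 : F ![false, true, false] = F' ![false, true, false])
    (e8 : F ![false, false, true] = F' ![false, false, true]) :
    ∑ t, (∏ k, (T (if t k then capExp (![a, b, c] k) else - capExp (![a, b, c] k)) : ℤ[T;T⁻¹])) *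
        delta ^ (F t - 1) =
      ∑ t, (∏ k, (T (if t k then capExp (![a, b, c] k) else - capExp (![a, b, c] k)) : ℤ[T;T⁻¹])) *
        delta ^ (F' t - 1) := by
  obtain ⟨k, hk⟩ := Nat.exists_eq_add_of_lt p
  obtain ⟨l, hl⟩ := Nat.exists_eq_add_of_lt p'
  have f1 : F ![true, true, true] - 1 = k + 1 := by omega
  have f2 : F ![true, true, false] - 1 = k := by omega
  have f3 : F ![true, false, true] - 1 = k := by omega
  have f4 : F ![false, true, true] - 1 = k := by omega
  have f5 : F ![false, false, false] - 1 = l := by omega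
  have f1' : F' ![true, true, true] - 1 = l + 1 := by omega
  have f2' : F' ![true, true, false] - 1 = l := by omega
  have f3' : F' ![true, false, true] - 1 = l := by omega
  have f4' : F' ![false, true, true] - 1 = l := by omega
  have f5' : F' ![false, false, false] - 1 = k := by omega
  rw [sum_fin_three_bool, sum_fin_three_bool]
  simp only [Fintype.sum_bool, f1, f2, f3, f4, f5, f1', f2', f3', f4', f5', e6, e7, e8]
  have hprod : ∀ x y z : Bool, ∏ k, (T (if ![x, y, z] k then capExp (![a, b, c] k) else
      - capExp (![a, b, c] k)) : ℤ[T;T⁻¹]) = T (if x then capExp a else - capExp a) *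
      T (if y then capExp b else - capExp b) * T (if z then capExp c else - capExp c) :=
    fun x y z => Fin.prod_univ_three _
  simp only [hprod, if_true, Bool.false_eq_true, if_false, pow_succ]
  have h := capExp_triangle hover
  generalize (T (capExp a) : ℤ[T;T⁻¹]) = A at *
  generalize (T (- capExp a) : ℤ[T;T⁻¹]) = A' at *
  generalize (T (capExp b) : ℤ[T;T⁻¹]) = B at *
  generalize (T (- capExp b) : ℤ[T;T⁻¹]) = B' at *
  generalize (T (capExp c) : ℤ[T;T⁻¹]) = C at *
  generalize (T (- capExp c) : ℤ[T;T⁻¹]) = C' at *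
  generalize delta = d at *
  linear_combination (d ^ k - d ^ l) * h

theorem triangle_bijective {a b c : D.Dart} (hab : a.1 ≠ b.1) (hbc : b.1 ≠ c.1) (hca : c.1 ≠ a.1) :
    Function.Bijective (Sum.elim
      (Subtype.val : {x : Fin D.n // x ≠ a.1 ∧ x ≠ b.1 ∧ x ≠ c.1} → Fin D.n)
      fun k => (![a, b, c] k).1) := by
  constructor
  · rintro (x | x) (y | y) h
    · exact congrArg _ (Subtype.ext h)
    · have := x.2
      fin_cases y
      exacts [absurd h this.1, absurd h this.2.1, absurd h this.2.2]
    · have := y.2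
      fin_cases x
      exacts [absurd h.symm this.1, absurd h.symm this.2.1, absurd h.symm this.2.2]
    · fin_cases x <;> fin_cases y
      exacts [rfl, absurd h hab, absurd h hca.symm, absurd h hab.symm, rfl, absurd h hbc,
        absurd h hca, absurd h hbc.symm, rfl]
  · intro y
    by_cases h1 : y = a.1
    · exact ⟨Sum.inr 0, h1.symm⟩
    by_cases h2 : y = b.1
    · exact ⟨Sum.inr 1, h2.symm⟩
    by_cases h3 : y = c.1
    · exact ⟨Sum.inr 2, h3.symm⟩
    exact ⟨Sum.inl ⟨y, h1, h2, h3⟩, rfl⟩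

theorem normalizedBracket_eq_of_R3 (hD : Subsingleton D.Component)
    (hD' : Subsingleton D'.Component) (h : D.R3 D') :
    D.normalizedBracket = D'.normalizedBracket := by
  obtain ⟨a, b, c, hab, hbc, hca, ga, gb, gc, hover, f, hf, hg⟩ := h
  have htri : IsTriangle D.glue a b c := ⟨D.glue_glue, hab, hbc, hca, ga, gb, gc⟩
  have hg' : ∀ d, D'.glue (f (D.flip a b c d)) = f (D.flip a b c (D.glue d)) := fun d => by
    simpa only [CrossingMap.flip, Equiv.Perm.mul_apply] using hg d
  have hb := crossing_bijective f hf
  have hn : D.n ≠ 0 := by have := a.1.pos; omega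
  have hn' : D'.n ≠ 0 := by rw [← n_eq f hf]; exact hn
  have hbr : D.bracket = D'.bracket := by
    let ι : {x : Fin D.n // x ≠ a.1 ∧ x ≠ b.1 ∧ x ≠ c.1} → Fin D.n := Subtype.val
    have hbij : Function.Bijective (Sum.elim ι fun k => (![a, b, c] k).1) :=
      triangle_bijective hab hbc hca
    have hbij' : Function.Bijective (Sum.elim (crossing f ∘ ι) fun k => (f (![a, b, c] k)).1) := by
      have : (Sum.elim (crossing f ∘ ι) fun k => (f (![a, b, c] k)).1) =
          crossing f ∘ Sum.elim ι fun k => (![a, b, c] k).1 := by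
        funext x
        rcases x with x | x
        · rfl
        · exact hf.map_fst _
      rw [this]
      exact hb.comp hbij
    obtain ⟨u, hu1, hu2, hu3⟩ := bracket_eq_sum ι ![a, b, c] hbij
    obtain ⟨u', hu1', hu2', hu3'⟩ := bracket_eq_sum (crossing f ∘ ι) (fun k => f (![a, b, c] k)) hbij'
    rw [hu3, hu3']
    refine Finset.sum_congr rfl fun s _ => congrArg (HMul.hMul _) ?_
    have huu' : ∀ t, u' s t ∘ crossing f = u s t := by
      intro t
      funext y
      refine eq_of_capped hbij ?_ fun k _ => ?_
      · exact (hu1' s t).trans (hu1 s t).symm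
      · rw [hu2, ← hf.caps_iff, hu2']
    have hc : ∀ t, D.circles (u s t) = loops D.glue (D.smooth (u s t)) := fun t => by
      rw [circles_eq_loops, if_neg hn, add_zero]
    have hc' : ∀ t, D'.circles (u' s t) = flipLoops D.glue a b c (u s t) := fun t => by
      rw [circles_eq_loops, if_neg hn', add_zero, ← huu']
      refine (loops_conj ((D.flip a b c).trans f) hg' fun x => ?_).symm
      change D'.smooth (u' s t) (f (D.flip a b c x)) = f (D.flip a b c (D.flip a b c _))
      rw [htri.flip_flip, hf.map_smooth]
    have he : ∀ k, capExp (f (![a, b, c] k)) = capExp (![a, b, c] k) := fun k => by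
      unfold capExp; simp only [hf.2]
    have hcap : ∀ t, CapsAt (u s t) a b c t := fun t => hu2 s t
    -- States whose descriptions differ at one corner differ at most at this crossing.
    have hch : ∀ t t' (l : Fin 3), (∀ k, k ≠ l → t k = t' k) → ∀ y, y ≠ (![a, b, c] l).1 →
        u s t y = u s t' y := by
      intro t t' l htt y hy
      refine eq_of_capped hbij ((hu1 s t).trans (hu1 s t').symm) fun k hk => ?_
      rw [hu2, hu2, htt k (fun h => hy (by rw [← hk, h]))]
    have hout : ∀ t t' y, y ≠ a.1 → y ≠ b.1 → y ≠ c.1 → u s t y = u s t' y := by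
      intro t t' y h1 h2 h3
      refine eq_of_capped hbij ((hu1 s t).trans (hu1 s t').symm) fun k hk => ?_
      fin_cases k
      exacts [absurd hk.symm h1, absurd hk.symm h2, absurd hk.symm h3]
    have hA : ∀ x y z, (Caps (u s ![x, y, z]) a ↔ x = true) ∧ (Caps (u s ![x, y, z]) b ↔ y = true) ∧
        (Caps (u s ![x, y, z]) c ↔ z = true) := fun x y z =>
      ⟨hu2 s ![x, y, z] 0, hu2 s ![x, y, z] 1, hu2 s ![x, y, z] 2⟩
    obtain ⟨ta, tb, tc⟩ := hA true true true
    have e1 : loops D.glue (D.smooth (u s ![true, true, true])) =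
        loops D.glue (D.smooth (u s ![true, true, false])) + 1 :=
      htri.loops_eq (ta.2 rfl) (tb.2 rfl) (tc.2 rfl) (mt (hA _ _ _).2.2.1 (by decide))
        (hch _ _ 2 (by decide))
    have e2 : loops D.glue (D.smooth (u s ![true, true, true])) =
        loops D.glue (D.smooth (u s ![false, true, true])) + 1 :=
      htri.rotate.loops_eq (tb.2 rfl) (tc.2 rfl) (ta.2 rfl) (mt (hA _ _ _).1.1 (by decide))
        (hch _ _ 0 (by decide))
    have e3 : loops D.glue (D.smooth (u s ![true, true, true])) =
        loops D.glue (D.smooth (u s ![true, false, true])) + 1 :=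
      htri.rotate.rotate.loops_eq (tc.2 rfl) (ta.2 rfl) (tb.2 rfl)
        (mt (hA _ _ _).2.1.1 (by decide)) (hch _ _ 1 (by decide))
    have e1' : flipLoops D.glue a b c (u s ![true, true, true]) =
        flipLoops D.glue a b c (u s ![true, true, false]) + 1 :=
      htri.flipLoops_eq (ta.2 rfl) (tb.2 rfl) (tc.2 rfl) (mt (hA _ _ _).2.2.1 (by decide))
        (hch _ _ 2 (by decide))
    have e2' : flipLoops D.glue a b c (u s ![true, true, true]) =
        flipLoops D.glue a b c (u s ![false, true, true]) + 1 := by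
      rw [flipLoops_rotate htri, flipLoops_rotate htri]
      exact htri.rotate.flipLoops_eq (tb.2 rfl) (tc.2 rfl) (ta.2 rfl)
        (mt (hA _ _ _).1.1 (by decide)) (hch _ _ 0 (by decide))
    have e3' : flipLoops D.glue a b c (u s ![true, true, true]) =
        flipLoops D.glue a b c (u s ![true, false, true]) + 1 := by
      rw [flipLoops_rotate htri, flipLoops_rotate htri, flipLoops_rotate htri.rotate,
        flipLoops_rotate htri.rotate]
      exact htri.rotate.rotate.flipLoops_eq (tc.2 rfl) (ta.2 rfl) (tb.2 rfl)
        (mt (hA _ _ _).2.1.1 (by decide)) (hch _ _ 1 (by decide))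
    have e4 := htri.loops_eq_flipLoops (hcap _) (hcap _) (hout _ _) triangleEquiv_none
    have e5 := htri.loops_eq_flipLoops (hcap _) (hcap _) (hout _ _) triangleEquiv_two
    have e6 := htri.loops_eq_flipLoops (hcap _) (hcap _) (hout _ _) triangleEquiv_one_fst
    have e7 := htri.loops_eq_flipLoops (hcap _) (hcap _) (hout _ _) triangleEquiv_one_snd
    have e8 := htri.loops_eq_flipLoops (hcap _) (hcap _) (hout _ _) triangleEquiv_one_thd
    have p1 := circles_pos (u s ![true, true, false])
    have p2 := circles_pos (u' s ![true, true, false])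
    rw [hc] at p1
    rw [hc'] at p2
    simp only [he, hc, hc']
    exact triangle_sum_eq hover p1 p2 e1 e2 e3 e1' e2' e3' e4 e5 e6 e7 e8
  have hw : D.writhe = D'.writhe := by
    unfold writhe
    refine Fintype.sum_equiv (Equiv.ofBijective _ hb) _ _ fun x => ?_
    refine (sign_crossing hD hD' hf (fun d e => ?_) x).symm
    have := dir_map_iff hD hD' (F := fun x => f (D.flip a b c x))
      (fun x => by rw [htri.flip_opp, hf.map_opp]) (fun x => (hg' x).symm)
      (D.flip a b c d) (D.flip a b c e)
    simpa only [htri.flip_flip, htri.dir_flip] using this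
  unfold normalizedBracket
  rw [hbr, hw]

end CrossingMap

/-! ### Knot invariance -/

/-- The normalised bracket depends only on the knot. -/
theorem KnotDiagram.normalizedBracket_eq_of_knot_eq {D D' : KnotDiagram} (h : D.knot = D'.knot) :
    D.normalizedBracket = D'.normalizedBracket := by
  refine congrArg (Quot.lift (fun D : KnotDiagram => D.normalizedBracket) ?_) h
  rintro D D' (h | h | h | h)
  · exact CrossingMap.normalizedBracket_eq_of_iso D.single D'.single h
  · exact CrossingMap.normalizedBracket_eq_of_R1 D'.single D.single h
  · exact CrossingMap.normalizedBracket_eq_of_R2 D'.single D.single h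
  · exact CrossingMap.normalizedBracket_eq_of_R3 D.single D'.single h

namespace CrossingMap

variable {D : CrossingMap}

/-! ### Parity of the number of circles -/

section Parity

variable {g : D.Dart → D.Dart} {s s' : Fin D.n → Bool} {d : D.Dart}

/-- If no edge joins two overpasses or two underpasses, then changing one smoothing
changes the parity of the number of circles. -/
theorem odd_loops_add (hg : ∀ d, g (g d) = d) (hgo : ∀ d, D.IsOver (g d) ↔ ¬ D.IsOver d)
    (hs : ∀ y, y ≠ d.1 → s y = s' y) (hd : Caps s d) (hd' : ¬ Caps s' d) :
    Odd (loops g (D.smooth s) + loops g (D.smooth s')) := by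
  have ho : ∀ (s : Fin D.n → Bool) (d : D.Dart), D.IsOver (D.smooth s d) ↔ ¬ D.IsOver d := by
    intro s d
    by_cases h : Caps s d
    · rw [smooth_of_caps h, isOver_rot]
    · rw [smooth_of_not_caps h, isOver_rot_symm]
  have h1 := even_loops_add hg (smooth_smooth s) (smooth_smooth s') hgo (ho s) (ho s')
  have h2 := loops_self (smooth_smooth s) (ho s)
  have h3 : loops (D.smooth s) (D.smooth s) = loops (D.smooth s) (D.smooth s') + 1 := by
    refine loops_eq_add_one_of_ne hd (fun e he => (smooth_eq_of_ne hs e he).symm)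
      (fun e he => he) (loopOf_eq_of_not_caps hd' ?_) ?_
    · rw [← loopOf_left, smooth_of_caps hd, ← loopOf_right,
        smooth_of_caps ((caps_rot s' d).2 hd'), rot_rot]
    · refine loopOf_ne_of_invariant (fun v => v = d ∨ v = D.rot d) ?_ (smooth_smooth s) ?_
        (smooth_smooth s) (Or.inl rfl) ?_
      · have := smooth_smooth s d
        rintro v (rfl | rfl) <;> simp_all [smooth_of_caps hd]
      · have := smooth_smooth s d
        rintro v (rfl | rfl) <;> simp_all [smooth_of_caps hd]
      · rintro (h | h)
        · exact opp_ne d h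
        · exact rot_ne_opp d h.symm
  rw [Nat.odd_iff]
  rw [Nat.even_iff] at h1
  omega

/-- If the two arcs at a crossing belong to different circles, then changing the smoothing joins
these circles. -/
theorem loops_eq_add_one (hg : ∀ d, g (g d) = d) (hgo : ∀ d, D.IsOver (g d) ↔ ¬ D.IsOver d)
    (hs : ∀ y, y ≠ d.1 → s y = s' y) (hd : Caps s d) (hd' : ¬ Caps s' d)
    (hne : loopOf g (D.smooth s) d ≠ loopOf g (D.smooth s) (D.opp d)) :
    loops g (D.smooth s) = loops g (D.smooth s') + 1 := by
  classical
  refine loops_eq_add_one_of_ne hd (fun e he => (smooth_eq_of_ne hs e he).symm)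
    (fun e he => he) (loopOf_eq_of_not_caps hd' ?_) hne
  by_contra hne'
  -- Otherwise both states lose one circle when all four darts at the crossing are connected.
  let m' : D.Dart → D.Dart := fun e => if e.1 = d.1 then D.rot e else D.smooth s e
  have hrot : ∀ e : D.Dart, e.1 = d.1 → loopOf g m' (D.rot e) = loopOf g m' e := fun e he => by
    rw [← loopOf_right g m' e]
    exact congrArg _ (if_pos he).symm
  have hall : ∀ e : D.Dart, e.1 = d.1 → loopOf g m' e = loopOf g m' d := by
    intro e he
    rcases eq_of_fst_eq he with rfl | rfl | rfl | rfl
    · rfl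
    · exact hrot d rfl
    · rw [← rot_rot, hrot (D.rot d) rfl, hrot d rfl]
    · rw [← rot_opp, hrot (D.opp d) rfl, ← rot_rot, hrot (D.rot d) rfl, hrot d rfl]
  have hfst : ∀ e : D.Dart, e.1 = d.1 → (m' e).1 = d.1 := fun e he =>
    (congrArg Prod.fst (if_pos he)).trans he
  have h1 := loops_eq_add_one_of_ne (m' := m') hd (fun e he => if_neg he) hfst hall hne
  have h2 := loops_eq_add_one_of_ne (m' := m') (s := s') (d := D.rot d) ((caps_rot s' d).2 hd')
    (fun e he => (if_neg he).trans (smooth_eq_of_ne hs e he)) hfst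
    (fun e he => (hall e he).trans (hrot d rfl).symm) ?_
  · have h3 := odd_loops_add hg hgo hs hd hd'
    rw [Nat.odd_iff] at h3
    omega
  · have e1 : loopOf g (D.smooth s') (D.rot d) = loopOf g (D.smooth s') (D.opp d) := by
      rw [← loopOf_right, smooth_of_caps ((caps_rot s' d).2 hd'), rot_rot]
    have e2 : loopOf g (D.smooth s') (D.opp (D.rot d)) = loopOf g (D.smooth s') d := by
      rw [opp_rot, ← loopOf_right g (D.smooth s') d, smooth_of_not_caps hd']
    rw [e1, e2]
    exact fun h => hne' h.symm

/-- Changing one smoothing adds at most one circle. -/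
theorem loops_le_add_one (hg : ∀ d, g (g d) = d) (hgo : ∀ d, D.IsOver (g d) ↔ ¬ D.IsOver d)
    (hs : ∀ y, y ≠ d.1 → s y = s' y) (hd : Caps s d) (hd' : ¬ Caps s' d) :
    loops g (D.smooth s') ≤ loops g (D.smooth s) + 1 := by
  by_cases h : loopOf g (D.smooth s') d = loopOf g (D.smooth s') (D.opp d)
  · have hall := loopOf_eq_of_not_caps hd' h
    have hlift : ∀ x y, y = g x ∨ y = D.smooth s x →
        loopOf g (D.smooth s') x = loopOf g (D.smooth s') y := by
      rintro x _ (rfl | rfl)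
      · exact (loopOf_left g _ x).symm
      · by_cases hx : x.1 = d.1
        · exact (hall x hx).trans (hall (D.smooth s x) hx).symm
        · rw [smooth_eq_of_ne hs x hx]
          exact (loopOf_right g _ x).symm
    refine (Nat.card_le_card_of_surjective (Quot.lift (loopOf g (D.smooth s')) hlift) ?_).trans
      (Nat.le_succ _)
    rintro ⟨x⟩
    exact ⟨Quot.mk _ x, rfl⟩
  · have e1 : loopOf g (D.smooth s') (D.rot d) = loopOf g (D.smooth s') (D.opp d) := by
      rw [← loopOf_right, smooth_of_caps ((caps_rot s' d).2 hd'), rot_rot]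
    have e2 : loopOf g (D.smooth s') (D.opp (D.rot d)) = loopOf g (D.smooth s') d := by
      rw [opp_rot, ← loopOf_right g (D.smooth s') d, smooth_of_not_caps hd']
    refine (loops_eq_add_one (d := D.rot d) hg hgo (fun y hy => (hs y hy).symm)
      ((caps_rot s' d).2 hd') (fun h' => (caps_rot s d).1 h' hd) ?_).le
    rw [e1, e2]
    exact Ne.symm h

end Parity

end CrossingMap

/-! ### Components of a set of edges -/

/-- The number of connected components of the graph on `V` with edge set `T` (loops in `T` are
allowed, and have no effect). -/
def comps {V : Type*} (T : Set (Sym2 V)) : ℕ := Nat.card (Quot fun a b : V => s(a, b) ∈ T)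

section Comps

variable {V : Type*} {T : Set (Sym2 V)} {a b : V}

/-- The connected component of a vertex. -/
abbrev compOf (T : Set (Sym2 V)) (a : V) : Quot fun a b : V => s(a, b) ∈ T := Quot.mk _ a

theorem comps_empty : comps (∅ : Set (Sym2 V)) = Nat.card V := by
  symm
  refine Nat.card_congr (Equiv.ofBijective (Quot.mk _) ⟨?_, Quot.mk_surjective⟩)
  intro x y h
  exact congrArg (Quot.lift id (by rintro x y h; exact absurd h (Set.notMem_empty _))) h

theorem comps_insert_of_eq (h : compOf T a = compOf T b) :
    comps (insert s(a, b) T) = comps T := by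
  refine Nat.card_quot_congr ?_ fun x y hxy => Quot.sound (Set.mem_insert_of_mem _ hxy)
  rintro x y (hxy | hxy)
  · rcases Sym2.eq_iff.1 hxy with ⟨rfl, rfl⟩ | ⟨rfl, rfl⟩
    exacts [h, h.symm]
  · exact Quot.sound hxy

theorem comps_insert_of_ne [Finite V] (h : compOf T a ≠ compOf T b) :
    comps T = comps (insert s(a, b) T) + 1 := by
  refine Nat.card_quot_merge h (fun x y hxy => Quot.sound (Set.mem_insert_of_mem _ hxy))
    (Quot.sound (Set.mem_insert _ _)) ?_
  rintro x y (hxy | hxy)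
  · rcases Sym2.eq_iff.1 hxy with ⟨rfl, rfl⟩ | ⟨rfl, rfl⟩
    exacts [Or.inr (Or.inl ⟨rfl, rfl⟩), Or.inr (Or.inr ⟨rfl, rfl⟩)]
  · exact Or.inl (Quot.sound hxy)

end Comps

namespace CheckerboardColoring

open CrossingMap

variable {D : CrossingMap} (c : CheckerboardColoring D)

/-! ### States of an alternating diagram -/

theorem color_rot (d : D.Dart) : c.color (D.face (D.rot d)) = !c.color (D.face d) :=
  Bool.eq_not_of_ne (c.rot_ne d)

theorem color_opp (d : D.Dart) : c.color (D.face (D.opp d)) = c.color (D.face d) := by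
  rw [← rot_rot, color_rot, color_rot, Bool.not_not]

theorem color_rot_symm (d : D.Dart) : c.color (D.face (D.rot.symm d)) = !c.color (D.face d) := by
  rw [← rot_opp, color_rot, color_opp]

theorem _root_.CrossingMap.face_rot_symm_glue (d : D.Dart) :
    D.face (D.rot.symm (D.glue d)) = D.face d := by
  refine congrArg Sum.inl (Quot.sound ?_)
  rw [Equiv.apply_symm_apply, D.glue_glue]

theorem _root_.CrossingMap.face_glue (d : D.Dart) : D.face (D.glue d) = D.face (D.rot.symm d) := by
  rw [← face_rot_symm_glue (D.glue d), D.glue_glue]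

theorem color_glue (d : D.Dart) : c.color (D.face (D.glue d)) = !c.color (D.face d) := by
  rw [face_glue, color_rot_symm]

/-- In an alternating knot diagram, a suitable constant state cuts off all corners of a given
colour. -/
theorem exists_caps (hD : Subsingleton D.Component) (hD' : D.IsAlternating) (b : Bool) :
    ∃ t : Bool, ∀ d : D.Dart, Caps (fun _ => t) d ↔ c.color (D.face d) = b := by
  classical
  by_cases hn : Nonempty D.Dart
  · obtain ⟨d⟩ := hn
    obtain ⟨t, ht⟩ : ∃ t : Bool, Caps (fun _ => t) d ↔ c.color (D.face d) = b := by
      by_cases h1 : c.color (D.face d) = b <;> by_cases h2 : D.IsOver d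
      exacts [⟨false, by simp [Caps, h1, h2]⟩, ⟨true, by simp [Caps, h1, h2]⟩,
        ⟨true, by simp [Caps, h1, h2]⟩, ⟨false, by simp [Caps, h1, h2]⟩]
    refine ⟨t, fun e => component_induction hD (P := fun e => Caps (fun _ => t) e ↔
      c.color (D.face e) = b) d ht (fun e => ?_) (fun e => ?_) e⟩
    · have h : Caps (fun _ => t) (D.glue e) ↔ ¬ Caps (fun _ => t) e := by
        unfold Caps; rw [hD']; tauto
      rw [h, color_glue]
      cases c.color (D.face e) <;> cases b <;> simp
    · rw [caps_opp, color_opp]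
  · exact ⟨true, fun d => absurd ⟨d⟩ hn⟩

/-- The region of colour `b` at the edge of the dart `d`. -/
def region (b : Bool) (d : D.Dart) : {F : D.Face // c.color F = b} :=
  if h : c.color (D.face d) = b then ⟨D.face d, h⟩ else
    ⟨D.face (D.rot.symm d), by rw [color_rot_symm]; cases b <;> simpa using h⟩

variable {b : Bool}

theorem region_of_eq {d : D.Dart} (h : c.color (D.face d) = b) :
    (c.region b d : D.Face) = D.face d := by
  rw [region, dif_pos h]

theorem region_of_ne {d : D.Dart} (h : c.color (D.face d) ≠ b) :
    (c.region b d : D.Face) = D.face (D.rot.symm d) := by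
  rw [region, dif_neg h]

theorem region_rot {d : D.Dart} (h : c.color (D.face d) = b) :
    c.region b (D.rot d) = c.region b d := by
  apply Subtype.ext
  rw [region_of_eq c h, region_of_ne c, Equiv.symm_apply_apply]
  rw [color_rot, ← h]
  exact Bool.not_ne_self _

theorem region_rot_symm {d : D.Dart} (h : c.color (D.face d) ≠ b) :
    c.region b (D.rot.symm d) = c.region b d := by
  have h' : c.color (D.face (D.rot.symm d)) = b := by
    rw [color_rot_symm]; exact (Bool.eq_not_of_ne h.symm).symm
  rw [← region_rot c h', Equiv.apply_symm_apply]

theorem region_glue (d : D.Dart) : c.region b (D.glue d) = c.region b d := by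
  apply Subtype.ext
  by_cases h : c.color (D.face d) = b
  · rw [region_of_eq c h, region_of_ne c, face_rot_symm_glue]
    rw [color_glue, ← h]
    exact Bool.not_ne_self _
  · rw [region_of_ne c h, region_of_eq c, face_glue]
    rw [color_glue]; exact (Bool.eq_not_of_ne (Ne.symm h)).symm

/-- The two ends of a crossing, as an edge of the checkerboard graph of colour `b`. -/
def ends (b : Bool) (x : Fin D.n) : Sym2 {F : D.Face // c.color F = b} :=
  s(c.region b (x, 0), c.region b (x, 2))

theorem region_region_opp (d : D.Dart) :
    s(c.region b d, c.region b (D.opp d)) = c.ends b d.1 := by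
  have key : ∀ d : D.Dart, s(c.region b (D.rot d), c.region b (D.opp (D.rot d))) =
      s(c.region b d, c.region b (D.opp d)) := by
    intro d
    by_cases h : c.color (D.face d) = b
    · rw [opp_rot, ← rot_opp, region_rot c h, region_rot c ((c.color_opp d).trans h)]
    · have h' : c.color (D.face (D.opp d)) ≠ b := by rwa [color_opp]
      rw [opp_rot, region_rot_symm c h, ← rot_symm_opp, region_rot_symm c h', Sym2.eq_swap]
  have h0 : c.ends b d.1 = s(c.region b (d.1, 0), c.region b (D.opp (d.1, 0))) := rfl
  rw [h0]
  rcases eq_of_fst_eq (d := d) (e := (d.1, 0)) rfl with h | h | h | h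
  · rw [h]
  · rw [h, key]
  · rw [h, ← key d, ← key (D.rot d), rot_rot]
  · rw [h, ← key (D.rot.symm d), Equiv.apply_symm_apply]

/-- The state in which precisely the crossings in `S` are smoothed such that corners of the colour
opposite to that of the constant state `t` are cut off. -/
def state (t : Bool) (S : Finset (Fin D.n)) (x : Fin D.n) : Bool := if x ∈ S then !t else t

theorem state_empty (t : Bool) : state t (∅ : Finset (Fin D.n)) = fun _ => t := by
  funext x; simp [state]

theorem state_univ (t : Bool) : state t (Finset.univ : Finset (Fin D.n)) = fun _ => !t := by
  funext x; simp [state]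

instance : Finite D.Face := inferInstanceAs (Finite ((Quot _) ⊕ {_b : Bool // D.n = 0}))

theorem card_add_card (hp : Nat.card D.Face = D.n + 2) (b : Bool) :
    Nat.card {F : D.Face // c.color F = b} + Nat.card {F : D.Face // c.color F = !b} = D.n + 2 := by
  rw [← hp, ← Nat.card_sum]
  refine Nat.card_congr (Equiv.trans (Equiv.sumCongr (Equiv.refl _)
    (Equiv.subtypeEquivRight fun F => ?_)) (Equiv.sumCompl fun F => c.color F = b))
  cases c.color F <;> cases b <;> simp

theorem card_pos (b : Bool) : 0 < Nat.card {F : D.Face // c.color F = b} := by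
  refine Nat.card_pos_iff.2 ⟨?_, inferInstance⟩
  by_cases h : D.n = 0
  · have := c.circle_ne h
    by_cases h1 : c.color (Sum.inr ⟨true, h⟩) = b
    · exact ⟨⟨_, h1⟩⟩
    · refine ⟨⟨Sum.inr ⟨false, h⟩, ?_⟩⟩
      cases h2 : c.color (Sum.inr ⟨true, h⟩) <;> cases h3 : c.color (Sum.inr ⟨false, h⟩) <;>
        cases b <;> simp_all
  · exact ⟨c.region b (⟨0, Nat.pos_of_ne_zero h⟩, 0)⟩

/-- The state that cuts off all corners of colour `b` consists of the boundaries of the regions of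
colour `b`. -/
theorem circles_const (hp : Nat.card D.Face = D.n + 2) {t : Bool}
    (ht : ∀ d : D.Dart, Caps (fun _ => t) d ↔ c.color (D.face d) = b) :
    D.circles (fun _ => t) = Nat.card {F : D.Face // c.color F = b} := by
  rw [circles_eq_loops]
  by_cases hn : D.n = 0
  · have h1 := c.card_add_card hp b
    have h2 := c.card_pos b
    have h3 := c.card_pos (!b)
    have : IsEmpty D.Dart := ⟨fun d => by have := d.1.2; omega⟩
    have h4 : loops D.glue (D.smooth fun _ => t) = 0 := by
      have : IsEmpty (Quot fun d e : D.Dart => e = D.glue d ∨ e = D.smooth (fun _ => t) d) :=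
        ⟨fun q => by obtain ⟨d⟩ := q; exact this.elim d⟩
      exact Nat.card_of_isEmpty
    rw [if_pos hn, h4]
    omega
  rw [if_neg hn, add_zero]
  have hs : ∀ d, c.region b (D.smooth (fun _ => t) d) = c.region b d := by
    intro d
    by_cases h : c.color (D.face d) = b
    · rw [smooth_of_caps ((ht d).2 h), region_rot c h]
    · rw [smooth_of_not_caps (mt (ht d).1 h), region_rot_symm c h]
  have hlift : ∀ x y, y = D.glue x ∨ y = D.smooth (fun _ => t) x → c.region b x = c.region b y := by
    rintro x _ (rfl | rfl)
    exacts [(region_glue c x).symm, (hs x).symm]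
  refine Nat.card_congr (Equiv.ofBijective (Quot.lift (c.region b) hlift) ⟨?_, ?_⟩)
  · -- It suffices to compare darts whose own corners have the colour `b`.
    have hrep : ∀ d, ∃ d', c.color (D.face d') = b ∧
        loopOf D.glue (D.smooth fun _ => t) d' = loopOf D.glue (D.smooth fun _ => t) d := by
      intro d
      by_cases h : c.color (D.face d) = b
      · exact ⟨d, h, rfl⟩
      · refine ⟨D.smooth (fun _ => t) d, ?_, loopOf_right _ _ d⟩
        rw [smooth_of_not_caps (mt (ht d).1 h), color_rot_symm]
        exact (Bool.eq_not_of_ne (Ne.symm h)).symm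
    rintro ⟨d⟩ ⟨e⟩ h
    obtain ⟨d', hd', hd⟩ := hrep d
    obtain ⟨e', he', he⟩ := hrep e
    change loopOf _ _ d = loopOf _ _ e
    rw [← hd, ← he]
    have h : c.region b d' = c.region b e' := by
      have h1 := congrArg (Quot.lift (c.region b) hlift) hd
      have h2 := congrArg (Quot.lift (c.region b) hlift) he
      exact h1.trans (h.trans h2.symm)
    have h' := congrArg Subtype.val h
    rw [region_of_eq c hd', region_of_eq c he'] at h'
    -- Walking around a region of colour `b` stays on one circle.
    let w : D.Dart → Quot (fun d e : D.Dart => e = D.glue d ∨ e = D.smooth (fun _ => t) d) :=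
      fun d => if c.color (D.face d) = b then loopOf D.glue (D.smooth fun _ => t) d else
        loopOf D.glue (D.smooth fun _ => t) d'
    have hw : ∀ x y : D.Dart, y = D.glue (D.rot x) → w x = w y := by
      rintro x _ rfl
      have hx : c.color (D.face (D.glue (D.rot x))) = c.color (D.face x) := by
        rw [color_glue, color_rot, Bool.not_not]
      simp only [w, hx]
      split_ifs with hxb
      · rw [loopOf_left, ← smooth_of_caps ((ht x).2 hxb), loopOf_right]
      · rfl
    have h3 := congrArg (Quot.lift w hw) (Sum.inl_injective h')
    change w d' = w e' at h3
    simpa only [w, hd', he', if_true] using h3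
  · rintro ⟨F, hF⟩
    rcases F with ⟨⟨d⟩⟩ | ⟨_, h⟩
    · exact ⟨Quot.mk _ d, Subtype.ext (region_of_eq c (d := d) hF)⟩
    · exact absurd h hn

theorem region_cases (d e : D.Dart) (h : e.1 = d.1) :
    c.region b e = c.region b d ∨ c.region b e = c.region b (D.opp d) := by
  have h1 := c.region_region_opp (b := b) d
  have h2 := c.region_region_opp (b := b) e
  rw [h, ← h1] at h2
  rcases Sym2.eq_iff.1 h2 with h | h
  exacts [Or.inl h.1, Or.inr h.1]

/-- The amount by which the number of circles of a state exceeds its expected value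
`|S| + 2 k(S) - |V|`; it turns out to be zero. -/
def defect (b t : Bool) (S : Finset (Fin D.n)) : ℤ :=
  D.circles (state t S) + Nat.card {F : D.Face // c.color F = b} - S.card -
    2 * comps (c.ends b '' S)

/-- The defect does not increase with `S`: a crossing between two components joins two circles, and any
other one adds at most one circle. -/
theorem defect_insert_le (hA : D.IsAlternating) {t : Bool}
    (ht : ∀ d : D.Dart, Caps (fun _ => t) d ↔ c.color (D.face d) = b) {S : Finset (Fin D.n)}
    {x : Fin D.n} (hx : x ∉ S) : c.defect b t (insert x S) ≤ c.defect b t S := by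
  have hn : D.n ≠ 0 := by have := x.2; omega
  unfold defect
  rw [circles_eq_loops, circles_eq_loops, if_neg hn, add_zero, add_zero,
    Finset.card_insert_of_notMem hx, Finset.coe_insert, Set.image_insert_eq]
  have hS : ∀ y, y ≠ x → state t S y = state t (insert x S) y := by
    intro y hy; simp [state, hy]
  obtain ⟨d, rfl, hd⟩ : ∃ d : D.Dart, d.1 = x ∧ Caps (fun _ => t) d := by
    by_cases h : Caps (fun _ => t) ((x, 0) : D.Dart)
    · exact ⟨(x, 0), rfl, h⟩
    · exact ⟨D.rot (x, 0), rfl, (caps_rot _ _).2 h⟩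
  have hd1 : Caps (state t S) d := by
    unfold Caps at hd ⊢; simpa [state, hx] using hd
  have hd2 : ¬ Caps (state t (insert d.1 S)) d := by
    unfold Caps at hd ⊢
    have : state t (insert d.1 S) d.1 = !t := by simp [state]
    rw [this, ← hd]
    cases t <;> simp
  rw [← region_region_opp]
  by_cases hc : compOf (c.ends b '' S) (c.region b d) = compOf (c.ends b '' S) (c.region b (D.opp d))
  · rw [comps_insert_of_eq hc]
    have := loops_le_add_one D.glue_glue hA hS hd1 hd2
    push_cast
    omega
  · have h1 := comps_insert_of_ne hc
    have h2 := loops_eq_add_one D.glue_glue hA hS hd1 hd2 ?_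
    · push_cast
      omega
    · -- The component of the region at a dart is constant along a circle of the state.
      intro h
      refine hc (congrArg (Quot.lift (fun e => compOf (c.ends b '' S) (c.region b e)) ?_) h)
      rintro e _ (rfl | rfl)
      · exact congrArg (compOf _) (region_glue c e).symm
      · by_cases he : e.1 ∈ S
        · have hlink : compOf (c.ends b '' S) (c.region b e) =
              compOf (c.ends b '' S) (c.region b (D.opp e)) :=
            Quot.sound (by rw [region_region_opp]; exact Set.mem_image_of_mem _ he)
          rcases c.region_cases (b := b) e (D.smooth (state t S) e) rfl with h | h <;>
            simp only [h, hlink]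
        · have : D.smooth (state t S) e = D.smooth (fun _ => t) e :=
            smooth_congr (by simp [state, he])
          rw [this]
          by_cases h : c.color (D.face e) = b
          · rw [smooth_of_caps ((ht e).2 h), region_rot c h]
          · rw [smooth_of_not_caps (mt (ht e).1 h), region_rot_symm c h]

theorem defect_union_le (hA : D.IsAlternating) {t : Bool}
    (ht : ∀ d : D.Dart, Caps (fun _ => t) d ↔ c.color (D.face d) = b) (S S' : Finset (Fin D.n)) :
    c.defect b t (S' ∪ S) ≤ c.defect b t S := by
  induction S' using Finset.induction_on with
  | empty => rw [Finset.empty_union]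
  | insert x S' _ ih =>
    rw [Finset.insert_union]
    by_cases hx : x ∈ S' ∪ S
    · rwa [Finset.insert_eq_of_mem hx]
    · exact (c.defect_insert_le hA ht hx).trans ih

end CheckerboardColoring

namespace KnotDiagram

open CrossingMap CheckerboardColoring

variable {D : KnotDiagram} (c : CheckerboardColoring D.toCrossingMap) {b : Bool}

/-- The checkerboard graph is connected. -/
theorem compOf_univ (F H : {F : D.Face // c.color F = b}) :
    compOf (Set.range (c.ends b)) F = compOf (Set.range (c.ends b)) H := by
  by_cases hn : D.n = 0
  · have h1 := c.card_add_card D.planar b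
    have h2 := c.card_pos b
    have h3 := c.card_pos (!b)
    have : Subsingleton {F : D.Face // c.color F = b} :=
      (Nat.card_eq_one_iff_unique.1 (by omega)).1
    rw [this.elim F H]
  · have hsurj : ∀ F : {F : D.Face // c.color F = b}, ∃ d, c.region b d = F := by
      rintro ⟨F, hF⟩
      rcases F with ⟨⟨d⟩⟩ | ⟨_, h⟩
      · exact ⟨d, Subtype.ext (region_of_eq c (d := d) hF)⟩
      · exact absurd h hn
    obtain ⟨d, rfl⟩ := hsurj F
    obtain ⟨e, rfl⟩ := hsurj H
    refine component_induction D.single (P := fun e => compOf (Set.range (c.ends b)) (c.region b d) =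
      compOf (Set.range (c.ends b)) (c.region b e)) d rfl (fun e => ?_) (fun e => ?_) e
    · rw [region_glue]
    · have : compOf (Set.range (c.ends b)) (c.region b e) =
          compOf (Set.range (c.ends b)) (c.region b (D.opp e)) :=
        Quot.sound (by rw [region_region_opp]; exact Set.mem_range_self _)
      rw [this]

theorem comps_range : comps (Set.range (c.ends b)) = 1 := by
  have := (Nat.card_pos_iff.1 (c.card_pos b)).1
  refine Nat.card_eq_one_iff_unique.2 ⟨⟨?_⟩, ⟨Quot.mk _ this.some⟩⟩
  rintro ⟨F⟩ ⟨H⟩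
  exact compOf_univ c F H

/-- In an alternating diagram, every state consists of the boundary curves of a neighbourhood of a
spanning subgraph of the checkerboard graph, and Euler's formula counts these. -/
theorem circles_add_card (hA : D.IsAlternating) {t : Bool}
    (ht : ∀ d : D.Dart, Caps (fun _ => t) d ↔ c.color (D.face d) = b) (S : Finset (Fin D.n)) :
    D.circles (state t S) + Nat.card {F : D.Face // c.color F = b} =
      S.card + 2 * comps (c.ends b '' S) := by
  -- The monotone defect vanishes for the two constant states, for the latter by Euler's formula.
  have h0 : c.defect b t ∅ = 0 := by
    unfold defect
    rw [state_empty, c.circles_const D.planar ht, Finset.coe_empty, Set.image_empty, comps_empty,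
      Finset.card_empty]
    push_cast; ring
  have ht' : ∀ d : D.Dart, Caps (fun _ => !t) d ↔ c.color (D.face d) = !b := by
    intro d
    have := ht d
    unfold Caps at this ⊢
    revert this
    cases t <;> cases b <;> cases c.color (D.face d) <;> simp
  have h1 : c.defect b t Finset.univ = 0 := by
    unfold defect
    rw [state_univ, c.circles_const D.planar ht', Finset.coe_univ, Set.image_univ, comps_range,
      Finset.card_univ, Fintype.card_fin]
    have := c.card_add_card D.planar b
    push_cast
    omega
  have h2 := c.defect_union_le hA ht ∅ S
  have h3 := c.defect_union_le hA ht S Finset.univ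
  rw [Finset.union_empty] at h2
  rw [Finset.union_eq_left.2 (Finset.subset_univ S)] at h3
  have h4 : c.defect b t S = 0 := by omega
  unfold defect at h4
  omega

end KnotDiagram

/-! ### The cycle rank of a set of edges -/

section CycleRank

variable {V : Type*} [Fintype V] {F F' : Finset (Sym2 V)} {e : Sym2 V} {a b : V}

/-- The cycle rank of the graph on `V` with edge set `F`. -/
def cycleRank (F : Finset (Sym2 V)) : ℤ := F.card + comps (F : Set (Sym2 V)) - Fintype.card V

theorem cycleRank_empty : cycleRank (∅ : Finset (Sym2 V)) = 0 := by
  simp [cycleRank, comps_empty]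

variable [DecidableEq V]

theorem cycleRank_insert_of_eq (hF : s(a, b) ∉ F)
    (h : compOf (F : Set (Sym2 V)) a = compOf (F : Set (Sym2 V)) b) :
    cycleRank (insert s(a, b) F) = cycleRank F + 1 := by
  unfold cycleRank
  rw [Finset.card_insert_of_notMem hF, Finset.coe_insert, comps_insert_of_eq h]
  push_cast; ring

theorem cycleRank_insert_of_ne
    (h : compOf (F : Set (Sym2 V)) a ≠ compOf (F : Set (Sym2 V)) b) :
    cycleRank (insert s(a, b) F) = cycleRank F := by
  have hF : s(a, b) ∉ F := fun h' => h (Quot.sound (Finset.mem_coe.2 h'))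
  unfold cycleRank
  rw [Finset.card_insert_of_notMem hF, Finset.coe_insert, comps_insert_of_ne h]
  push_cast; ring

theorem cycleRank_le_insert (e : Sym2 V) (F : Finset (Sym2 V)) :
    cycleRank F ≤ cycleRank (insert e F) := by
  induction e with | _ a b
  by_cases hF : s(a, b) ∈ F
  · rw [Finset.insert_eq_of_mem hF]
  · by_cases h : compOf (F : Set (Sym2 V)) a = compOf (F : Set (Sym2 V)) b
    · rw [cycleRank_insert_of_eq hF h]; omega
    · rw [cycleRank_insert_of_ne h]

theorem cycleRank_le_union (F F' : Finset (Sym2 V)) : cycleRank F ≤ cycleRank (F' ∪ F) := by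
  induction F' using Finset.induction_on with
  | empty => rw [Finset.empty_union]
  | insert e F' _ ih =>
    rw [Finset.insert_union]
    exact ih.trans (cycleRank_le_insert _ _)

theorem cycleRank_mono (h : F ⊆ F') : cycleRank F ≤ cycleRank F' := by
  have := cycleRank_le_union F F'
  rwa [Finset.union_eq_left.2 h] at this

theorem cycleRank_nonneg (F : Finset (Sym2 V)) : 0 ≤ cycleRank F := by
  have := cycleRank_mono (Finset.empty_subset F)
  rwa [cycleRank_empty] at this

/-- An edge with an end that belongs to no other edge lies on no cycle. -/
theorem cycleRank_insert_leaf (hab : a ≠ b) (ha : ∀ f ∈ F, a ∉ f) :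
    cycleRank (insert s(a, b) F) = cycleRank F := by
  refine cycleRank_insert_of_ne fun h => ?_
  have := congrArg (Quot.lift (fun x => x = a) ?_) h
  · exact hab (this.mp rfl).symm
  · intro x y hxy
    refine propext ⟨fun hx => ?_, fun hy => ?_⟩
    · exact absurd (hx ▸ Sym2.mem_mk_left x y) (ha _ hxy)
    · exact absurd (hy ▸ Sym2.mem_mk_right x y) (ha _ hxy)

theorem cycleRank_singleton (he : ¬ e.IsDiag) : cycleRank {e} = 0 := by
  induction e with | _ a b
  rw [← cycleRank_empty (V := V), ← insert_empty_eq (s(a, b))]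
  exact cycleRank_insert_leaf he (by simp)

/-- The set of edges has the form of a triangle. -/
def IsTri (F : Finset (Sym2 V)) : Prop :=
  ∃ a b c : V, a ≠ b ∧ a ≠ c ∧ b ≠ c ∧ F = {s(a, b), s(a, c), s(b, c)}

theorem cycleRank_pair {e f : Sym2 V} (he : ¬ e.IsDiag) (hf : ¬ f.IsDiag) :
    cycleRank {e, f} = 0 := by
  by_cases hef : e = f
  · rw [hef, Finset.pair_eq_singleton, cycleRank_singleton hf]
  induction e with | _ a b
  have hab : a ≠ b := he
  by_cases ha : a ∈ f
  · have hb : b ∉ f := fun hb => hef ((Sym2.mem_and_mem_iff hab).1 ⟨ha, hb⟩).symm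
    rw [Sym2.eq_swap, cycleRank_insert_leaf hab.symm (by simpa using hb), cycleRank_singleton hf]
  · rw [cycleRank_insert_leaf hab (by simpa using ha), cycleRank_singleton hf]

theorem IsTri.cycleRank (h : IsTri F) : cycleRank F = 1 := by
  obtain ⟨a, b, c, hab, hac, hbc, rfl⟩ := h
  rw [cycleRank_insert_of_eq, cycleRank_pair (e := s(a, c)) (f := s(b, c)) hac hbc, zero_add]
  · simp only [Finset.mem_insert, Finset.mem_singleton, Sym2.eq_iff]
    tauto
  · have h1 : compOf (({s(a, c), s(b, c)} : Finset (Sym2 V)) : Set (Sym2 V)) a = compOf _ c :=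
      Quot.sound (by simp)
    have h2 : compOf (({s(a, c), s(b, c)} : Finset (Sym2 V)) : Set (Sym2 V)) b = compOf _ c :=
      Quot.sound (by simp)
    exact h1.trans h2.symm

/-- Among three edges of positive cycle rank, each end of each edge is shared. -/
theorem mem_or_mem_of_cycleRank_ne {e f g : Sym2 V} (he : ¬ e.IsDiag) (hf : ¬ f.IsDiag)
    (hg : ¬ g.IsDiag) (h : cycleRank {e, f, g} ≠ 0) {v : V} (hv : v ∈ e) : v ∈ f ∨ v ∈ g := by
  by_contra! hv'
  obtain ⟨w, rfl⟩ := hv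
  apply h
  rw [cycleRank_insert_leaf he (by simpa using hv'), cycleRank_pair hf hg]

theorem isTri_of_cycleRank_ne {e f g : Sym2 V} (he : ¬ e.IsDiag) (hf : ¬ f.IsDiag)
    (hg : ¬ g.IsDiag) (hef : e ≠ f) (heg : e ≠ g) (h : cycleRank {e, f, g} ≠ 0) :
    IsTri {e, f, g} := by
  have key : ∀ {a b : V} {f g : Sym2 V}, ¬ s(a, b).IsDiag → ¬ f.IsDiag → ¬ g.IsDiag →
      s(a, b) ≠ f → cycleRank {s(a, b), f, g} ≠ 0 → a ∈ f → IsTri {s(a, b), f, g} := by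
    intro a b f g he hf hg hef h ha
    obtain ⟨c, rfl⟩ := ha
    have hab : a ≠ b := he
    have hac : a ≠ c := hf
    have hbc : b ≠ c := fun h => hef (by rw [h])
    have hb : b ∈ g := by
      refine (mem_or_mem_of_cycleRank_ne he hf hg h (Sym2.mem_mk_right a b)).resolve_left ?_
      rw [Sym2.mem_iff]; tauto
    have hc : c ∈ g := by
      rw [Finset.insert_comm] at h
      refine (mem_or_mem_of_cycleRank_ne hf he hg h (Sym2.mem_mk_right a c)).resolve_left ?_
      rw [Sym2.mem_iff]; tauto
    have := (Sym2.mem_and_mem_iff hbc).1 ⟨hb, hc⟩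
    subst this
    exact ⟨a, b, c, hab, hac, hbc, rfl⟩
  induction e with | _ a b
  rcases mem_or_mem_of_cycleRank_ne he hf hg h (Sym2.mem_mk_left a b) with ha | ha
  · exact key he hf hg hef h ha
  · rw [Finset.pair_comm] at h ⊢
    exact key he hg hf heg h ha

/-- The rank of more than three edges is at least three. -/
theorem cycleRank_add_three_le (hF : ∀ e ∈ F, ¬ e.IsDiag) (h3 : 3 ≤ F.card) (hT : ¬ IsTri F) :
    cycleRank F + 3 ≤ F.card := by
  -- It suffices to find three edges of rank three.
  have key : ∀ G ⊆ F, G.card = 3 → cycleRank G = 0 → cycleRank F + 3 ≤ F.card := by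
    intro G hGF hG h0
    -- Each further edge raises the cycle rank by at most one.
    have hins : ∀ (e : Sym2 V) (H : Finset (Sym2 V)), e ∉ H →
        cycleRank (insert e H) ≤ cycleRank H + 1 := by
      intro e H he
      induction e with | _ a b
      by_cases h : compOf (H : Set (Sym2 V)) a = compOf (H : Set (Sym2 V)) b
      · rw [cycleRank_insert_of_eq he h]
      · rw [cycleRank_insert_of_ne h]; omega
    have hun : ∀ H : Finset (Sym2 V), Disjoint H G → cycleRank (H ∪ G) ≤ H.card := by
      intro H
      induction H using Finset.induction_on with
      | empty => intro _; rw [Finset.empty_union, h0]; simp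
      | insert e H he ih =>
        intro hd
        rw [Finset.disjoint_insert_left] at hd
        rw [Finset.insert_union, Finset.card_insert_of_notMem he]
        refine (hins _ _ ?_).trans ?_
        · rw [Finset.mem_union]; tauto
        · have := ih hd.2; push_cast; omega
    have h1 := hun (F \ G) Finset.sdiff_disjoint
    rw [Finset.sdiff_union_of_subset hGF] at h1
    have h2 := Finset.card_sdiff_add_card_eq_card hGF
    omega
  by_contra hcon
  have hpos : ∀ G ⊆ F, G.card = 3 → IsTri G := by
    intro G hGF hG
    have hr : cycleRank G ≠ 0 := fun h0 => hcon (key G hGF hG h0)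
    obtain ⟨e, f, g, hef, heg, hfg, rfl⟩ := Finset.card_eq_three.1 hG
    exact isTri_of_cycleRank_ne (hF _ (hGF (by simp))) (hF _ (hGF (by simp)))
      (hF _ (hGF (by simp))) hef heg hr
  obtain ⟨G, hGF, hG⟩ := Finset.exists_subset_card_eq h3
  have hGF' : G ≠ F := fun h => hT (h ▸ hpos G hGF hG)
  obtain ⟨p, hpF, hpG⟩ := Finset.exists_of_ssubset (hGF.ssubset_of_ne hGF')
  obtain ⟨a, b, c, hab, hac, hbc, rfl⟩ := hpos G hGF hG
  -- Replacing one edge of a triangle by another one leaves an end which is not shared.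
  have hp : IsTri {p, s(a, b), s(a, c)} := by
    refine hpos _ ?_ ?_
    · intro x hx
      simp only [Finset.mem_insert, Finset.mem_singleton] at hx
      rcases hx with rfl | rfl | rfl
      exacts [hpF, hGF (by simp), hGF (by simp)]
    · refine Finset.card_eq_three.2 ⟨_, _, _, ?_, ?_, ?_, rfl⟩
      · rintro rfl; simp at hpG
      · rintro rfl; simp at hpG
      · simp only [ne_eq, Sym2.eq_iff]; tauto
  have hpd := hF p hpF
  have hmem : ∀ v ∈ p, v = a ∨ v = b ∨ v = c := by
    intro v hv
    rcases mem_or_mem_of_cycleRank_ne hpd (f := s(a, b)) (g := s(a, c)) hab hac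
      (by rw [hp.cycleRank]; decide) hv with h | h <;>
    · rw [Sym2.mem_iff] at h; tauto
  induction p with | _ x y
  have hxy : x ≠ y := hpd
  apply hpG
  rcases hmem x (Sym2.mem_mk_left x y) with rfl | rfl | rfl <;>
    rcases hmem y (Sym2.mem_mk_right x y) with rfl | rfl | rfl <;>
    first | exact absurd rfl hxy | simp [Sym2.eq_swap]

open Classical in
/-- The number of triangles of the graph with edge set `F`. -/
def numTri (F : Finset (Sym2 V)) : ℕ := {G ∈ F.powersetCard 3 | IsTri G}.card

/-- If two vertices have `k` common neighbours, then the cycle rank is at least `k - 1`. -/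
theorem card_le_cycleRank_add_one {u v : V} (huv : u ≠ v) (W : Finset V) (hu : u ∉ W) (hv : v ∉ W)
    (hWu : ∀ w ∈ W, s(u, w) ∈ F) (hWv : ∀ w ∈ W, s(v, w) ∈ F) :
    (W.card : ℤ) ≤ cycleRank F + 1 := by
  have key : (W.card : ℤ) ≤ cycleRank (W.image (fun w => s(u, w)) ∪ W.image (fun w => s(v, w))) + 1 := by
    clear hWu hWv
    induction W using Finset.induction_on with
    | empty => simp [cycleRank_empty]
    | insert w W hw ih =>
      simp only [Finset.mem_insert, not_or] at hu hv
      have ih := ih hu.2 hv.2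
      rw [Finset.image_insert, Finset.image_insert, Finset.insert_union, Finset.union_insert,
        Finset.insert_comm, Finset.card_insert_of_notMem hw]
      set H := W.image (fun w => s(u, w)) ∪ W.image (fun w => s(v, w)) with hH
      rcases W.eq_empty_or_nonempty with rfl | ⟨z, hz⟩
      · have := cycleRank_nonneg (insert s(v, w) (insert s(u, w) H))
        simpa using this
      · rw [cycleRank_insert_of_eq]
        · have := cycleRank_le_insert s(u, w) H
          push_cast
          omega
        · simp only [hH, Finset.mem_insert, Finset.mem_union, Finset.mem_image, Sym2.eq_iff]
          rintro ((h | h) | ⟨x, hx, (h | h)⟩ | ⟨x, hx, (h | h)⟩)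
          · exact huv h.1.symm
          · exact hv.1 h.1
          · exact huv h.1
          · exact hu.1 h.1
          · exact hw (h.2 ▸ hx)
          · exact hv.1 h.1
        · have h1 : compOf (↑(insert s(u, w) H) : Set (Sym2 V)) v = compOf _ z :=
            Quot.sound (by
              simp only [Finset.coe_insert, Set.mem_insert_iff, Finset.mem_coe, hH,
                Finset.mem_union, Finset.mem_image]
              exact Or.inr (Or.inr ⟨z, hz, rfl⟩))
          have h2 : compOf (↑(insert s(u, w) H) : Set (Sym2 V)) u = compOf _ z :=
            Quot.sound (by
              simp only [Finset.coe_insert, Set.mem_insert_iff, Finset.mem_coe, hH,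
                Finset.mem_union, Finset.mem_image]
              exact Or.inr (Or.inl ⟨z, hz, rfl⟩))
          have h3 : compOf (↑(insert s(u, w) H) : Set (Sym2 V)) u = compOf _ w :=
            Quot.sound (by simp)
          exact h1.trans (h2.symm.trans h3)
  refine key.trans (add_le_add_left (cycleRank_mono ?_) 1)
  intro x hx
  simp only [Finset.mem_union, Finset.mem_image] at hx
  rcases hx with ⟨w, hw, rfl⟩ | ⟨w, hw, rfl⟩
  exacts [hWu w hw, hWv w hw]

/-- A graph of cycle rank `r` has at most `r (r + 1) / 2` triangles. -/
theorem two_mul_numTri_le (hF : ∀ e ∈ F, ¬ e.IsDiag) :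
    2 * (numTri F : ℤ) ≤ cycleRank F * (cycleRank F + 1) := by
  classical
  induction F using Finset.induction_on with
  | empty =>
    have : Finset.powersetCard 3 (∅ : Finset (Sym2 V)) = ∅ :=
      Finset.powersetCard_eq_empty.2 (by simp)
    simp [numTri, cycleRank_empty, this]
  | insert e F he ih =>
    have ih := ih fun f hf => hF f (Finset.mem_insert_of_mem hf)
    have hed := hF e (Finset.mem_insert_self _ _)
    have hFd : ∀ f ∈ F, ¬ f.IsDiag := fun f hf => hF f (Finset.mem_insert_of_mem hf)
    clear hF
    induction e with | _ u v
    have huv : u ≠ v := hed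
    let W : Finset V := {w | s(u, w) ∈ F ∧ s(v, w) ∈ F}
    have htri : numTri (insert s(u, v) F) ≤ numTri F + W.card := by
      unfold numTri
      refine (Finset.card_le_card ?_).trans ((Finset.card_union_le _ (W.image fun w =>
        ({s(u, v), s(u, w), s(v, w)} : Finset (Sym2 V)))).trans
          (Nat.add_le_add_left Finset.card_image_le _))
      intro G hG
      rw [Finset.mem_filter, Finset.mem_powersetCard] at hG
      obtain ⟨⟨hG1, hG2⟩, hG3⟩ := hG
      rw [Finset.mem_union, Finset.mem_filter, Finset.mem_powersetCard, Finset.mem_image]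
      by_cases heG : s(u, v) ∈ G
      · right
        -- the triangle, with its vertices ordered suitably
        have h : ∃ w, G = {s(u, v), s(u, w), s(v, w)} ∧ u ≠ w ∧ v ≠ w := by
          obtain ⟨a, b, c, hab, hac, hbc, rfl⟩ := hG3
          simp only [Finset.mem_insert, Finset.mem_singleton, Sym2.eq_iff] at heG
          rcases heG with (⟨rfl, rfl⟩ | ⟨rfl, rfl⟩) | (⟨rfl, rfl⟩ | ⟨rfl, rfl⟩) |
            (⟨rfl, rfl⟩ | ⟨rfl, rfl⟩)
          · exact ⟨c, rfl, hac, hbc⟩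
          · exact ⟨c, by rw [Sym2.eq_swap, Finset.pair_comm], hbc, hac⟩
          · refine ⟨b, ?_, hab, hbc.symm⟩
            rw [Finset.insert_comm, Sym2.eq_swap (a := v)]
          · refine ⟨b, ?_, hbc.symm, hab⟩
            ext x; simp only [Finset.mem_insert, Finset.mem_singleton, Sym2.eq_swap (a := u)]; tauto
          · refine ⟨a, ?_, hab.symm, hac.symm⟩
            ext x
            simp only [Finset.mem_insert, Finset.mem_singleton, Sym2.eq_swap (a := a)]; tauto
          · refine ⟨a, ?_, hac.symm, hab.symm⟩
            ext x
            simp only [Finset.mem_insert, Finset.mem_singleton, Sym2.eq_swap (a := a),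
              Sym2.eq_swap (a := u) (b := v)]; tauto
        obtain ⟨w, rfl, huw, hvw⟩ := h
        refine ⟨w, ?_, rfl⟩
        simp only [W, Finset.mem_filter, Finset.mem_univ, true_and]
        constructor
        · refine (Finset.mem_insert.1 (hG1 (by simp : s(u, w) ∈ _))).resolve_left ?_
          simp only [Sym2.eq_iff]; tauto
        · refine (Finset.mem_insert.1 (hG1 (by simp : s(v, w) ∈ _))).resolve_left ?_
          simp only [Sym2.eq_iff]; tauto
      · left
        exact ⟨⟨(Finset.subset_insert_iff_of_notMem heG).1 hG1, hG2⟩, hG3⟩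
    have hnn := cycleRank_nonneg F
    rcases W.eq_empty_or_nonempty with hW | ⟨w, hw⟩
    · have h1 := cycleRank_le_insert s(u, v) F
      rw [hW, Finset.card_empty, add_zero] at htri
      have : (numTri (insert s(u, v) F) : ℤ) ≤ numTri F := by exact_mod_cast htri
      nlinarith
    · have hw' : s(u, w) ∈ F ∧ s(v, w) ∈ F := by simpa [W] using hw
      have h1 : compOf (F : Set (Sym2 V)) u = compOf (F : Set (Sym2 V)) v := by
        have h2 : compOf (F : Set (Sym2 V)) u = compOf _ w := Quot.sound hw'.1
        have h3 : compOf (F : Set (Sym2 V)) v = compOf _ w := Quot.sound hw'.2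
        exact h2.trans h3.symm
      rw [cycleRank_insert_of_eq he h1]
      have h4 := card_le_cycleRank_add_one (F := F) huv W ?_ ?_ (by simp +contextual [W])
        (by simp +contextual [W])
      · have : (numTri (insert s(u, v) F) : ℤ) ≤ numTri F + W.card := by exact_mod_cast htri
        nlinarith
      · intro h
        have : s(u, u) ∈ F ∧ s(v, u) ∈ F := by simpa [W] using h
        exact hFd _ this.1 rfl
      · intro h
        have : s(u, v) ∈ F ∧ s(v, v) ∈ F := by simpa [W] using h
        exact hFd _ this.2 rfl

end CycleRank

/-! ### The first three coefficients of the state polynomial -/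

section StatePolynomial

theorem sum_powerset_ite_card {A : Type*} [DecidableEq A] (s : Finset A) (j : ℕ)
    (h : Finset A → ℤ) :
    ∑ F ∈ s.powerset, (if F.card = j then h F else 0) = ∑ F ∈ s.powersetCard j, h F := by
  rw [← Finset.sum_filter, Finset.powersetCard_eq_filter]

theorem two_mul_choose_two (m : ℕ) : (2 * (m.choose 2 : ℤ)) = m * (m - 1) := by
  have h : (2 * (m.choose 2 : ℚ)) = m * (m - 1) := by
    rw [Nat.cast_choose_two]; ring
  exact_mod_cast h

section

variable {V : Type*} [Fintype V]

/-- The rank of the graph on `V` with edge set `F`. -/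
def edgeRank (F : Finset (Sym2 V)) : ℕ := Fintype.card V - comps (F : Set (Sym2 V))

theorem comps_le_card (F : Set (Sym2 V)) : comps F ≤ Fintype.card V := by
  rw [← Nat.card_eq_fintype_card]
  exact Nat.card_le_card_of_surjective (Quot.mk _) Quot.mk_surjective

theorem comps_pos [Nonempty V] (F : Set (Sym2 V)) : 0 < comps F :=
  Nat.card_pos_iff.2 ⟨⟨Quot.mk _ (Classical.arbitrary V)⟩, inferInstance⟩

theorem edgeRank_eq (F : Finset (Sym2 V)) : (edgeRank F : ℤ) = F.card - cycleRank F := by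
  have := comps_le_card (F : Set (Sym2 V))
  unfold edgeRank cycleRank
  omega

theorem edgeRank_empty : edgeRank (∅ : Finset (Sym2 V)) = 0 := by
  have := edgeRank_eq (∅ : Finset (Sym2 V))
  rw [cycleRank_empty] at this
  simpa using this

end

variable {V E : Type*} [Fintype E] [DecidableEq V] (ends : E → Sym2 V)

/-- The signed number of sets of edges with a given underlying set of simple edges. -/
theorem sum_neg_one_pow_image_eq (F : Finset (Sym2 V)) (hF : F ⊆ Finset.univ.image ends) :
    ∑ S : Finset E with S.image ends = F, (-1 : ℤ) ^ S.card = (-1) ^ F.card := by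
  classical
  induction F using Finset.strongInduction with | _ F ih
  have h1 : ∑ G ∈ F.powerset, ∑ S : Finset E with S.image ends = G, (-1 : ℤ) ^ S.card =
      if F = ∅ then 1 else 0 := by
    have h2 : ∀ S : Finset E, S ∈ (Finset.univ.filter fun x => ends x ∈ F).powerset ↔
        S.image ends ∈ F.powerset := by
      intro S
      rw [Finset.mem_powerset, Finset.mem_powerset, Finset.image_subset_iff]
      simp [Finset.subset_iff]
    have h3 := Finset.sum_fiberwise_of_maps_to
      (s := (Finset.univ.filter fun x => ends x ∈ F).powerset) (t := F.powerset)
      (g := fun S => S.image ends) (fun S hS => (h2 S).1 hS) fun S => (-1 : ℤ) ^ S.card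
    rw [Finset.sum_powerset_neg_one_pow_card] at h3
    have h4 : (Finset.univ.filter fun x => ends x ∈ F) = ∅ ↔ F = ∅ := by
      constructor
      · intro h
        by_contra hne
        obtain ⟨f, hf⟩ := Finset.nonempty_iff_ne_empty.2 hne
        obtain ⟨x, -, rfl⟩ := Finset.mem_image.1 (hF hf)
        exact absurd (h ▸ Finset.mem_filter.2 ⟨Finset.mem_univ x, hf⟩) (Finset.notMem_empty x)
      · rintro rfl; simp
    simp only [h4] at h3
    rw [← h3]
    refine Finset.sum_congr rfl fun G hG => Finset.sum_congr ?_ fun _ _ => rfl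
    ext S
    rw [Finset.mem_filter, Finset.mem_filter, h2]
    constructor
    · rintro ⟨-, rfl⟩; exact ⟨hG, rfl⟩
    · rintro ⟨-, rfl⟩; exact ⟨Finset.mem_univ _, rfl⟩
  have h5 := Finset.sum_powerset_neg_one_pow_card (x := F)
  rw [← h5, ← Finset.sum_erase_add _ _ (Finset.mem_powerset_self F),
    ← Finset.sum_erase_add _ _ (Finset.mem_powerset_self F)] at h1
  have h6 : ∑ G ∈ F.powerset.erase F, ∑ S : Finset E with S.image ends = G, (-1 : ℤ) ^ S.card =
      ∑ G ∈ F.powerset.erase F, (-1 : ℤ) ^ G.card := by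
    refine Finset.sum_congr rfl fun G hG => ?_
    rw [Finset.mem_erase, Finset.mem_powerset] at hG
    exact ih G (hG.2.ssubset_of_ne hG.1) (hG.2.trans hF)
  rw [h6] at h1
  exact add_left_cancel h1

/-- The multiplicity of an edge. -/
def mult (f : Sym2 V) : ℕ := (Finset.univ.filter fun x => ends x = f).card

theorem sum_neg_one_pow_mul_card (f : Sym2 V) :
    ∑ S : Finset E with S.image ends = {f}, (-1 : ℤ) ^ S.card * S.card =
      if mult ends f = 1 then -1 else 0 := by
  set X : Finset E := Finset.univ.filter fun x => ends x = f with hX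
  have h1 : ∑ S : Finset E with S.image ends = {f}, (-1 : ℤ) ^ S.card * S.card =
      ∑ S ∈ X.powerset, (-1 : ℤ) ^ S.card * S.card := by
    refine Finset.sum_subset ?_ ?_
    · intro S hS
      rw [Finset.mem_filter] at hS
      rw [Finset.mem_powerset]
      intro x hx
      have := hS.2 ▸ Finset.mem_image_of_mem ends hx
      rw [Finset.mem_singleton] at this
      simp [hX, this]
    · intro S hS hS'
      rcases S.eq_empty_or_nonempty with rfl | hne
      · simp
      · refine absurd (Finset.mem_filter.2 ⟨Finset.mem_univ _, ?_⟩) hS'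
        rw [Finset.mem_powerset] at hS
        refine (Finset.eq_singleton_iff_nonempty_unique_mem.2 ⟨hne.image _, ?_⟩)
        intro y hy
        obtain ⟨x, hx, rfl⟩ := Finset.mem_image.1 hy
        exact (Finset.mem_filter.1 (hS hx)).2
  rw [h1]
  -- The derivative of `∑ X ^ |S| = (1 + X) ^ μ` at `-1`.
  have h2 : ∑ S ∈ X.powerset, (Polynomial.X : Polynomial ℤ) ^ S.card =
      (Polynomial.X + 1) ^ X.card := by
    have := Finset.sum_pow_mul_eq_add_pow (Polynomial.X : Polynomial ℤ) 1 X
    simpa using this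
  have h3 := congrArg (fun p => Polynomial.eval (-1) (Polynomial.derivative p)) h2
  simp only [Polynomial.derivative_sum, Polynomial.eval_finsetSum,
    Polynomial.derivative_pow, Polynomial.derivative_add, Polynomial.derivative_X,
    Polynomial.derivative_one, Polynomial.eval_mul, Polynomial.eval_pow, Polynomial.eval_add,
    Polynomial.eval_X, Polynomial.eval_one, Polynomial.eval_C, add_zero, mul_one,
    neg_add_cancel] at h3
  have h4 : ∀ S : Finset E, (-1 : ℤ) ^ S.card * S.card = -(S.card * (-1) ^ (S.card - 1)) := by
    intro S
    rcases Nat.eq_zero_or_pos S.card with h | h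
    · simp [h]
    · obtain ⟨k, hk⟩ := Nat.exists_eq_add_of_lt h
      rw [hk]; simp [pow_succ]; ring
  rw [Finset.sum_congr rfl fun S _ => h4 S, Finset.sum_neg_distrib, h3]
  change -((X.card : ℤ) * 0 ^ (X.card - 1)) = if X.card = 1 then -1 else 0
  split_ifs with h
  · simp [h]
  · rcases Nat.eq_zero_or_pos X.card with h0 | h0
    · simp [h0]
    · rw [zero_pow (by omega)]; simp

variable {ends} in
theorem not_isDiag_of_mem_image (hd : ∀ x, ¬ (ends x).IsDiag) {F : Finset (Sym2 V)}
    (hF : F ⊆ Finset.univ.image ends) (e : Sym2 V) (he : e ∈ F) : ¬ e.IsDiag := by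
  obtain ⟨x, -, rfl⟩ := Finset.mem_image.1 (hF he)
  exact hd x

theorem IsTri.card {F : Finset (Sym2 V)} (h : IsTri F) : F.card = 3 := by
  obtain ⟨a, b, c, hab, hac, hbc, rfl⟩ := h
  refine Finset.card_eq_three.2 ⟨_, _, _, ?_, ?_, ?_, rfl⟩ <;>
  · simp only [ne_eq, Sym2.eq_iff]; tauto

variable [Fintype V]

/-- The polynomial `∑_S (-1)^(|S| + |V| + 1) X^r(S) (1 + X)^(|S| + 2 k(S) - |V| - 1)` of a
multigraph, where `S` runs through the sets of edges, and `r(S)` and `k(S)` are the rank and the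
number of components of `S`. -/
def statePoly : Polynomial ℤ :=
  ∑ S : Finset E, (-1) ^ (S.card + Fintype.card V + 1) *
    (Polynomial.X ^ edgeRank (S.image ends) *
      (1 + Polynomial.X) ^ (S.card + 2 * comps (ends '' S) - Fintype.card V - 1))

/-- The contribution to a coefficient of the sets of edges with a given underlying set of simple
edges. -/
def contribution (i : ℕ) (F : Finset (Sym2 V)) : ℤ :=
  ∑ S : Finset E with S.image ends = F, (-1) ^ S.card *
    if edgeRank F ≤ i then
      ((S.card + 2 * comps (F : Set (Sym2 V)) - Fintype.card V - 1).choose (i - edgeRank F) : ℤ)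
    else 0

theorem coeff_statePoly (i : ℕ) : (statePoly ends).coeff i = (-1) ^ (Fintype.card V + 1) *
    ∑ F ∈ (Finset.univ.image ends).powerset, contribution ends i F := by
  unfold statePoly contribution
  rw [Polynomial.finsetSum_coeff, Finset.mul_sum,
    ← Finset.sum_fiberwise_of_maps_to (s := Finset.univ) (g := fun S : Finset E => S.image ends)
      (t := (Finset.univ.image ends).powerset)
      fun S _ => Finset.mem_powerset.2 (Finset.image_subset_image (Finset.subset_univ S))]
  refine Finset.sum_congr rfl fun F _ => ?_
  rw [Finset.mul_sum]
  refine Finset.sum_congr rfl fun S hS => ?_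
  rw [Finset.mem_filter] at hS
  obtain ⟨-, rfl⟩ := hS
  have h1 : ((-1) ^ (S.card + Fintype.card V + 1) : Polynomial ℤ) =
      Polynomial.C ((-1) ^ (S.card + Fintype.card V + 1)) := by simp
  rw [h1, Polynomial.coeff_C_mul, Polynomial.coeff_X_pow_mul', Polynomial.coeff_one_add_X_pow,
    Finset.coe_image, add_assoc, pow_add]
  ring

variable {ends}

theorem contribution_eq_zero {i : ℕ} {F : Finset (Sym2 V)} (h : i < edgeRank F) :
    contribution ends i F = 0 := by
  unfold contribution
  simp [Nat.not_le.2 h]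

theorem contribution_rank {F : Finset (Sym2 V)} (hF : F ⊆ Finset.univ.image ends) :
    contribution ends (edgeRank F) F = (-1) ^ F.card := by
  unfold contribution
  simpa using sum_neg_one_pow_image_eq ends F hF

theorem contribution_empty (i : ℕ) :
    contribution ends i ∅ = ((Fintype.card V - 1).choose i : ℤ) := by
  unfold contribution
  have : (Finset.univ.filter fun S : Finset E => S.image ends = ∅) = {∅} := by
    ext S; simp
  rw [this, Finset.sum_singleton, edgeRank_empty, Finset.coe_empty, comps_empty]
  simp [Nat.card_eq_fintype_card, two_mul]

theorem edgeRank_singleton {f : Sym2 V} (hf : ¬ f.IsDiag) : edgeRank {f} = 1 := by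
  have := edgeRank_eq {f}
  rw [cycleRank_singleton hf] at this
  simpa using this

theorem contribution_singleton [Nonempty V] {f : Sym2 V} (hf : ¬ f.IsDiag)
    (hF : f ∈ Finset.univ.image ends) :
    contribution ends 2 {f} = 2 - Fintype.card V + if 2 ≤ mult ends f then 1 else 0 := by
  unfold contribution
  have h1 := cycleRank_singleton hf
  have h2 := comps_pos (({f} : Finset (Sym2 V)) : Set (Sym2 V))
  unfold cycleRank at h1
  rw [Finset.card_singleton] at h1
  rw [edgeRank_singleton hf]
  have h3 : ∀ S ∈ Finset.univ.filter fun S : Finset E => S.image ends = {f},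
      ((-1 : ℤ) ^ S.card * if 1 ≤ 2 then ((S.card + 2 * comps (({f} : Finset (Sym2 V)) :
        Set (Sym2 V)) - Fintype.card V - 1).choose (2 - 1) : ℤ) else 0) =
      (-1 : ℤ) ^ S.card * S.card + (-1 : ℤ) ^ S.card * (Fintype.card V - 3) := by
    intro S hS
    have hne : S.Nonempty := by
      rw [Finset.mem_filter] at hS
      rw [← Finset.image_nonempty (f := ends), hS.2]
      exact Finset.singleton_nonempty f
    have := hne.card_pos
    rw [if_pos (by decide), ← mul_add, show 2 - 1 = 1 from rfl, Nat.choose_one_right]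
    congr 1
    omega
  rw [Finset.sum_congr rfl h3, Finset.sum_add_distrib, sum_neg_one_pow_mul_card, ← Finset.sum_mul,
    sum_neg_one_pow_image_eq ends {f} (by simpa using hF), Finset.card_singleton]
  have h4 : 0 < mult ends f := by
    obtain ⟨x, -, rfl⟩ := Finset.mem_image.1 hF
    exact Finset.card_pos.2 ⟨x, by simp⟩
  split_ifs <;> omega

theorem edgeRank_pair {F : Finset (Sym2 V)} (hF : ∀ e ∈ F, ¬ e.IsDiag) (h : F.card = 2) :
    edgeRank F = 2 := by
  have h1 := edgeRank_eq F
  obtain ⟨e, f, hef, rfl⟩ := Finset.card_eq_two.1 h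
  rw [cycleRank_pair (hF _ (by simp)) (hF _ (by simp)), h] at h1
  omega

theorem IsTri.edgeRank {F : Finset (Sym2 V)} (h : IsTri F) : edgeRank F = 2 := by
  have h1 := edgeRank_eq F
  rw [h.card, h.cycleRank] at h1
  omega

theorem three_le_edgeRank {F : Finset (Sym2 V)} (hF : ∀ e ∈ F, ¬ e.IsDiag) (h : 3 ≤ F.card)
    (hT : ¬ IsTri F) : 3 ≤ edgeRank F := by
  have h1 := edgeRank_eq F
  have h2 := cycleRank_add_three_le hF h hT
  omega

theorem coeff_zero_statePoly (hd : ∀ x, ¬ (ends x).IsDiag) :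
    (statePoly ends).coeff 0 = (-1) ^ (Fintype.card V + 1) := by
  rw [coeff_statePoly, Finset.sum_eq_single ∅, contribution_empty]
  · simp
  · intro F hF hne
    rw [Finset.mem_powerset] at hF
    have hFd := not_isDiag_of_mem_image hd hF
    apply contribution_eq_zero
    have hc := Finset.card_pos.2 (Finset.nonempty_iff_ne_empty.2 hne)
    by_cases h1 : F.card = 1
    · obtain ⟨f, rfl⟩ := Finset.card_eq_one.1 h1
      rw [edgeRank_singleton (hFd f (by simp))]; decide
    by_cases h2 : F.card = 2
    · rw [edgeRank_pair hFd h2]; decide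
    by_cases h3 : IsTri F
    · rw [h3.edgeRank]; decide
    · have := three_le_edgeRank hFd (by omega) h3; omega
  · simp

theorem coeff_one_statePoly [Nonempty V] (hd : ∀ x, ¬ (ends x).IsDiag) :
    (statePoly ends).coeff 1 = (-1) ^ (Fintype.card V + 1) *
      (Fintype.card V - 1 - (Finset.univ.image ends).card) := by
  have hV : 0 < Fintype.card V := Fintype.card_pos
  have h : ∀ F ∈ (Finset.univ.image ends).powerset, contribution ends 1 F =
      (if F.card = 0 then (Fintype.card V - 1 : ℤ) else 0) + if F.card = 1 then -1 else 0 := by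
    intro F hF
    rw [Finset.mem_powerset] at hF
    have hFd := not_isDiag_of_mem_image hd hF
    by_cases h0 : F.card = 0
    · rw [Finset.card_eq_zero] at h0
      rw [h0, contribution_empty]
      simp [Nat.cast_sub hV]
    by_cases h1 : F.card = 1
    · obtain ⟨f, rfl⟩ := Finset.card_eq_one.1 h1
      have := contribution_rank hF
      rw [edgeRank_singleton (hFd f (by simp))] at this
      rw [this]; simp
    rw [if_neg h0, if_neg h1, contribution_eq_zero, add_zero]
    by_cases h2 : F.card = 2
    · rw [edgeRank_pair hFd h2]; decide
    by_cases h3 : IsTri F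
    · rw [h3.edgeRank]; decide
    · have := three_le_edgeRank hFd (by omega) h3; omega
  rw [coeff_statePoly, Finset.sum_congr rfl h, Finset.sum_add_distrib, sum_powerset_ite_card,
    sum_powerset_ite_card, Finset.powersetCard_zero, Finset.sum_singleton, Finset.sum_const,
    Finset.card_powersetCard, Nat.choose_one_right]
  simp; ring

/-- The third coefficient, in terms of the cycle rank `|Ẽ| - |V| + 1`, the number of multiple edges
and the number of triangles of the underlying simple graph. -/
theorem coeff_two_statePoly [Nonempty V] (hd : ∀ x, ¬ (ends x).IsDiag) :
    2 * (statePoly ends).coeff 2 = (-1) ^ (Fintype.card V + 1) *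
      (((Finset.univ.image ends).card - Fintype.card V + 1) *
          ((Finset.univ.image ends).card - Fintype.card V + 2) +
        2 * ((Finset.univ.image ends).filter fun f => 2 ≤ mult ends f).card -
        2 * numTri (Finset.univ.image ends)) := by
  classical
  have hV : 0 < Fintype.card V := Fintype.card_pos
  have h : ∀ F ∈ (Finset.univ.image ends).powerset, contribution ends 2 F =
      (if F.card = 0 then ((Fintype.card V - 1).choose 2 : ℤ) else 0) +
      (if F.card = 1 then ∑ f ∈ F, (2 - (Fintype.card V : ℤ) + if 2 ≤ mult ends f then 1 else 0) else 0) +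
      (if F.card = 2 then 1 else 0) + (if F.card = 3 then (if IsTri F then -1 else 0) else 0) := by
    intro F hF
    rw [Finset.mem_powerset] at hF
    have hFd := not_isDiag_of_mem_image hd hF
    by_cases h0 : F.card = 0
    · rw [Finset.card_eq_zero] at h0
      rw [h0, contribution_empty]
      simp
    by_cases h1 : F.card = 1
    · obtain ⟨f, rfl⟩ := Finset.card_eq_one.1 h1
      rw [contribution_singleton (hFd f (by simp)) (hF (by simp))]
      simp
    by_cases h2 : F.card = 2
    · have := contribution_rank hF
      rw [edgeRank_pair hFd h2] at this
      rw [this]; simp [h2]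
    by_cases hT : IsTri F
    · have := contribution_rank hF
      rw [hT.edgeRank] at this
      rw [this]; simp [hT, hT.card]
    · rw [contribution_eq_zero]
      · simp [h0, h1, h2, hT]
      · have := three_le_edgeRank hFd (by omega) hT; omega
  rw [coeff_statePoly, Finset.sum_congr rfl h, Finset.sum_add_distrib, Finset.sum_add_distrib,
    Finset.sum_add_distrib, sum_powerset_ite_card, sum_powerset_ite_card, sum_powerset_ite_card,
    sum_powerset_ite_card, Finset.powersetCard_zero, Finset.sum_singleton, Finset.powersetCard_one,
    Finset.sum_map, Finset.sum_const, Finset.card_powersetCard]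
  have h3 : ∑ G ∈ (Finset.univ.image ends).powersetCard 3, (if IsTri G then (-1 : ℤ) else 0) =
      - numTri (Finset.univ.image ends) := by
    rw [← Finset.sum_filter, Finset.sum_const]
    simp only [numTri, mul_neg, mul_one, nsmul_eq_mul]
  rw [h3]
  simp only [Function.Embedding.coeFn_mk, Finset.sum_singleton, Finset.sum_add_distrib,
    Finset.sum_const, Finset.card_singleton, nsmul_eq_mul, mul_one]
  rw [← Finset.sum_filter, Finset.sum_const, nsmul_eq_mul, mul_one]
  have h4 := two_mul_choose_two (Fintype.card V - 1)
  have h5 := two_mul_choose_two (Finset.univ.image ends).card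
  rw [Nat.cast_sub hV] at h4
  push_cast at h4 ⊢
  linear_combination ((-1) ^ (Fintype.card V + 1)) * (h4 + h5)

end StatePolynomial

namespace CrossingMap

variable {D : CrossingMap}

/-! ### The Seifert state -/

open Classical in
/-- The state in which every crossing is smoothed consistently with the orientation. -/
def seifertState (D : CrossingMap) (x : Fin D.n) : Bool := decide (D.sign x = 1)

/-- The arcs of the Seifert state respect the orientation. -/
theorem dir_smooth_seifertState (hD : Subsingleton D.Component) (d e : D.Dart) :
    dir (D.smooth D.seifertState d) = dir e ↔ dir d ≠ dir e := by
  rw [← dir_opp_eq_iff hD]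
  suffices h : dir (D.smooth D.seifertState d) = dir (D.opp d) by rw [h]
  have hc : Caps D.seifertState d ↔ dir d ≠ dir (D.rot d) := by
    unfold Caps seifertState
    rw [decide_eq_true_iff, sign_eq_one_iff hD]
    tauto
  by_cases h : Caps D.seifertState d
  · rw [smooth_of_caps h, eq_comm, dir_opp_eq_iff hD]
    exact hc.1 h
  · rw [smooth_of_not_caps h, ← opp_rot]
    exact (dir_opp_eq (not_not.1 (mt hc.2 h))).symm

theorem card_dart : Nat.card D.Dart = 4 * D.n := by
  rw [Nat.card_prod, Nat.card_eq_fintype_card, Fintype.card_fin, Nat.card_eq_fintype_card,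
    ZMod.card, mul_comm]

/-- The number of Seifert circles of a knot diagram has the opposite parity to the number of
crossings. -/
theorem even_circles_seifertState (hD : Subsingleton D.Component) :
    Even (D.circles D.seifertState + D.n + 1) := by
  classical
  rw [circles_eq_loops]
  by_cases hn : D.n = 0
  · have : IsEmpty D.Dart := ⟨fun d => by have := d.1.2; omega⟩
    have h : loops D.glue (D.smooth D.seifertState) = 0 := by
      have : IsEmpty (Quot fun d e : D.Dart => e = D.glue d ∨ e = D.smooth D.seifertState d) :=
        ⟨fun q => by obtain ⟨d⟩ := q; exact this.elim d⟩
      exact Nat.card_of_isEmpty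
    rw [if_pos hn, h, hn]
    decide
  rw [if_neg hn, add_zero]
  obtain ⟨ω⟩ : Nonempty D.Dart := ⟨(⟨0, Nat.pos_of_ne_zero hn⟩, 0)⟩
  -- The darts pointing in one direction are a transversal of the edges, of the strands at the
  -- crossings, and of the arcs of the Seifert state.
  have hZg : ∀ d : D.Dart, dir (D.glue d) = dir ω ↔ ¬ dir d = dir ω := fun d => by
    rw [dir_glue, dir_opp_eq_iff hD]
  have h := even_loops_add D.glue_glue opp_opp (smooth_smooth D.seifertState)
    (Z := fun d => dir d = dir ω) hZg (fun d => dir_opp_eq_iff hD d ω)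
    (fun d => dir_smooth_seifertState hD d ω)
  have h1 : loops D.glue D.opp = 1 :=
    Nat.card_eq_one_iff_unique.2 ⟨hD, ⟨(Quot.mk _ ω : D.Component)⟩⟩
  have h2 : loops D.opp (D.smooth D.seifertState) = D.n := by
    have hr : ∀ d : D.Dart, loopOf D.opp (D.smooth D.seifertState) (D.rot d) =
        loopOf D.opp (D.smooth D.seifertState) d := by
      intro d
      by_cases h : Caps D.seifertState d
      · rw [← smooth_of_caps h, loopOf_right]
      · rw [← opp_rot_symm, loopOf_left, ← smooth_of_not_caps h, loopOf_right]
    have hlift : ∀ x y : D.Dart, y = D.opp x ∨ y = D.smooth D.seifertState x → x.1 = y.1 := by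
      rintro x _ (rfl | rfl) <;> rfl
    rw [← Fintype.card_fin D.n, ← Nat.card_eq_fintype_card]
    refine Nat.card_congr (Equiv.ofBijective (Quot.lift Prod.fst hlift) ⟨?_, fun x =>
      ⟨Quot.mk _ (x, 0), rfl⟩⟩)
    rintro ⟨x⟩ ⟨y⟩ hxy
    change loopOf _ _ x = loopOf _ _ y
    rcases eq_of_fst_eq (d := x) (e := y) hxy.symm with rfl | rfl | rfl | rfl
    · rfl
    · exact (hr x).symm
    · exact (loopOf_left _ _ x).symm
    · rw [← rot_opp, hr, loopOf_left]
  have h3 : Nat.card {d : D.Dart // dir d = dir ω} = 2 * D.n := by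
    have e1 : Nat.card {d : D.Dart // dir d = dir ω} = Nat.card {d : D.Dart // ¬ dir d = dir ω} :=
      Nat.card_congr (D.glue.subtypeEquiv fun d => by rw [hZg, not_not])
    have e2 := Nat.card_congr (Equiv.sumCompl fun d : D.Dart => dir d = dir ω)
    rw [Nat.card_sum, card_dart] at e2
    omega
  rw [h1, h2, h3] at h
  rw [Nat.even_iff] at h ⊢
  omega

end CrossingMap

namespace KnotDiagram

open CrossingMap CheckerboardColoring

variable {D : KnotDiagram} (c : CheckerboardColoring D.toCrossingMap) {b : Bool}

/-- The exponents of the normalised bracket are divisible by four. -/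
theorem four_dvd (hA : D.IsAlternating)
    (ht : ∀ d : D.Dart, Caps (fun _ => true) d ↔ c.color (D.face d) = b) :
    (4 : ℤ) ∣ 3 * D.writhe - (D.n + 2 * Nat.card {F : D.Face // c.color F = b} - 2) := by
  classical
  have h1 := even_circles_seifertState D.single
  let S : Finset (Fin D.n) := {x | ¬ D.sign x = 1}
  have hS : D.seifertState = state true S := by
    funext x
    by_cases h : D.sign x = 1 <;> simp [seifertState, state, S, h]
  have h2 := circles_add_card c hA ht S
  rw [← hS] at h2
  have h3 : D.writhe = D.n - 2 * S.card := by
    have : ∀ x, D.sign x = 1 - 2 * if ¬ D.sign x = 1 then 1 else 0 := by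
      intro x
      unfold sign
      split_ifs <;> simp_all
    unfold writhe
    rw [Finset.sum_congr rfl fun x _ => this x, Finset.sum_sub_distrib, ← Finset.mul_sum,
      ← Finset.sum_filter]
    simp [S]
  rw [h3]
  rw [Nat.even_iff] at h1
  omega

/-! ### The bracket of an alternating diagram -/

theorem state_bijective (t : Bool) : Function.Bijective (state (D := D.toCrossingMap) t) := by
  classical
  refine Function.bijective_iff_has_inverse.2 ⟨fun s => {x | s x ≠ t}, fun S => ?_, fun s => ?_⟩
  · ext x
    by_cases h : x ∈ S <;> cases t <;> simp [state, h]
  · funext x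
    cases h : s x <;> cases t <;> simp [state, h]

theorem prod_state (t : Bool) (S : Finset (Fin D.n)) :
    ∏ x, (T (if state t S x then 1 else -1) : ℤ[T;T⁻¹]) =
      T ((if t then 1 else -1) * (D.n - 2 * S.card)) := by
  have h : ∀ x, (if state t S x then 1 else -1 : ℤ) =
      (if t then 1 else -1) * (1 - 2 * if x ∈ S then 1 else 0) := by
    intro x
    by_cases hx : x ∈ S <;> cases t <;> simp [state, hx]
  have hT : ∀ f : Fin D.n → ℤ, ∏ x, (T (f x) : ℤ[T;T⁻¹]) = T (∑ x, f x) := by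
    intro f
    induction (Finset.univ : Finset (Fin D.n)) using Finset.induction_on with
    | empty => simp
    | insert x s hx ih => rw [Finset.prod_insert hx, Finset.sum_insert hx, T_add, ih]
  rw [hT, Finset.sum_congr rfl fun x _ => h x, ← Finset.mul_sum, Finset.sum_sub_distrib,
    ← Finset.mul_sum, ← Finset.sum_filter]
  simp

open Classical in
/-- The bracket of an alternating diagram is, up to a shift, the state polynomial of either
checkerboard graph. -/
theorem bracket_eq (hA : D.IsAlternating) {t : Bool}
    [Fintype {F : D.Face // c.color F = b}]
    (ht : ∀ d : D.Dart, Caps (fun _ => t) d ↔ c.color (D.face d) = b) {ε : ℤ}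
    (hε : ε = if t then 1 else -1) :
    D.bracket = T (ε * (D.n + 2 * Fintype.card {F : D.Face // c.color F = b} - 2)) *
      (statePoly (c.ends b)).eval₂ C (T (-4 * ε)) := by
  unfold bracket statePoly
  rw [← (state_bijective t).sum_comp, Polynomial.eval₂_finsetSum, Finset.mul_sum]
  refine Finset.sum_congr rfl fun S _ => ?_
  rw [prod_state, ← hε]
  have h1 := circles_add_card c hA ht S
  have h2 := circles_pos (state t S)
  rw [Nat.card_eq_fintype_card] at h1
  have h3 := comps_le_card (c.ends b '' S)
  have h4 : edgeRank (S.image (c.ends b)) =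
      Fintype.card {F : D.Face // c.color F = b} - comps (c.ends b '' S) := by
    rw [edgeRank, Finset.coe_image]
  have h5 : S.card + 2 * comps (c.ends b '' S) - Fintype.card {F : D.Face // c.color F = b} - 1 =
      D.circles (state t S) - 1 := by omega
  have h6 : (- T 2 - T (-2) : ℤ[T;T⁻¹]) = - (T (2 * ε) * (1 + T (-4 * ε))) := by
    rw [mul_add, mul_one, ← T_add]
    cases t <;> subst hε <;> norm_num <;> ring
  have h7 : ((-1) ^ (S.card + Fintype.card {F : D.Face // c.color F = b} + 1) : ℤ[T;T⁻¹]) =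
      (-1) ^ (D.circles (state t S) - 1) := by
    rw [neg_one_pow_eq_pow_mod_two, neg_one_pow_eq_pow_mod_two (n := D.circles _ - 1)]
    congr 1
    omega
  rw [h4, h5, h6]
  simp only [Polynomial.eval₂_mul, Polynomial.eval₂_pow, Polynomial.eval₂_add,
    Polynomial.eval₂_one, Polynomial.eval₂_X, Polynomial.eval₂_neg]
  rw [h7, neg_pow, mul_pow, T_pow, T_pow]
  have h8 : ε * (D.n - 2 * S.card) + ((D.circles (state t S) - 1 : ℕ) : ℤ) * (2 * ε) =
      ε * (D.n + 2 * Fintype.card {F : D.Face // c.color F = b} - 2) +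
      ((Fintype.card {F : D.Face // c.color F = b} - comps (c.ends b '' S) : ℕ) : ℤ) * (-4 * ε) := by
    rw [Nat.cast_sub h3, Nat.cast_sub h2]
    have h1' : (D.circles (state t S) : ℤ) =
      S.card + 2 * comps (c.ends b '' S) - Fintype.card {F : D.Face // c.color F = b} := by omega
    rw [h1']
    push_cast; ring
  have h9 := congrArg (T : ℤ → ℤ[T;T⁻¹]) h8
  rw [T_add, T_add] at h9
  linear_combination ((-1) ^ (D.circles (state t S) - 1) *
    (1 + T (-4 * ε)) ^ (D.circles (state t S) - 1)) * h9

end KnotDiagram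

/-! ### Coefficients of Laurent polynomials -/

theorem LaurentPolynomial.coeff_C_mul_T (a : ℤ) (n k : ℤ) :
    (C a * T n : ℤ[T;T⁻¹]).coeff k = if n = k then a else 0 := by
  rw [← single_eq_C_mul_T, AddMonoidAlgebra.coeff_single, Finsupp.single_apply]

theorem LaurentPolynomial.coeff_T_mul (N : ℤ) (f : ℤ[T;T⁻¹]) (k : ℤ) :
    (T N * f).coeff k = f.coeff (k - N) := by
  induction f using LaurentPolynomial.induction_on' with
  | add p q hp hq => rw [mul_add, AddMonoidAlgebra.coeff_add, AddMonoidAlgebra.coeff_add, Finsupp.add_apply,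
      Finsupp.add_apply, hp, hq]
  | C_mul_T n a =>
    rw [mul_left_comm, ← T_add, coeff_C_mul_T, coeff_C_mul_T]
    congr 1
    rw [eq_iff_iff]; omega

theorem LaurentPolynomial.coeff_C_mul (a : ℤ) (f : ℤ[T;T⁻¹]) (k : ℤ) :
    (C a * f).coeff k = a * f.coeff k := by
  induction f using LaurentPolynomial.induction_on' with
  | add p q hp hq => rw [mul_add, AddMonoidAlgebra.coeff_add, AddMonoidAlgebra.coeff_add, Finsupp.add_apply,
      Finsupp.add_apply, hp, hq, mul_add]
  | C_mul_T n b =>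
    rw [← mul_assoc, ← map_mul, coeff_C_mul_T, coeff_C_mul_T]
    split_ifs <;> simp

theorem Polynomial.coeff_toLaurent_natCast (p : Polynomial ℤ) (i : ℕ) :
    (toLaurent p).coeff (i : ℤ) = p.coeff i := by
  induction p using Polynomial.induction_on' with
  | add p q hp hq =>
    rw [map_add, AddMonoidAlgebra.coeff_add, Finsupp.add_apply, hp, hq, Polynomial.coeff_add]
  | monomial n a =>
    rw [toLaurent_C_mul_T, LaurentPolynomial.coeff_C_mul_T]
    simp [Polynomial.coeff_monomial]

theorem Polynomial.coeff_toLaurent_of_neg (p : Polynomial ℤ) {k : ℤ} (hk : k < 0) :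
    (toLaurent p).coeff k = 0 := by
  induction p using Polynomial.induction_on' with
  | add p q hp hq => rw [map_add, AddMonoidAlgebra.coeff_add, Finsupp.add_apply, hp, hq, add_zero]
  | monomial n a =>
    rw [← Polynomial.C_mul_X_pow_eq_monomial, toLaurent_C_mul_X_pow, LaurentPolynomial.coeff_C_mul_T,
      if_neg (by omega)]

/-- The substitution `t = A⁻⁴`. -/
abbrev jonesSubst : ℤ[T;T⁻¹] →+* ℤ[T;T⁻¹] :=
  LaurentPolynomial.eval₂ (C : ℤ →+* ℤ[T;T⁻¹]) (isUnit_T (-4)).unit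

theorem jonesSubst_T (N : ℤ) : jonesSubst (T N) = T (-4 * N) := by
  have h : ∀ n : ℕ, jonesSubst (T n) = T (-4 * n) := by
    intro n
    rw [eval₂_T_n, IsUnit.unit_spec, T_pow, mul_comm]
  obtain ⟨n, rfl | rfl⟩ := Int.eq_nat_or_neg N
  · exact h n
  · have h1 : jonesSubst (T (-(n : ℤ))) * jonesSubst (T n) = 1 := by
      rw [← map_mul, ← T_add, neg_add_cancel, T_zero, map_one]
    rw [h] at h1
    calc jonesSubst (T (-(n : ℤ))) = jonesSubst (T (-(n : ℤ))) * T (-4 * n) * T (-4 * -n) := by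
          rw [mul_assoc, ← T_add, show (-4 * n + -4 * -n : ℤ) = 0 by ring, T_zero, mul_one]
      _ = T (-4 * -n) := by rw [h1, one_mul]

theorem coeff_jonesSubst (f : ℤ[T;T⁻¹]) (k : ℤ) : (jonesSubst f).coeff (-4 * k) = f.coeff k := by
  induction f using LaurentPolynomial.induction_on' with
  | add p q hp hq => rw [map_add, AddMonoidAlgebra.coeff_add, AddMonoidAlgebra.coeff_add, Finsupp.add_apply,
      Finsupp.add_apply, hp, hq]
  | C_mul_T n a =>
    rw [map_mul jonesSubst, jonesSubst_T, LaurentPolynomial.eval₂_C, LaurentPolynomial.coeff_C_mul_T,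
      LaurentPolynomial.coeff_C_mul_T]
    congr 1
    rw [eq_iff_iff]; omega

theorem jonesSubst_injective : Function.Injective jonesSubst := by
  intro f g h
  ext k
  rw [← coeff_jonesSubst f, ← coeff_jonesSubst g, h]

theorem jonesSubst_toLaurent (p : Polynomial ℤ) :
    jonesSubst (Polynomial.toLaurent p) = p.eval₂ C (T (-4)) := by
  rw [LaurentPolynomial.eval₂_toLaurent, IsUnit.unit_spec]

theorem jonesSubst_invert_toLaurent (p : Polynomial ℤ) :
    jonesSubst (invert (Polynomial.toLaurent p)) = p.eval₂ C (T 4) := by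
  induction p using Polynomial.induction_on' with
  | add p q hp hq => simp only [map_add, hp, hq, Polynomial.eval₂_add]
  | monomial n a =>
    rw [← Polynomial.C_mul_X_pow_eq_monomial, Polynomial.toLaurent_C_mul_X_pow, map_mul, invert_C,
      invert_T, map_mul, jonesSubst_T, LaurentPolynomial.eval₂_C, Polynomial.eval₂_mul,
      Polynomial.eval₂_C, Polynomial.eval₂_X_pow, T_pow]
    congr 2; ring

namespace CheckerboardColoring

open CrossingMap

variable {D : CrossingMap} (c : CheckerboardColoring D) {b : Bool}

/-! ### The checkerboard graphs -/

theorem isLink_iff (x : Fin D.n) (F H : (c.graph b).vertexSet) :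
    (c.graph b).IsLink x F H ↔ c.ends b x = s(F, H) := by
  constructor
  · rintro ⟨i, hi, hF, hH⟩
    rw [← c.region_region_opp (x, i)]
    refine congrArg₂ _ (Subtype.ext ?_) (Subtype.ext ?_)
    · rw [region_of_eq c hi]; exact hF
    · rw [region_of_eq c ((c.color_opp _).trans hi)]; exact hH
  · intro h
    obtain ⟨i, hi⟩ : ∃ i, c.color (D.face (x, i)) = b := by
      by_cases h0 : c.color (D.face (x, 0)) = b
      · exact ⟨0, h0⟩
      · refine ⟨(D.rot (x, 0)).2, ?_⟩
        refine (c.color_rot (x, 0)).trans (Bool.eq_not_of_ne (Ne.symm h0)).symm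
    rw [← c.region_region_opp (x, i)] at h
    have e1 := region_of_eq c hi
    have e2 := region_of_eq c ((c.color_opp (x, i)).trans hi)
    have hl : (c.graph b).IsLink x (D.face (x, i)) (D.face (D.opp (x, i))) := ⟨i, hi, rfl, rfl⟩
    rcases Sym2.eq_iff.1 h with ⟨h1, h2⟩ | ⟨h1, h2⟩
    · have h1 := congrArg Subtype.val h1
      have h2 := congrArg Subtype.val h2
      rw [e1] at h1
      rw [e2] at h2
      rw [← h1, ← h2]
      exact hl
    · have h1 := congrArg Subtype.val h1
      have h2 := congrArg Subtype.val h2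
      rw [e1] at h1
      rw [e2] at h2
      rw [← h1, ← h2]
      exact hl.symm

/-- The checkerboard graphs of a reduced diagram have no loops. -/
theorem not_isDiag_ends (hR : D.IsReduced) (x : Fin D.n) : ¬ (c.ends b x).IsDiag := by
  have key : ∀ d : D.Dart, c.color (D.face d) = b → ¬ (c.ends b d.1).IsDiag := by
    intro d hd h
    rw [← c.region_region_opp d, Sym2.mk_isDiag_iff] at h
    have h := congrArg Subtype.val h
    rw [region_of_eq c hd, region_of_eq c ((c.color_opp d).trans hd)] at h
    exact hR d h
  by_cases h0 : c.color (D.face (x, 0)) = b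
  · exact key (x, 0) h0
  · exact key (D.rot (x, 0)) ((c.color_rot (x, 0)).trans (Bool.eq_not_of_ne (Ne.symm h0)).symm)

open Classical

theorem edgeSet_eq (hR : D.IsReduced) : (c.graph b).toSimpleGraph.edgeSet =
    (↑(Finset.univ.image (c.ends b)) : Set (Sym2 {F : D.Face // c.color F = b})) := by
  ext e
  induction e with | _ F H
  rw [SimpleGraph.mem_edgeSet, Finset.coe_image, Finset.coe_univ, Set.image_univ]
  constructor
  · rintro ⟨-, x, hx⟩
    exact ⟨x, (c.isLink_iff x F H).1 hx⟩
  · rintro ⟨x, hx⟩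
    refine ⟨?_, x, (c.isLink_iff x F H).2 hx⟩
    have := c.not_isDiag_ends (b := b) hR x
    rw [hx] at this
    exact fun h => this h

theorem numSimpleEdges_eq (hR : D.IsReduced) :
    (c.graph b).numSimpleEdges = (Finset.univ.image (c.ends b)).card := by
  unfold Graph.numSimpleEdges
  rw [edgeSet_eq c hR]
  exact Set.ncard_coe_finset _

theorem multiplicity_eq (e : Sym2 (c.graph b).vertexSet) :
    (c.graph b).multiplicity e = mult (c.ends b) e := by
  unfold Graph.multiplicity mult
  rw [← Set.ncard_coe_finset]
  congr 1
  ext x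
  simp only [Set.mem_ofPred_eq, Finset.coe_filter, Finset.mem_univ, true_and]
  induction e with | _ F H
  constructor
  · rintro ⟨u, v, he, hl⟩
    rw [he]; exact (c.isLink_iff x u v).1 hl
  · intro h
    exact ⟨F, H, rfl, (c.isLink_iff x F H).2 h⟩

theorem numMultiple_eq (hR : D.IsReduced) : (c.graph b).numMultiple 2 =
    ((Finset.univ.image (c.ends b)).filter fun f => 2 ≤ mult (c.ends b) f).card := by
  unfold Graph.numMultiple
  rw [edgeSet_eq c hR, ← Set.ncard_coe_finset]
  congr 1
  ext e
  rw [Finset.coe_filter]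
  simp only [multiplicity_eq]
  rfl

end CheckerboardColoring

/-- The triangles of a simple graph, counted by their edges. -/
theorem SimpleGraph.ncard_cliqueSet_three {V : Type*} [Fintype V] [DecidableEq V]
    (G : SimpleGraph V) (E : Finset (Sym2 V)) (hE : G.edgeSet = E) :
    (G.cliqueSet 3).ncard = numTri E := by
  classical
  have hadj : ∀ a b, G.Adj a b ↔ s(a, b) ∈ E := by
    intro a b
    rw [← SimpleGraph.mem_edgeSet, hE, Finset.mem_coe]
  have hmem : ∀ {a b c : V} (e : Sym2 V), a ≠ b → a ≠ c → b ≠ c →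
      (e ∈ ({a, b, c} : Finset V).sym2.filter (fun e => ¬ e.IsDiag) ↔
        e ∈ ({s(a, b), s(a, c), s(b, c)} : Finset (Sym2 V))) := by
    intro a b c e hab hac hbc
    induction e with | _ x y
    simp only [Finset.mem_filter, Finset.mk_mem_sym2_iff, Finset.mem_insert, Finset.mem_singleton,
      Sym2.mk_isDiag_iff, Sym2.eq_iff]
    constructor
    · rintro ⟨⟨rfl | rfl | rfl, rfl | rfl | rfl⟩, h⟩ <;> simp_all
    · rintro ((⟨rfl, rfl⟩ | ⟨rfl, rfl⟩) | (⟨rfl, rfl⟩ | ⟨rfl, rfl⟩) | (⟨rfl, rfl⟩ | ⟨rfl, rfl⟩)) <;>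
        simp_all [eq_comm]
  unfold numTri
  rw [← Set.ncard_coe_finset]
  refine Set.ncard_congr (fun t _ => t.sym2.filter fun e => ¬ e.IsDiag) ?_ ?_ ?_
  · intro t ht
    obtain ⟨a, b, c, hab, hac, hbc, rfl⟩ := SimpleGraph.is3Clique_iff.1 ht
    have h : ({a, b, c} : Finset V).sym2.filter (fun e => ¬ e.IsDiag) =
        {s(a, b), s(a, c), s(b, c)} := by
      ext e; exact hmem e hab.ne hac.ne hbc.ne
    have hT : IsTri ({s(a, b), s(a, c), s(b, c)} : Finset (Sym2 V)) :=
      ⟨a, b, c, hab.ne, hac.ne, hbc.ne, rfl⟩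
    rw [h, Finset.mem_coe, Finset.mem_filter, Finset.mem_powersetCard]
    refine ⟨⟨?_, hT.card⟩, hT⟩
    intro e he
    simp only [Finset.mem_insert, Finset.mem_singleton] at he
    rcases he with rfl | rfl | rfl
    exacts [(hadj _ _).1 hab, (hadj _ _).1 hac, (hadj _ _).1 hbc]
  · -- A triangle is determined by its edges.
    have hrec : ∀ t : Finset V, t ∈ G.cliqueSet 3 → ∀ v, v ∈ t ↔
        ∃ e ∈ t.sym2.filter (fun e => ¬ e.IsDiag), v ∈ e := by
      intro t ht v
      obtain ⟨a, b, c, hab, hac, hbc, rfl⟩ := SimpleGraph.is3Clique_iff.1 ht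
      simp only [hmem _ hab.ne hac.ne hbc.ne]
      simp only [Finset.mem_insert, Finset.mem_singleton, exists_eq_or_imp, exists_eq_left,
        Sym2.mem_iff]
      tauto
    intro t t' ht ht' h
    ext v
    rw [hrec t ht, hrec t' ht', h]
  · intro F hF
    rw [Finset.mem_coe, Finset.mem_filter, Finset.mem_powersetCard] at hF
    obtain ⟨⟨hF1, -⟩, a, b, c, hab, hac, hbc, rfl⟩ := hF
    refine ⟨{a, b, c}, SimpleGraph.is3Clique_iff.2 ⟨a, b, c, ?_, ?_, ?_, rfl⟩, ?_⟩
    · exact (hadj _ _).2 (hF1 (by simp))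
    · exact (hadj _ _).2 (hF1 (by simp))
    · exact (hadj _ _).2 (hF1 (by simp))
    · ext e; exact hmem e hab hac hbc

namespace KnotDiagram

open CrossingMap CheckerboardColoring Classical

variable {D : KnotDiagram} (c : CheckerboardColoring D.toCrossingMap) {b : Bool}

/-! ### The Jones polynomial of an alternating knot -/

instance : Fintype {F : D.Face // c.color F = b} := Fintype.ofFinite _

/-- The Jones polynomial of an alternating diagram, expressed by either checkerboard graph. -/
theorem exists_jonesSubst_eq (hA : D.IsAlternating) : ∃ (b : Bool) (N N' σ : ℤ), |σ| = 1 ∧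
    D.normalizedBracket =
      jonesSubst (C σ * (T N * Polynomial.toLaurent (statePoly (c.ends b)))) ∧
    D.normalizedBracket =
      jonesSubst (C σ * (T N' * invert (Polynomial.toLaurent (statePoly (c.ends !b))))) := by
  obtain ⟨b, ht⟩ : ∃ b, ∀ d : D.Dart, Caps (fun _ => true) d ↔ c.color (D.face d) = b := by
    obtain ⟨t, ht⟩ := c.exists_caps D.single hA true
    cases t
    · refine ⟨false, fun d => ?_⟩
      have := ht d
      unfold Caps at this ⊢
      revert this
      cases c.color (D.face d) <;> simp
    · exact ⟨true, ht⟩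
  have ht' : ∀ d : D.Dart, Caps (fun _ => false) d ↔ c.color (D.face d) = !b := by
    intro d
    have := ht d
    unfold Caps at this ⊢
    revert this
    cases b <;> cases c.color (D.face d) <;> simp
  obtain ⟨N, hN⟩ := four_dvd c hA ht
  have hV := c.card_add_card D.planar b
  rw [Nat.card_eq_fintype_card] at hN hV
  rw [Nat.card_eq_fintype_card] at hV
  refine ⟨b, N, N + D.n, (-1) ^ D.writhe.natAbs, by rw [abs_pow]; simp, ?_, ?_⟩
  · rw [map_mul, map_mul, jonesSubst_T, jonesSubst_toLaurent, LaurentPolynomial.eval₂_C,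
      normalizedBracket, bracket_eq c hA ht rfl, map_pow, map_neg, map_one, ← mul_assoc, ← mul_assoc,
      mul_assoc _ (T _) (T _), ← T_add]
    congr 3
    simp only [if_true]
    linear_combination -hN
  · rw [map_mul, map_mul, jonesSubst_T, jonesSubst_invert_toLaurent, LaurentPolynomial.eval₂_C,
      normalizedBracket, bracket_eq c hA ht' rfl, map_pow, map_neg, map_one, ← mul_assoc, ← mul_assoc,
      mul_assoc _ (T _) (T _), ← T_add]
    congr 3
    have hV' : (Fintype.card {F : D.Face // c.color F = b} : ℤ) +
      Fintype.card {F : D.Face // c.color F = !b} = D.n + 2 := by exact_mod_cast hV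
    simp only [Bool.false_eq_true, if_false]
    linear_combination -hN - 2 * hV'

/-- The cycle rank of the underlying simple graph of a checkerboard graph. -/
def rank (b : Bool) : ℤ := cycleRank (Finset.univ.image (c.ends b))

theorem rank_eq (hR : D.IsReduced) : rank c b =
    (c.graph b).numSimpleEdges + 1 - Fintype.card {F : D.Face // c.color F = b} := by
  rw [numSimpleEdges_eq c hR, rank, cycleRank, Finset.coe_image, Finset.coe_univ, Set.image_univ,
    comps_range]
  push_cast; ring

instance : Nonempty {F : D.Face // c.color F = b} := (Nat.card_pos_iff.1 (c.card_pos b)).1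

theorem abs_coeff_zero (hR : D.IsReduced) : |(statePoly (c.ends b)).coeff 0| = 1 := by
  rw [coeff_zero_statePoly (c.not_isDiag_ends hR), abs_pow]; simp

theorem abs_coeff_one (hR : D.IsReduced) : |(statePoly (c.ends b)).coeff 1| = rank c b := by
  have h := rank_eq c (b := b) hR
  have h0 : 0 ≤ rank c b := cycleRank_nonneg _
  rw [coeff_one_statePoly (c.not_isDiag_ends hR), abs_mul, abs_pow, abs_neg, abs_one, one_pow,
    one_mul, ← numSimpleEdges_eq c hR, abs_sub_comm, abs_of_nonneg] <;> omega

theorem two_mul_abs_coeff_two (hR : D.IsReduced) : 2 * |(statePoly (c.ends b)).coeff 2| =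
    rank c b * (rank c b + 1) + 2 * (c.graph b).numMultiple 2 - 2 * (c.graph b).numTriangles := by
  have h := rank_eq c (b := b) hR
  have hd := c.not_isDiag_ends (b := b) hR
  have h1 := coeff_two_statePoly hd
  have h2 := two_mul_numTri_le (not_isDiag_of_mem_image hd subset_rfl)
  have h3 : (c.graph b).numTriangles = numTri (Finset.univ.image (c.ends b)) :=
    SimpleGraph.ncard_cliqueSet_three (V := {F : D.Face // c.color F = b}) _ _ (edgeSet_eq c hR)
  rw [← numSimpleEdges_eq c hR, ← numMultiple_eq c hR, ← h3] at h1
  rw [← h3] at h2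
  change _ ≤ rank c b * (rank c b + 1) at h2
  have h4 : ((c.graph b).numSimpleEdges - Fintype.card {F : D.Face // c.color F = b} + 1 : ℤ) =
    rank c b := by rw [h]; ring
  have h5 : ((c.graph b).numSimpleEdges - Fintype.card {F : D.Face // c.color F = b} + 2 : ℤ) =
    rank c b + 1 := by rw [h]; ring
  rw [h4, h5] at h1
  have h6 := congrArg abs h1
  rw [abs_mul, abs_mul, abs_pow, abs_neg, abs_one, one_pow, one_mul, abs_two] at h6
  rw [h6, abs_of_nonneg]
  omega

theorem twistNumber_eq (hR : D.IsReduced) : c.twistNumber = rank c true + rank c false := by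
  have h1 := rank_eq c (b := true) hR
  have h2 := rank_eq c (b := false) hR
  have h3 := c.card_add_card D.planar true
  rw [Nat.card_eq_fintype_card, Nat.card_eq_fintype_card] at h3
  have h3' : (Fintype.card {F : D.Face // c.color F = true} : ℤ) +
    Fintype.card {F : D.Face // c.color F = false} = D.n + 2 := by exact_mod_cast h3
  have h4 : (c.graph true).edgeSet.ncard = D.n := by
    change (Set.univ : Set (Fin D.n)).ncard = D.n
    rw [Set.ncard_univ, Nat.card_eq_fintype_card, Fintype.card_fin]
  unfold twistNumber
  rw [h1, h2, h4]
  linear_combination h3'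

/-- The extreme coefficients of the Jones polynomial of a reduced alternating diagram. -/
theorem coeff_jones (hA : D.IsAlternating) (hR : D.IsReduced) {f : ℤ[T;T⁻¹]}
    (hf : jonesSubst f = D.normalizedBracket) :
    ∃ n m : ℤ, IsLeast {k : ℤ | f.coeff k ≠ 0} n ∧ IsGreatest {k : ℤ | f.coeff k ≠ 0} m ∧
      |f.coeff n| = 1 ∧ |f.coeff m| = 1 ∧ |f.coeff (n + 1)| + |f.coeff (m - 1)| = c.twistNumber ∧
      ((|f.coeff (n + 2)| + |f.coeff (m - 2)| + |f.coeff (m - 1)| * |f.coeff (n + 1)| : ℤ) : ℚ) =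
        ((c.twistNumber : ℚ) + (c.twistNumber : ℚ) ^ 2) / 2 +
          (c.graph true).numMultiple 2 + (c.graph false).numMultiple 2 -
          (c.graph true).numTriangles - (c.graph false).numTriangles := by
  obtain ⟨b, N, N', σ, hσ, h1, h2⟩ := exists_jonesSubst_eq c hA
  have hf1 := jonesSubst_injective (hf.trans h1)
  have hf2 := jonesSubst_injective (hf.trans h2)
  have hn : ∀ i : ℕ, |f.coeff (N + i)| = |(statePoly (c.ends b)).coeff i| := by
    intro i
    rw [hf1, coeff_C_mul, coeff_T_mul, add_sub_cancel_left, Polynomial.coeff_toLaurent_natCast,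
      abs_mul, hσ, one_mul]
  have hm : ∀ i : ℕ, |f.coeff (N' - i)| = |(statePoly (c.ends !b)).coeff i| := by
    intro i
    rw [hf2, coeff_C_mul, coeff_T_mul, invert_apply, show -(N' - i - N') = (i : ℤ) by ring,
      Polynomial.coeff_toLaurent_natCast, abs_mul, hσ, one_mul]
  have hn' : ∀ k < N, f.coeff k = 0 := by
    intro k hk
    rw [hf1, coeff_C_mul, coeff_T_mul, Polynomial.coeff_toLaurent_of_neg _ (by omega), mul_zero]
  have hm' : ∀ k > N', f.coeff k = 0 := by
    intro k hk
    rw [hf2, coeff_C_mul, coeff_T_mul, invert_apply, Polynomial.coeff_toLaurent_of_neg _ (by omega),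
      mul_zero]
  have n0 := hn 0
  have n1 := hn 1
  have n2 := hn 2
  have m0 := hm 0
  have m1 := hm 1
  have m2 := hm 2
  rw [abs_coeff_zero c hR] at n0 m0
  rw [abs_coeff_one c hR] at n1 m1
  rw [Nat.cast_zero, add_zero] at n0
  rw [Nat.cast_zero, sub_zero] at m0
  rw [Nat.cast_one] at n1 m1
  rw [Nat.cast_ofNat] at n2 m2
  have n2' := two_mul_abs_coeff_two c (b := b) hR
  have m2' := two_mul_abs_coeff_two c (b := !b) hR
  rw [← n2] at n2'
  rw [← m2] at m2'
  have hT : c.twistNumber = rank c b + rank c !b := by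
    rw [twistNumber_eq c hR]; cases b
    · exact add_comm _ _
    · rfl
  refine ⟨N, N', ⟨?_, ?_⟩, ⟨?_, ?_⟩, n0, m0, by rw [n1, m1, hT], ?_⟩
  · intro h0
    rw [h0] at n0
    simp at n0
  · intro k hk
    by_contra! h
    exact hk (hn' k h)
  · intro h0
    rw [h0] at m0
    simp at m0
  · intro k hk
    by_contra! h
    exact hk (hm' k h)
  · rw [n1, m1, hT]
    have e1 := congrArg (Int.cast : ℤ → ℚ) n2'
    have e2 := congrArg (Int.cast : ℤ → ℚ) m2'
    cases b <;>
    · simp only [Bool.not_true, Bool.not_false] at e1 e2 ⊢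
      push_cast at e1 e2 ⊢
      linear_combination (e1 + e2) / 2

end KnotDiagram

end

theorem mainTheorem2 (K : Knot)
    (hK : ∃ D : KnotDiagram, D.knot = K ∧ D.IsAlternating ∧ D.IsReduced) :
    ∃ (V : LaurentPolynomial ℤ) (n m : ℤ),
      K.IsJonesPolynomial V ∧
      IsLeast {k : ℤ | V.coeff k ≠ 0} n ∧ IsGreatest {k : ℤ | V.coeff k ≠ 0} m ∧
      |V.coeff n| = 1 ∧ |V.coeff m| = 1 ∧
      (∀ D : KnotDiagram, D.knot = K → D.IsAlternating → D.IsReduced →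
        ∀ c : CheckerboardColoring D.toCrossingMap,
          |V.coeff (n + 1)| + |V.coeff (m - 1)| = c.twistNumber ∧
          ((|V.coeff (n + 2)| + |V.coeff (m - 2)| +
              |V.coeff (m - 1)| * |V.coeff (n + 1)| : ℤ) : ℚ) =
            ((c.twistNumber : ℚ) + (c.twistNumber : ℚ) ^ 2) / 2 +
              (c.graph true).numMultiple 2 + (c.graph false).numMultiple 2 -
              (c.graph true).numTriangles - (c.graph false).numTriangles) ∧
      (∀ D₁ D₂ : KnotDiagram, D₁.knot = K → D₂.knot = K →
        D₁.IsAlternating → D₁.IsReduced → D₂.IsAlternating → D₂.IsReduced →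
        ∀ (c₁ : CheckerboardColoring D₁.toCrossingMap) (c₂ : CheckerboardColoring D₂.toCrossingMap),
          c₁.twistNumber = c₂.twistNumber) := by
  obtain ⟨D₀, rfl, hA, hR⟩ := hK
  obtain ⟨c₀⟩ := CheckerboardColoring.nonempty_of_isAlternating hA
  obtain ⟨b, N, -, σ, -, hV, -⟩ := KnotDiagram.exists_jonesSubst_eq c₀ hA
  generalize C σ * (T N * _) = V at hV
  have hinv : ∀ D : KnotDiagram, D.knot = D₀.knot → jonesSubst V = D.normalizedBracket :=
    fun D hD => hV.symm.trans (KnotDiagram.normalizedBracket_eq_of_knot_eq hD).symm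
  obtain ⟨n, m, hn, hm, hn1, hm1, -, -⟩ := KnotDiagram.coeff_jones c₀ hA hR (hinv D₀ rfl)
  have key : ∀ D : KnotDiagram, D.knot = D₀.knot → D.IsAlternating → D.IsReduced →
      ∀ c : CheckerboardColoring D.toCrossingMap,
        |V.coeff (n + 1)| + |V.coeff (m - 1)| = c.twistNumber ∧
        ((|V.coeff (n + 2)| + |V.coeff (m - 2)| +
            |V.coeff (m - 1)| * |V.coeff (n + 1)| : ℤ) : ℚ) =
          ((c.twistNumber : ℚ) + (c.twistNumber : ℚ) ^ 2) / 2 +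
            (c.graph true).numMultiple 2 + (c.graph false).numMultiple 2 -
            (c.graph true).numTriangles - (c.graph false).numTriangles := by
    intro D hD hDA hDR c
    obtain ⟨n', m', hn', hm', -, -, h1, h2⟩ := KnotDiagram.coeff_jones c hDA hDR (hinv D hD)
    obtain rfl := hn'.unique hn
    obtain rfl := hm'.unique hm
    exact ⟨h1, h2⟩
  refine ⟨V, n, m, hinv, hn, hm, hn1, hm1, key, ?_⟩
  intro D₁ D₂ h₁ h₂ hA₁ hR₁ hA₂ hR₂ c₁ c₂
  exact (key D₁ h₁ hA₁ hR₁ c₁).1.symm.trans (key D₂ h₂ hA₂ hR₂ c₂).1
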